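/- **Setting.** All vector spaces are over $\mathbb{C}$. $\mathbf{SVect}$ is the category of super-vector spaces and even linear maps, with super-flip $\tau_{V,W}(v\otimes w)=(-1)^{|v||w|}w\otimes v$; $\omega_V(v)=(-1)^{|v|}v$ is the parity involution; associators of $\mathbf{SVect}$ are not written. Let $\mathfrak h$ be a finite-dimensional purely odd abelian Lie super-algebra with a non-degenerate supersymmetric (that is, since $\mathfrak h$ is odd, skew-symmetric) pairing $(-,-)$. Put $N=\tfrac12\dim\mathfrak h$ (an integer), choose bases $\{\alpha^i\},\{\beta^i\}$ of $\mathfrak h$ with $(\alpha^i,\beta^j)=\delta_{ij}$, and set $\Omega=\sum_i\beta^i\otimes\alpha^i$. On a tensor product, $\Omega^{(ij)}=\sum_k(\beta^k)^{(i)}\circ(\alpha^k)^{(j)}$, where $a^{(i)}$ denotes $a\in\mathfrak h$ acting on the $i$-th factor with the usual super-signs. Let $U=U(\mathfrak h)$ be the universal enveloping algebra (the exterior algebra of $\mathfrak h$), with product $\mu$, coproduct $\Delta(a)=a\otimes1+1\otimes a$ and antipode $S(a)=-a$ ($a\in\mathfrak h$); $\rho^A:U\otimes A\to A$ is the action on a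 representation $A$. Let $\lambda:U\to\mathbb{C}$ be the linear form which vanishes outside the top degree $2N$ and satisfies $\lambda\big((i\pi\,\Omega^{(11)})^N\big)=(-1)^N\,N!\,(2i)^N$, where $\Omega^{(11)}=\sum_k\beta^k\alpha^k\in U$, and let $$\phi=\big(\mathrm{id}_U\otimes(\lambda\circ\mu)\big)\circ\big(\exp(-\pi i\,\Omega)\otimes\mathrm{id}_U\big):U\to U .$$ Let $\mathcal C=\mathcal C_0+\mathcal C_1$ be the $\mathbb Z/2$-graded category with components $\mathcal C_0=\mathrm{Rep}(\mathfrak h)$ (all representations of $\mathfrak h$ on super-vector spaces, with even intertwiners) and $\mathcal C_1=\mathbf{SVect}$ (objects are those of $\mathcal C_0$ and those of $\mathcal C_1$, with no morphisms between the two components). **Tensor product.** With $F:\mathcal C_0\to\mathbf{SVect}$ the forgetful functor, - $A,B\in\mathcal C_0$: $A*B=A\otimes_{\mathrm{Rep}(\mathfrak h)}B\in\mathcal C_0$; - $A\in\mathcal C_0,\ B\in\mathcal C_1$: $A*B=F(A)\otimes B\in\mathcal C_1$; - $A\in\mathcal C_1,\ B\in\mathcal C_0$: $A*B=A\otimes F(B)\in\mathcal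 C_1$; - $A,B\in\mathcal C_1$: $A*B=U\otimes A\otimes B\in\mathcal C_0$, with $\mathfrak h$ acting by left multiplication on $U$; and correspondingly on morphisms. The unit object is the trivial representation $\mathbf 1=\mathbb{C}^{1|0}\in\mathcal C_0$ with the unit isomorphisms $z\otimes v\mapsto zv$ and $v\otimes z\mapsto zv$. **Associator.** $\alpha_{A,B,C}:A*(B*C)\to(A*B)*C$ is, according to the degrees of $A,B,C$, - $000,\ 001,\ 100$: $\mathrm{id}_{A\otimes B\otimes C}$; - $010$: $\exp(i\pi\,\Omega^{(13)})$ on $A\otimes B\otimes C$; - $101$: $\exp(i\pi\,\Omega^{(13)})$ on $U\otimes A\otimes B\otimes C$; - $011$: $\big[\{\mathrm{id}_U\otimes(\rho^A\circ(S^{-1}\otimes\mathrm{id}_A))\}\circ\{(\tau_{U,U}\circ\Delta)\otimes\mathrm{id}_A\}\circ\tau_{A,U}\big]\otimes\mathrm{id}_{B\otimes C}$; - $110$: $\{\mathrm{id}_{U\otimes A\otimes B}\otimes\rho^C\}\circ\{\mathrm{id}_U\otimes\tau_{U,A\otimes B}\otimes\mathrm{id}_C\}\circ\{\Delta\otimes\mathrm{id}_{A\otimes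 B\otimes C}\}$; - $111$: $\{\phi\otimes\mathrm{id}_{A\otimes B\otimes C}\}\circ\{\tau_{A,U}\otimes\mathrm{id}_{B\otimes C}\}$. **Braiding.** $c_{A,B}:A*B\to B*A$ is - $A\in\mathcal C_0,\ B\in\mathcal C_0$: $\tau_{A,B}\circ\exp(-i\pi\,\Omega^{(12)})$; - $A\in\mathcal C_0,\ B\in\mathcal C_1$: $\tau_{A,B}\circ\exp(\tfrac{i\pi}{2}\,\Omega^{(11)})$; - $A\in\mathcal C_1,\ B\in\mathcal C_0$: $\tau_{A,B}\circ\exp(\tfrac{i\pi}{2}\,\Omega^{(22)})\circ\{\mathrm{id}_A\otimes\omega_B\}$; - $A\in\mathcal C_1,\ B\in\mathcal C_1$: $e^{-i\pi N/4}\,(\mathrm{id}_U\otimes\tau_{A,B})\circ\exp(-\tfrac{i\pi}{2}\,\Omega^{(11)})\circ\{\mathrm{id}_{U\otimes A}\otimes\omega_B\}$. **Theorem.** $(\mathcal C,*,\alpha)$, with the above unit, is a monoidal category, and the family $c_{A,B}$ is a braiding on it: the $c_{A,B}$ are isomorphisms, natural in $A$ and $B$, and for all $A,B,C\in\mathcal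 C$ (in all eight combinations of degrees) the two hexagon identities hold: $$\alpha_{B,C,A}\circ(\mathrm{id}_B*c_{A,C})\circ\alpha_{B,A,C}^{-1}\circ(c_{A,B}*\mathrm{id}_C)\circ\alpha_{A,B,C}=c_{A,B*C},$$ $$\alpha_{C,A,B}\circ c_{A*B,C}\circ\alpha_{A,B,C}=(c_{A,C}*\mathrm{id}_B)\circ\alpha_{A,C,B}\circ(\mathrm{id}_A*c_{B,C}).$$ -/

import Mathlib

universe u

namespace SymplecticFermions

open CategoryTheory TensorProduct

noncomputable section

/-! ### Super-vector spaces -/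

/-- A complex super-vector space: a vector space with a decomposition into an even and an odd
subspace. -/
structure SuperVect : Type (u + 1) where
  carrier : Type u
  [addCommGroup : AddCommGroup carrier]
  [module : Module ℂ carrier]
  even : Submodule ℂ carrier
  odd : Submodule ℂ carrier
  isCompl : IsCompl even odd

namespace SuperVect

instance : CoeSort SuperVect.{u} (Type u) := ⟨carrier⟩

attribute [instance] addCommGroup module

/-- The projection to the even subspace along the odd one. -/
def evenPart (V : SuperVect.{u}) : Module.End ℂ V :=
  LinearMap.ofIsCompl V.isCompl V.even.subtype 0

/-- The projection to the odd subspace along the even one. -/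
def oddPart (V : SuperVect.{u}) : Module.End ℂ V :=
  LinearMap.ofIsCompl V.isCompl 0 V.odd.subtype

/-- The parity involution `ω`: it is `1` on the even and `-1` on the odd subspace. -/
def parity (V : SuperVect.{u}) : Module.End ℂ V :=
  LinearMap.ofIsCompl V.isCompl V.even.subtype (-V.odd.subtype)

lemma parity_of_even (V : SuperVect.{u}) {v : V} (hv : v ∈ V.even) : V.parity v = v :=
  LinearMap.ofIsCompl_apply_left V.isCompl (⟨v, hv⟩ : V.even)

lemma parity_of_odd (V : SuperVect.{u}) {v : V} (hv : v ∈ V.odd) : V.parity v = -v :=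
  LinearMap.ofIsCompl_apply_right V.isCompl (⟨v, hv⟩ : V.odd)

lemma exists_add (V : SuperVect.{u}) (v : V) : ∃ a ∈ V.even, ∃ b ∈ V.odd, a + b = v := by
  obtain ⟨a, b, h, -⟩ := Submodule.existsUnique_add_of_isCompl V.isCompl v
  exact ⟨a, a.2, b, b.2, h⟩

lemma evenPart_eq (V : SuperVect.{u}) : V.evenPart = (2⁻¹ : ℂ) • (1 + V.parity) := by
  refine LinearMap.ofIsCompl_eq _ (fun a => ?_) (fun b => ?_)
  · simp only [Submodule.subtype_apply, LinearMap.smul_apply, LinearMap.add_apply,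
      Module.End.one_apply, V.parity_of_even a.2]
    rw [← two_smul ℂ, smul_smul]; simp
  · simp [V.parity_of_odd b.2]

lemma oddPart_eq (V : SuperVect.{u}) : V.oddPart = (2⁻¹ : ℂ) • (1 - V.parity) := by
  refine LinearMap.ofIsCompl_eq _ (fun a => ?_) (fun b => ?_)
  · simp [V.parity_of_even a.2]
  · simp only [Submodule.subtype_apply, LinearMap.smul_apply, LinearMap.sub_apply,
      Module.End.one_apply, V.parity_of_odd b.2, sub_neg_eq_add]
    rw [← two_smul ℂ, smul_smul]; simp

lemma parity_unique (V : SuperVect.{u}) (T : Module.End ℂ V) (h0 : ∀ v ∈ V.even, T v = v)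
    (h1 : ∀ v ∈ V.odd, T v = -v) : V.parity = T :=
  LinearMap.ofIsCompl_eq _ (fun a => (h0 a a.2).symm) (fun b => (h1 b b.2).symm)

@[simp]
lemma parity_parity (V : SuperVect.{u}) (v : V) : V.parity (V.parity v) = v := by
  obtain ⟨a, ha, b, hb, rfl⟩ := V.exists_add v
  simp [V.parity_of_even ha, V.parity_of_odd hb]

lemma parity_mul_parity (V : SuperVect.{u}) : V.parity * V.parity = 1 := by
  ext v; simp

lemma eq_zero_of_eq_neg (V : SuperVect.{u}) {v : V} (h : v = -v) : v = 0 := by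
  have h2 : (2 : ℂ) • v = 0 := by
    rw [two_smul]; nth_rewrite 1 [h]; simp
  exact (smul_eq_zero.mp h2).resolve_left two_ne_zero

lemma mem_even_iff (V : SuperVect.{u}) {v : V} : v ∈ V.even ↔ V.parity v = v := by
  refine ⟨V.parity_of_even, fun h => ?_⟩
  obtain ⟨a, ha, b, hb, rfl⟩ := V.exists_add v
  rw [map_add, V.parity_of_even ha, V.parity_of_odd hb] at h
  have : b = 0 := V.eq_zero_of_eq_neg (add_left_cancel h).symm
  simpa [this] using ha

lemma mem_odd_iff (V : SuperVect.{u}) {v : V} : v ∈ V.odd ↔ V.parity v = -v := by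
  refine ⟨V.parity_of_odd, fun h => ?_⟩
  obtain ⟨a, ha, b, hb, rfl⟩ := V.exists_add v
  rw [map_add, V.parity_of_even ha, V.parity_of_odd hb, neg_add] at h
  have : a = 0 := V.eq_zero_of_eq_neg (add_right_cancel h)
  simpa [this] using hb

/-- Morphisms of super-vector spaces are the even linear maps. -/
@[ext]
structure Hom (V W : SuperVect.{u}) : Type u where
  lin : V →ₗ[ℂ] W
  map_even : ∀ v ∈ V.even, lin v ∈ W.even
  map_odd : ∀ v ∈ V.odd, lin v ∈ W.odd

instance : Category.{u} SuperVect.{u} where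
  Hom V W := Hom V W
  id V := ⟨LinearMap.id, fun _ h => h, fun _ h => h⟩
  comp f g := ⟨g.lin ∘ₗ f.lin, fun v h => g.map_even _ (f.map_even v h),
    fun v h => g.map_odd _ (f.map_odd v h)⟩

/-- A linear map which commutes with the parity involutions is even. -/
def Hom.ofCommute {V W : SuperVect.{u}} (f : V →ₗ[ℂ] W)
    (h : f ∘ₗ V.parity = W.parity ∘ₗ f) : V ⟶ W :=
  Hom.mk f
    (fun v hv => by
      rw [mem_even_iff, ← LinearMap.comp_apply, ← h, LinearMap.comp_apply, V.parity_of_even hv])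
    (fun v hv => by
      rw [mem_odd_iff, ← LinearMap.comp_apply, ← h, LinearMap.comp_apply, V.parity_of_odd hv,
        map_neg])

lemma Hom.map_parity {V W : SuperVect.{u}} (f : V ⟶ W) (v : V) :
    f.lin (V.parity v) = W.parity (f.lin v) := by
  obtain ⟨a, ha, b, hb, rfl⟩ := V.exists_add v
  simp [V.parity_of_even ha, V.parity_of_odd hb, W.parity_of_even (f.map_even a ha),
    W.parity_of_odd (f.map_odd b hb)]

/-- The tensor product, with grading `(V ⊗ W)₀ = V₀ ⊗ W₀ + V₁ ⊗ W₁` and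
`(V ⊗ W)₁ = V₀ ⊗ W₁ + V₁ ⊗ W₀`. -/
abbrev tensor (V W : SuperVect.{u}) : SuperVect.{u} where
  carrier := V ⊗[ℂ] W
  even := Submodule.map₂ (TensorProduct.mk ℂ V W) V.even W.even ⊔
    Submodule.map₂ (TensorProduct.mk ℂ V W) V.odd W.odd
  odd := Submodule.map₂ (TensorProduct.mk ℂ V W) V.even W.odd ⊔
    Submodule.map₂ (TensorProduct.mk ℂ V W) V.odd W.even
  isCompl := by
    have h0 : Submodule.map₂ (TensorProduct.mk ℂ V W) V.even W.even ⊔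
        Submodule.map₂ (TensorProduct.mk ℂ V W) V.odd W.odd ≤
        LinearMap.ker (TensorProduct.map V.parity W.parity - LinearMap.id) := by
      refine sup_le (Submodule.map₂_le.mpr ?_) (Submodule.map₂_le.mpr ?_)
      · intro a ha b hb; simp [parity_of_even _ ha, parity_of_even _ hb]
      · intro a ha b hb; simp [parity_of_odd _ ha, parity_of_odd _ hb, neg_tmul, tmul_neg]
    have h1 : Submodule.map₂ (TensorProduct.mk ℂ V W) V.even W.odd ⊔
        Submodule.map₂ (TensorProduct.mk ℂ V W) V.odd W.even ≤
        LinearMap.ker (TensorProduct.map V.parity W.parity + LinearMap.id) := by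
      refine sup_le (Submodule.map₂_le.mpr ?_) (Submodule.map₂_le.mpr ?_)
      · intro a ha b hb; simp [parity_of_even _ ha, parity_of_odd _ hb, tmul_neg]
      · intro a ha b hb; simp [parity_of_odd _ ha, parity_of_even _ hb, neg_tmul]
    refine ⟨Submodule.disjoint_def.mpr fun x hx hx' => ?_, codisjoint_iff_le_sup.mpr ?_⟩
    · have e0 := LinearMap.mem_ker.mp (h0 hx)
      have e1 := LinearMap.mem_ker.mp (h1 hx')
      have : (2 : ℂ) • x = 0 := by
        rw [two_smul]
        simp only [LinearMap.sub_apply, LinearMap.add_apply, LinearMap.id_apply] at e0 e1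
        rw [sub_eq_zero] at e0
        rwa [e0] at e1
      exact (smul_eq_zero.mp this).resolve_left two_ne_zero
    · rintro x -
      induction x with
      | zero => exact Submodule.zero_mem _
      | add x y hx hy => exact Submodule.add_mem _ hx hy
      | tmul v w =>
        obtain ⟨a, ha, b, hb, rfl⟩ := V.exists_add v
        obtain ⟨c, hc, d, hd, rfl⟩ := W.exists_add w
        rw [add_tmul, tmul_add, tmul_add]
        refine Submodule.add_mem _ (Submodule.add_mem _ ?_ ?_) (Submodule.add_mem _ ?_ ?_)
        · exact Submodule.mem_sup_left (Submodule.mem_sup_left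
            (Submodule.apply_mem_map₂ (TensorProduct.mk ℂ V W) ha hc))
        · exact Submodule.mem_sup_right (Submodule.mem_sup_left
            (Submodule.apply_mem_map₂ (TensorProduct.mk ℂ V W) ha hd))
        · exact Submodule.mem_sup_right (Submodule.mem_sup_right
            (Submodule.apply_mem_map₂ (TensorProduct.mk ℂ V W) hb hc))
        · exact Submodule.mem_sup_left (Submodule.mem_sup_right
            (Submodule.apply_mem_map₂ (TensorProduct.mk ℂ V W) hb hd))

end SuperVect

infixr:70 " ⊗ₛ " => SuperVect.tensor

namespace SuperVect

lemma parity_tensor (V W : SuperVect.{u}) :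
    (V ⊗ₛ W).parity = TensorProduct.map V.parity W.parity := by
  refine parity_unique _ _ (fun v hv => ?_) (fun v hv => ?_)
  · have h0 : (V ⊗ₛ W).even ≤
        LinearMap.ker (TensorProduct.map V.parity W.parity - LinearMap.id) := by
      refine sup_le (Submodule.map₂_le.mpr ?_) (Submodule.map₂_le.mpr ?_)
      · intro a ha b hb; simp [parity_of_even _ ha, parity_of_even _ hb]
      · intro a ha b hb; simp [parity_of_odd _ ha, parity_of_odd _ hb, neg_tmul, tmul_neg]
    exact sub_eq_zero.mp (LinearMap.mem_ker.mp (h0 hv))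
  · have h1 : (V ⊗ₛ W).odd ≤
        LinearMap.ker (TensorProduct.map V.parity W.parity + LinearMap.id) := by
      refine sup_le (Submodule.map₂_le.mpr ?_) (Submodule.map₂_le.mpr ?_)
      · intro a ha b hb; simp [parity_of_even _ ha, parity_of_odd _ hb, tmul_neg]
      · intro a ha b hb; simp [parity_of_odd _ ha, parity_of_even _ hb, neg_tmul]
    exact eq_neg_of_add_eq_zero_left (LinearMap.mem_ker.mp (h1 hv))

@[simp]
lemma parity_tmul (V W : SuperVect.{u}) (v : V) (w : W) :
    (V ⊗ₛ W).parity (v ⊗ₜ[ℂ] w) = V.parity v ⊗ₜ[ℂ] W.parity w := by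
  rw [parity_tensor]; rfl

/-- The tensor product of even linear maps. -/
def tensorHom {V V' W W' : SuperVect.{u}} (f : V ⟶ V') (g : W ⟶ W') : V ⊗ₛ W ⟶ V' ⊗ₛ W' :=
  Hom.ofCommute (TensorProduct.map f.lin g.lin) (by
    rw [parity_tensor, parity_tensor]
    exact TensorProduct.ext' fun v w => by simp [f.map_parity, g.map_parity])

lemma tensorHom_tmul {V V' W W' : SuperVect.{u}} (f : V ⟶ V') (g : W ⟶ W') (v : V) (w : W) :
    (tensorHom f g).lin (v ⊗ₜ[ℂ] w) = f.lin v ⊗ₜ[ℂ] g.lin w := rfl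

/-- The associator of super-vector spaces (no signs). -/
def assoc (V W X : SuperVect.{u}) : (V ⊗ₛ W) ⊗ₛ X ⟶ V ⊗ₛ (W ⊗ₛ X) :=
  Hom.ofCommute (TensorProduct.assoc ℂ V W X).toLinearMap (by
    simp only [parity_tensor]
    exact TensorProduct.ext_threefold fun a b c => rfl)

/-- The inverse associator of super-vector spaces. -/
def assocInv (V W X : SuperVect.{u}) : V ⊗ₛ (W ⊗ₛ X) ⟶ (V ⊗ₛ W) ⊗ₛ X :=
  Hom.ofCommute (TensorProduct.assoc ℂ V W X).symm.toLinearMap (by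
    simp only [parity_tensor]
    exact TensorProduct.ext_threefold' fun a b c => rfl)

lemma assoc_tmul (V W X : SuperVect.{u}) (v : V) (w : W) (x : X) :
    (assoc V W X).lin ((v ⊗ₜ[ℂ] w) ⊗ₜ[ℂ] x) = v ⊗ₜ[ℂ] (w ⊗ₜ[ℂ] x) := rfl

lemma assocInv_tmul (V W X : SuperVect.{u}) (v : V) (w : W) (x : X) :
    (assocInv V W X).lin (v ⊗ₜ[ℂ] (w ⊗ₜ[ℂ] x)) = (v ⊗ₜ[ℂ] w) ⊗ₜ[ℂ] x := rfl

/-- The super-flip `τ(v ⊗ w) = (-1)^{|v||w|} w ⊗ v`, written for general `v = v₀ + v₁` as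
`v ⊗ w ↦ w ⊗ v₀ + ω(w) ⊗ v₁`. -/
def flip (V W : SuperVect.{u}) : V ⊗ₛ W ⟶ W ⊗ₛ V :=
  Hom.ofCommute ((TensorProduct.comm ℂ V W).toLinearMap ∘ₗ
      (TensorProduct.map V.evenPart LinearMap.id + TensorProduct.map V.oddPart W.parity)) (by
    rw [parity_tensor, parity_tensor]
    exact TensorProduct.ext' fun v w => by simp [evenPart_eq, oddPart_eq])

lemma flip_tmul (V W : SuperVect.{u}) (v : V) (w : W) : (flip V W).lin (v ⊗ₜ[ℂ] w) =
    w ⊗ₜ[ℂ] V.evenPart v + W.parity w ⊗ₜ[ℂ] V.oddPart v := rfl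

lemma flip_tmul_of_even_left {V W : SuperVect.{u}} {v : V} (hv : v ∈ V.even) (w : W) :
    (flip V W).lin (v ⊗ₜ[ℂ] w) = w ⊗ₜ[ℂ] v := by
  have h0 : V.evenPart v = v := LinearMap.ofIsCompl_apply_left V.isCompl (⟨v, hv⟩ : V.even)
  have h1 : V.oddPart v = 0 := LinearMap.ofIsCompl_apply_left V.isCompl (⟨v, hv⟩ : V.even)
  rw [flip_tmul, h0, h1, tmul_zero, add_zero]

lemma flip_tmul_of_even_right {V W : SuperVect.{u}} (v : V) {w : W} (hw : w ∈ W.even) :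
    (flip V W).lin (v ⊗ₜ[ℂ] w) = w ⊗ₜ[ℂ] v := by
  rw [flip_tmul, W.parity_of_even hw, ← tmul_add, ← LinearMap.add_apply, evenPart_eq, oddPart_eq,
    ← smul_add, add_add_sub_cancel, ← two_smul ℂ, smul_smul]
  simp

lemma flip_tmul_of_odd {V W : SuperVect.{u}} {v : V} (hv : v ∈ V.odd) {w : W} (hw : w ∈ W.odd) :
    (flip V W).lin (v ⊗ₜ[ℂ] w) = -(w ⊗ₜ[ℂ] v) := by
  have h0 : V.evenPart v = 0 := LinearMap.ofIsCompl_apply_right V.isCompl (⟨v, hv⟩ : V.odd)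
  have h1 : V.oddPart v = v := LinearMap.ofIsCompl_apply_right V.isCompl (⟨v, hv⟩ : V.odd)
  rw [flip_tmul, h0, h1, tmul_zero, zero_add, W.parity_of_odd hw, neg_tmul]

/-- The parity involution as an even map. -/
def parityHom (V : SuperVect.{u}) : V ⟶ V := Hom.ofCommute V.parity rfl

/-- Multiplication with a scalar. -/
def scale (z : ℂ) (V : SuperVect.{u}) : V ⟶ V := Hom.ofCommute (z • LinearMap.id) (by
  rw [LinearMap.smul_comp, LinearMap.comp_smul, LinearMap.id_comp, LinearMap.comp_id])

/-- The even line `ℂ^{1|0}`. -/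
abbrev unit : SuperVect.{u} where
  carrier := ULift.{u} ℂ
  even := ⊤
  odd := ⊥
  isCompl := isCompl_top_bot

lemma parity_unit : unit.{u}.parity = LinearMap.id :=
  parity_unique _ _ (fun _ _ => rfl) (fun v hv => by
    rw [(Submodule.mem_bot ℂ).mp hv]; simp)

/-- `ℂ^{1|0} ⊗ V → V`, `z ⊗ v ↦ z v`. -/
def leftUnit (V : SuperVect.{u}) : unit ⊗ₛ V ⟶ V :=
  Hom.ofCommute (TensorProduct.lift ((LinearMap.lsmul ℂ V : ℂ →ₗ[ℂ] V →ₗ[ℂ] V) ∘ₗ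
      (ULift.moduleEquiv : ULift.{u} ℂ ≃ₗ[ℂ] ℂ).toLinearMap)) (by
    rw [parity_tensor, parity_unit]
    exact TensorProduct.ext' fun z v => by simp)

/-- `V ⊗ ℂ^{1|0} → V`, `v ⊗ z ↦ z v`. -/
def rightUnit (V : SuperVect.{u}) : V ⊗ₛ unit ⟶ V :=
  flip V unit ≫ leftUnit V

end SuperVect

lemma map_neg_left {V W V' W' : Type u} [AddCommGroup V] [Module ℂ V] [AddCommGroup W] [Module ℂ W]
    [AddCommGroup V'] [Module ℂ V'] [AddCommGroup W'] [Module ℂ W'] (f : V →ₗ[ℂ] V')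
    (g : W →ₗ[ℂ] W') : TensorProduct.map (-f) g = -TensorProduct.map f g :=
  TensorProduct.ext' fun v w => by simp [neg_tmul]

lemma map_neg_right {V W V' W' : Type u} [AddCommGroup V] [Module ℂ V] [AddCommGroup W]
    [Module ℂ W] [AddCommGroup V'] [Module ℂ V'] [AddCommGroup W'] [Module ℂ W'] (f : V →ₗ[ℂ] V')
    (g : W →ₗ[ℂ] W') : TensorProduct.map f (-g) = -TensorProduct.map f g :=
  TensorProduct.ext' fun v w => by simp [tmul_neg]

/-! ### Representations of a purely odd abelian Lie super-algebra -/

/-- Linear families of odd endomorphisms of `V`, indexed by `h`: even linear maps from the purely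
odd super-vector space `h` to the super-vector space of all endomorphisms of `V`. -/
structure OddOps (h : Type u) [AddCommGroup h] [Module ℂ h] (V : SuperVect.{u}) : Type u where
  lin : h →ₗ[ℂ] Module.End ℂ V
  map_even : ∀ a, ∀ v ∈ V.even, lin a v ∈ V.odd
  map_odd : ∀ a, ∀ v ∈ V.odd, lin a v ∈ V.even

namespace OddOps

variable {h : Type u} [AddCommGroup h] [Module ℂ h]

lemma mul_parity {V : SuperVect.{u}} (P : OddOps h V) (a : h) :
    V.parity * P.lin a = -(P.lin a * V.parity) := by
  ext v
  obtain ⟨x, hx, y, hy, rfl⟩ := V.exists_add v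
  simp [V.parity_of_even hx, V.parity_of_odd hy, V.parity_of_odd (P.map_even a x hx),
    V.parity_of_even (P.map_odd a y hy), add_comm]

/-- Families of endomorphisms which anticommute with the parity involution are odd. -/
def ofAnticomm {V : SuperVect.{u}} (P : h →ₗ[ℂ] Module.End ℂ V)
    (hP : ∀ a, V.parity * P a = -(P a * V.parity)) : OddOps h V where
  lin := P
  map_even a v hv := by
    have := LinearMap.congr_fun (hP a) v
    rw [V.mem_odd_iff]
    simpa [V.parity_of_even hv] using this
  map_odd a v hv := by
    have := LinearMap.congr_fun (hP a) v
    rw [V.mem_even_iff]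
    simpa [V.parity_of_odd hv] using this

/-- Action on the left tensor factor: `v ⊗ w ↦ a v ⊗ w`. -/
def onLeft {V : SuperVect.{u}} (P : OddOps h V) (W : SuperVect.{u}) : OddOps h (V ⊗ₛ W) :=
  ofAnticomm ((TensorProduct.mapBilinear (RingHom.id ℂ) V W V W).flip LinearMap.id ∘ₗ P.lin)
    (fun a => by
      rw [SuperVect.parity_tensor]
      have := P.mul_parity a
      change TensorProduct.map _ _ * TensorProduct.map _ _ =
        -(TensorProduct.map _ _ * TensorProduct.map _ _)
      rw [← TensorProduct.map_mul, ← TensorProduct.map_mul, this, map_neg_left]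
      rfl)

/-- Action on the right tensor factor, with the sign of moving the odd operator past the left
factor: `v ⊗ w ↦ (-1)^{|v|} v ⊗ a w`. -/
def onRight (V : SuperVect.{u}) {W : SuperVect.{u}} (P : OddOps h W) : OddOps h (V ⊗ₛ W) :=
  ofAnticomm (TensorProduct.mapBilinear (RingHom.id ℂ) V W V W V.parity ∘ₗ P.lin)
    (fun a => by
      rw [SuperVect.parity_tensor]
      have := P.mul_parity a
      change TensorProduct.map _ _ * TensorProduct.map _ _ =
        -(TensorProduct.map _ _ * TensorProduct.map _ _)
      rw [← TensorProduct.map_mul, ← TensorProduct.map_mul, this, map_neg_right])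

lemma onLeft_lin {V : SuperVect.{u}} (P : OddOps h V) (W : SuperVect.{u}) (a : h) :
    (P.onLeft W).lin a = TensorProduct.map (P.lin a) (1 : Module.End ℂ W) := rfl

lemma onRight_lin (V : SuperVect.{u}) {W : SuperVect.{u}} (P : OddOps h W) (a : h) :
    (onRight V P).lin a = TensorProduct.map V.parity (P.lin a) := rfl

/-- Two families of odd operators super-commute. -/
def Anticomm {V : SuperVect.{u}} (P Q : OddOps h V) : Prop :=
  ∀ a b, P.lin a * Q.lin b = -(Q.lin b * P.lin a)

lemma Anticomm.symm {V : SuperVect.{u}} {P Q : OddOps h V} (H : Anticomm P Q) : Anticomm Q P :=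
  fun a b => by rw [H b a, neg_neg]

lemma Anticomm.onLeft {V : SuperVect.{u}} {P Q : OddOps h V} (H : Anticomm P Q)
    (W : SuperVect.{u}) : Anticomm (P.onLeft W) (Q.onLeft W) := fun a b => by
  rw [onLeft_lin, onLeft_lin, ← TensorProduct.map_mul, ← TensorProduct.map_mul, H a b,
    map_neg_left]

lemma Anticomm.onRight (V : SuperVect.{u}) {W : SuperVect.{u}} {P Q : OddOps h W}
    (H : Anticomm P Q) : Anticomm (OddOps.onRight V P) (OddOps.onRight V Q) := fun a b => by
  rw [onRight_lin, onRight_lin, ← TensorProduct.map_mul, ← TensorProduct.map_mul, H a b,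
    map_neg_right]

lemma anticomm_onLeft_onRight {V W : SuperVect.{u}} (P : OddOps h V) (Q : OddOps h W) :
    Anticomm (P.onLeft W) (OddOps.onRight V Q) := fun a b => by
  rw [onLeft_lin, onRight_lin, ← TensorProduct.map_mul, ← TensorProduct.map_mul, P.mul_parity,
    map_neg_left, neg_neg, one_mul, mul_one]

end OddOps

/-- A representation of `h`, regarded as a purely odd abelian Lie super-algebra. -/
structure HRep (h : Type u) [AddCommGroup h] [Module ℂ h] : Type (u + 1) where
  space : SuperVect.{u}
  act : OddOps h space
  act_anticomm : ∀ a b, act.lin a * act.lin b + act.lin b * act.lin a = 0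

namespace HRep

variable {h : Type u} [AddCommGroup h] [Module ℂ h]

lemma anticomm (A : HRep h) : OddOps.Anticomm A.act A.act :=
  fun a b => eq_neg_of_add_eq_zero_left (A.act_anticomm a b)

/-- Morphisms of representations are the even intertwiners. -/
@[ext]
structure Hom (A B : HRep h) : Type u where
  hom : A.space ⟶ B.space
  comm : ∀ a v, hom.lin (A.act.lin a v) = B.act.lin a (hom.lin v)

instance : Category.{u} (HRep.{u} h) where
  Hom A B := Hom A B
  id A := ⟨𝟙 A.space, fun _ _ => rfl⟩
  comp f g := ⟨f.hom ≫ g.hom, fun a v =>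
    (congrArg g.hom.lin (f.comm a v)).trans (g.comm a (f.hom.lin v))⟩

/-- The action on the tensor product of representations,
`a (v ⊗ w) = a v ⊗ w + (-1)^{|v|} v ⊗ a w`. -/
def tensorAct (A B : HRep h) : OddOps h (A.space ⊗ₛ B.space) :=
  OddOps.ofAnticomm ((A.act.onLeft B.space).lin + (OddOps.onRight A.space B.act).lin)
    (fun a => by
      rw [LinearMap.add_apply, mul_add, add_mul, neg_add, OddOps.mul_parity, OddOps.mul_parity])

/-- The tensor product of representations. -/
abbrev tensor (A B : HRep h) : HRep h where
  space := A.space ⊗ₛ B.space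
  act := tensorAct A B
  act_anticomm a b := by
    have h1 := A.anticomm.onLeft B.space a b
    have h2 := OddOps.Anticomm.onRight A.space B.anticomm a b
    have h3 := OddOps.anticomm_onLeft_onRight A.act B.act a b
    have h4 := OddOps.anticomm_onLeft_onRight A.act B.act b a
    simp only [tensorAct, OddOps.ofAnticomm, LinearMap.add_apply, mul_add, add_mul, h1, h2, h3, h4]
    abel

end HRep

infixr:70 " ⊗ᵣ " => HRep.tensor

namespace HRep

variable {h : Type u} [AddCommGroup h] [Module ℂ h]

/-- The super-vector space underlying the universal enveloping algebra `U(h)` of the purely odd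
abelian Lie super-algebra `h`: the associative algebra generated by `h` subject to `a b + b a = 0`,
that is, the exterior algebra. -/
abbrev envSpace (h : Type u) [AddCommGroup h] [Module ℂ h] : SuperVect.{u} where
  carrier := ExteriorAlgebra ℂ h
  even := CliffordAlgebra.evenOdd 0 0
  odd := CliffordAlgebra.evenOdd 0 1
  isCompl := CliffordAlgebra.evenOdd_isCompl 0

/-- The action of `h` on `U(h)` by left multiplication. -/
def leftMul (h : Type u) [AddCommGroup h] [Module ℂ h] : OddOps h (envSpace h) where
  lin := LinearMap.mul ℂ (ExteriorAlgebra ℂ h) ∘ₗ ExteriorAlgebra.ι ℂ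
  map_even := fun a v hv => by
    have := CliffordAlgebra.evenOdd_mul_le (0 : QuadraticForm ℂ h) 1 0
      (Submodule.mul_mem_mul (CliffordAlgebra.ι_mem_evenOdd_one 0 a) hv)
    simpa using this
  map_odd := fun a v hv => by
    have := CliffordAlgebra.evenOdd_mul_le (0 : QuadraticForm ℂ h) 1 1
      (Submodule.mul_mem_mul (CliffordAlgebra.ι_mem_evenOdd_one 0 a) hv)
    simpa [show (1 : ZMod 2) + 1 = 0 from rfl] using this

/-- `U(h)` as a representation by left multiplication. -/
abbrev env (h : Type u) [AddCommGroup h] [Module ℂ h] : HRep h where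
  space := envSpace h
  act := leftMul h
  act_anticomm a b := by
    refine LinearMap.ext fun (x : ExteriorAlgebra ℂ h) => ?_
    change ExteriorAlgebra.ι ℂ a * (ExteriorAlgebra.ι ℂ b * x) +
      ExteriorAlgebra.ι ℂ b * (ExteriorAlgebra.ι ℂ a * x) = 0
    rw [← mul_assoc, ← mul_assoc, ← add_mul, ExteriorAlgebra.ι_add_mul_swap, zero_mul]

lemma parity_env : (envSpace h).parity =
    (CliffordAlgebra.involute : ExteriorAlgebra ℂ h →ₐ[ℂ] ExteriorAlgebra ℂ h).toLinearMap :=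
  SuperVect.parity_unique _ _ (fun _ hv => CliffordAlgebra.involute_eq_of_mem_even hv)
    (fun _ hv => CliffordAlgebra.involute_eq_of_mem_odd hv)

/-- The algebra map from `U(h)` to endomorphisms which extends the action of `h`. -/
def envAct (A : HRep h) : ExteriorAlgebra ℂ h →ₐ[ℂ] Module.End ℂ A.space :=
  ExteriorAlgebra.lift ℂ ⟨A.act.lin, fun a => by
    have h2 : (2 : ℂ) • (A.act.lin a * A.act.lin a) = 0 := by rw [two_smul, A.act_anticomm a a]
    exact (smul_eq_zero.mp h2).resolve_left two_ne_zero⟩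

@[simp]
lemma envAct_ι (A : HRep h) (a : h) : A.envAct (ExteriorAlgebra.ι ℂ a) = A.act.lin a :=
  ExteriorAlgebra.lift_ι_apply ℂ _ _ a

lemma parity_mul_envAct (A : HRep h) (u : ExteriorAlgebra ℂ h) :
    A.envAct (CliffordAlgebra.involute u) * A.space.parity = A.space.parity * A.envAct u := by
  induction u using ExteriorAlgebra.induction with
  | algebraMap r => simp [Algebra.commutes]
  | ι a =>
    rw [ExteriorAlgebra.ι, CliffordAlgebra.involute_ι, map_neg, neg_mul]
    exact (by rw [envAct_ι, A.act.mul_parity] :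
      -(A.envAct (ExteriorAlgebra.ι ℂ a) * A.space.parity) =
        A.space.parity * A.envAct (ExteriorAlgebra.ι ℂ a))
  | mul x y hx hy => rw [map_mul, map_mul, map_mul, mul_assoc, hy, ← mul_assoc, hx, mul_assoc]
  | add x y hx hy => rw [map_add, map_add, map_add, add_mul, mul_add, hx, hy]

/-- The action `ρ : U(h) ⊗ A → A`. -/
def actHom (A : HRep h) : envSpace h ⊗ₛ A.space ⟶ A.space :=
  SuperVect.Hom.ofCommute (TensorProduct.lift A.envAct.toLinearMap) (by
    rw [SuperVect.parity_tensor, parity_env]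
    exact TensorProduct.ext' fun u v => LinearMap.congr_fun (A.parity_mul_envAct u) v)

/-- The coproduct `Δ : U(h) → U(h) ⊗ U(h)`: as an algebra map with `Δ(a) = a ⊗ 1 + 1 ⊗ a` for
`a ∈ h`, it is given by letting `u` act on the element `1 ⊗ 1` of the tensor product representation
`U(h) ⊗ U(h)`. -/
def coprod (h : Type u) [AddCommGroup h] [Module ℂ h] :
    envSpace h ⟶ envSpace h ⊗ₛ envSpace h :=
  SuperVect.Hom.ofCommute
    ((env h ⊗ᵣ env h).envAct.toLinearMap.flip ((1 : ExteriorAlgebra ℂ h) ⊗ₜ[ℂ] 1)) (by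
    rw [parity_env]
    refine LinearMap.ext fun (u : ExteriorAlgebra ℂ h) => ?_
    have h1 := LinearMap.congr_fun ((env h ⊗ᵣ env h).parity_mul_envAct u)
      ((1 : ExteriorAlgebra ℂ h) ⊗ₜ[ℂ] (1 : ExteriorAlgebra ℂ h))
    rw [Module.End.mul_apply, SuperVect.parity_tmul, parity_env, AlgHom.toLinearMap_apply,
      map_one] at h1
    exact h1)

lemma coprod_one : (coprod h).lin (1 : ExteriorAlgebra ℂ h) =
    (1 : ExteriorAlgebra ℂ h) ⊗ₜ[ℂ] (1 : ExteriorAlgebra ℂ h) := by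
  simp [coprod, SuperVect.Hom.ofCommute]

/-- `Δ(a u) = (a ⊗ 1 + 1 ⊗ a) Δ(u)` in the super tensor product algebra. -/
lemma coprod_ι_mul (a : h) (u : ExteriorAlgebra ℂ h) :
    (coprod h).lin (ExteriorAlgebra.ι ℂ a * u) =
      (env h ⊗ᵣ env h).act.lin a ((coprod h).lin u) := by
  change (env h ⊗ᵣ env h).envAct (ExteriorAlgebra.ι ℂ a * u) _ = _
  rw [map_mul, envAct_ι]
  rfl

/-- The multiplication `μ : U(h) ⊗ U(h) → U(h)`. -/
def mulHom (h : Type u) [AddCommGroup h] [Module ℂ h] :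
    envSpace h ⊗ₛ envSpace h ⟶ envSpace h :=
  SuperVect.Hom.ofCommute (LinearMap.mul' ℂ (ExteriorAlgebra ℂ h)) (by
    rw [SuperVect.parity_tensor, parity_env]
    exact TensorProduct.ext' fun u v => by simp)

/-- The antipode `S` of `U(h)`: the algebra anti-automorphism (in the super sense) with
`S(a) = -a` for `a ∈ h`. As `U(h)` is super-commutative, it is the algebra automorphism
with this property. -/
def antipode (h : Type u) [AddCommGroup h] [Module ℂ h] :
    ExteriorAlgebra ℂ h ≃ₐ[ℂ] ExteriorAlgebra ℂ h :=
  CliffordAlgebra.involuteEquiv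

/-- The inverse antipode `S⁻¹`. -/
def antipodeInv (h : Type u) [AddCommGroup h] [Module ℂ h] : envSpace h ⟶ envSpace h :=
  SuperVect.Hom.ofCommute (antipode h).symm.toLinearMap (by rw [parity_env]; rfl)

end HRep

namespace HRep

variable {h : Type u} [AddCommGroup h] [Module ℂ h]

/-- An even linear map which commutes with the action of all elements of `h` is an intertwiner. -/
def Hom.ofCommute {A B : HRep h} (f : A.space ⟶ B.space)
    (H : ∀ a, f.lin ∘ₗ A.act.lin a = B.act.lin a ∘ₗ f.lin) : A ⟶ B :=
  Hom.mk f fun a v => LinearMap.congr_fun (H a) v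

lemma tensor_act (A B : HRep h) (a : h) : (tensorAct A B).lin a =
    TensorProduct.map (A.act.lin a) (1 : Module.End ℂ B.space) +
      TensorProduct.map A.space.parity (B.act.lin a) := rfl

lemma tensor_act_tmul (A B : HRep h) (a : h) (v : A.space) (w : B.space) :
    (tensorAct A B).lin a (v ⊗ₜ[ℂ] w) =
      A.act.lin a v ⊗ₜ[ℂ] w + A.space.parity v ⊗ₜ[ℂ] B.act.lin a w := rfl

lemma anticomm_tensor_onLeft {A B : HRep h} {P : OddOps h A.space}
    (H : OddOps.Anticomm A.act P) : OddOps.Anticomm (A ⊗ᵣ B).act (P.onLeft B.space) :=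
  fun a b => by
    have h1 := H.onLeft B.space a b
    have h2 := (OddOps.anticomm_onLeft_onRight P B.act).symm a b
    change ((A.act.onLeft B.space).lin a + (OddOps.onRight A.space B.act).lin a) * _ =
      -(_ * ((A.act.onLeft B.space).lin a + (OddOps.onRight A.space B.act).lin a))
    rw [add_mul, mul_add, h1, h2, neg_add]

lemma anticomm_tensor_onRight {A B : HRep h} {P : OddOps h B.space}
    (H : OddOps.Anticomm B.act P) : OddOps.Anticomm (A ⊗ᵣ B).act (OddOps.onRight A.space P) :=
  fun a b => by
    have h1 := H.onRight A.space a b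
    have h2 := OddOps.anticomm_onLeft_onRight A.act P a b
    change ((A.act.onLeft B.space).lin a + (OddOps.onRight A.space B.act).lin a) * _ =
      -(_ * ((A.act.onLeft B.space).lin a + (OddOps.onRight A.space B.act).lin a))
    rw [add_mul, mul_add, h1, h2, neg_add]

/-- The tensor product of intertwiners. -/
def tensorHom {A A' B B' : HRep h} (f : A ⟶ A') (g : B ⟶ B') : A ⊗ᵣ B ⟶ A' ⊗ᵣ B' :=
  Hom.ofCommute (SuperVect.tensorHom f.hom g.hom) fun a => TensorProduct.ext' fun v w => by
    rw [LinearMap.comp_apply, LinearMap.comp_apply, tensor_act_tmul, map_add,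
      SuperVect.tensorHom_tmul, SuperVect.tensorHom_tmul, SuperVect.tensorHom_tmul,
      tensor_act_tmul, f.comm, g.comm, SuperVect.Hom.map_parity]

/-- The associator of `Rep(h)`. -/
def assoc (A B C : HRep h) : (A ⊗ᵣ B) ⊗ᵣ C ⟶ A ⊗ᵣ (B ⊗ᵣ C) :=
  Hom.ofCommute (SuperVect.assoc A.space B.space C.space) fun a =>
    TensorProduct.ext_threefold fun x y z => by
      rw [LinearMap.comp_apply, LinearMap.comp_apply, tensor_act_tmul, tensor_act_tmul,
        SuperVect.parity_tmul, add_tmul, map_add, map_add, SuperVect.assoc_tmul,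
        SuperVect.assoc_tmul, SuperVect.assoc_tmul, SuperVect.assoc_tmul, tensor_act_tmul,
        tensor_act_tmul, tmul_add, add_assoc]

/-- The inverse associator of `Rep(h)`. -/
def assocInv (A B C : HRep h) : A ⊗ᵣ (B ⊗ᵣ C) ⟶ (A ⊗ᵣ B) ⊗ᵣ C :=
  Hom.ofCommute (SuperVect.assocInv A.space B.space C.space) fun a =>
    TensorProduct.ext_threefold' fun x y z => by
      rw [LinearMap.comp_apply, LinearMap.comp_apply, SuperVect.assocInv_tmul, tensor_act_tmul,
        tensor_act_tmul, tensor_act_tmul, tensor_act_tmul, SuperVect.parity_tmul, add_tmul,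
        tmul_add, map_add, map_add, SuperVect.assocInv_tmul, SuperVect.assocInv_tmul,
        SuperVect.assocInv_tmul, add_assoc]

/-- The super-flip of `Rep(h)`. -/
def flip (A B : HRep h) : A ⊗ᵣ B ⟶ B ⊗ᵣ A :=
  Hom.ofCommute (SuperVect.flip A.space B.space) fun a => TensorProduct.ext' fun v w => by
    have e1 : ∀ v, A.space.parity (A.act.lin a v) = -A.act.lin a (A.space.parity v) :=
      fun v => LinearMap.congr_fun (A.act.mul_parity a) v
    have e2 : ∀ v, B.space.parity (B.act.lin a v) = -B.act.lin a (B.space.parity v) :=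
      fun v => LinearMap.congr_fun (B.act.mul_parity a) v
    rw [LinearMap.comp_apply, LinearMap.comp_apply, tensor_act_tmul, map_add, SuperVect.flip_tmul,
      SuperVect.flip_tmul, SuperVect.flip_tmul, map_add, tensor_act_tmul, tensor_act_tmul]
    simp only [SuperVect.evenPart_eq, SuperVect.oddPart_eq, LinearMap.smul_apply,
      LinearMap.add_apply,
      LinearMap.sub_apply, Module.End.one_apply, map_smul, map_add, map_sub, e1, e2,
      SuperVect.parity_parity, tmul_smul, tmul_add, tmul_sub, tmul_neg, neg_tmul]
    module

/-- The zero action. -/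
def zeroAct (h : Type u) [AddCommGroup h] [Module ℂ h] (V : SuperVect.{u}) : OddOps h V :=
  OddOps.ofAnticomm 0 (by simp)

/-- A super-vector space as a representation with zero action. -/
abbrev triv (h : Type u) [AddCommGroup h] [Module ℂ h] (V : SuperVect.{u}) : HRep h where
  space := V
  act := zeroAct h V
  act_anticomm := by simp [zeroAct, OddOps.ofAnticomm]

lemma triv_act (V : SuperVect.{u}) (a : h) : (zeroAct h V).lin a = 0 := rfl

lemma triv_tensor_act (V W : SuperVect.{u}) (a : h) :
    (tensorAct (triv h V) (triv h W)).lin a = 0 := by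
  rw [tensor_act, triv_act, triv_act, TensorProduct.map_zero_left, TensorProduct.map_zero_right,
    add_zero]

lemma anticomm_triv {V : SuperVect.{u}} (P : OddOps h V) : OddOps.Anticomm (triv h V).act P :=
  fun a b => by rw [triv_act, zero_mul, mul_zero, neg_zero]

/-- Even linear maps are intertwiners for zero actions. -/
def trivHom (h : Type u) [AddCommGroup h] [Module ℂ h] {V W : SuperVect.{u}} (f : V ⟶ W) :
    triv h V ⟶ triv h W :=
  Hom.ofCommute f fun a => by rw [triv_act, triv_act, LinearMap.comp_zero, LinearMap.zero_comp]

/-- Zero actions are compatible with tensor products. -/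
def trivTensor (h : Type u) [AddCommGroup h] [Module ℂ h] (V W : SuperVect.{u}) :
    triv h V ⊗ᵣ triv h W ⟶ triv h (V ⊗ₛ W) :=
  Hom.ofCommute (𝟙 (V ⊗ₛ W)) fun a => by
    rw [triv_tensor_act, triv_act, LinearMap.comp_zero, LinearMap.zero_comp]

/-- Zero actions are compatible with tensor products. -/
def trivTensorInv (h : Type u) [AddCommGroup h] [Module ℂ h] (V W : SuperVect.{u}) :
    triv h (V ⊗ₛ W) ⟶ triv h V ⊗ᵣ triv h W :=
  Hom.ofCommute (𝟙 (V ⊗ₛ W)) fun a => by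
    rw [triv_tensor_act, triv_act, LinearMap.comp_zero, LinearMap.zero_comp]

/-- The coproduct `Δ` intertwines the left multiplication by elements of `h`. -/
def coprodHom (h : Type u) [AddCommGroup h] [Module ℂ h] : env h ⟶ env h ⊗ᵣ env h :=
  Hom.ofCommute (coprod h) fun a => LinearMap.ext fun u => coprod_ι_mul a u

/-- The action `ρ : U(h) ⊗ A → A` is an intertwiner, where `h` acts on the source through left
multiplication on `U(h)` only. -/
def actIntertwiner (A : HRep h) : env h ⊗ᵣ triv h A.space ⟶ A :=
  Hom.ofCommute A.actHom fun a => TensorProduct.ext' fun u v => by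
    rw [LinearMap.comp_apply, tensor_act_tmul, triv_act, LinearMap.zero_apply, tmul_zero, add_zero]
    change A.envAct (ExteriorAlgebra.ι ℂ a * u) v = A.act.lin a (A.envAct u v)
    rw [map_mul, envAct_ι]
    rfl

/-- The even linear map `ρ ∘ (S⁻¹ ⊗ id) : U(h) ⊗ A → A`. It is an intertwiner from the tensor
product representation to the zero action. -/
def antipodeAct (A : HRep h) : env h ⊗ᵣ A ⟶ triv h A.space :=
  Hom.ofCommute (SuperVect.tensorHom (antipodeInv h) (𝟙 A.space) ≫ A.actHom) fun a =>
    TensorProduct.ext' fun u v => by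
      rw [triv_act, LinearMap.zero_comp, LinearMap.zero_apply, LinearMap.comp_apply,
        tensor_act_tmul, map_add]
      change A.envAct ((antipode h).symm (ExteriorAlgebra.ι ℂ a * u)) v +
        A.envAct ((antipode h).symm ((envSpace h).parity u)) (A.act.lin a v) = 0
      have e1 : (antipode h).symm (ExteriorAlgebra.ι ℂ a) = -ExteriorAlgebra.ι ℂ a :=
        CliffordAlgebra.involute_ι a
      have e2 : ∀ u : ExteriorAlgebra ℂ h,
          A.envAct u * A.act.lin a = A.act.lin a * A.envAct (CliffordAlgebra.involute u) := by
        intro u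
        induction u using ExteriorAlgebra.induction with
        | algebraMap r => simp [Algebra.commutes]
        | ι b =>
          rw [ExteriorAlgebra.ι, CliffordAlgebra.involute_ι, map_neg, mul_neg]
          exact (by rw [envAct_ι]; exact A.anticomm b a :
            A.envAct (ExteriorAlgebra.ι ℂ b) * A.act.lin a =
              -(A.act.lin a * A.envAct (ExteriorAlgebra.ι ℂ b)))
        | mul x y hx hy =>
          rw [map_mul, map_mul, map_mul, mul_assoc, hy, ← mul_assoc, hx, mul_assoc]
        | add x y hx hy => rw [map_add, map_add, map_add, add_mul, mul_add, hx, hy]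
      have e3 : (antipode h).symm ((envSpace h).parity u) = u := by
        rw [parity_env]
        exact CliffordAlgebra.involute_involute u
      have e4 : (antipode h).symm u = CliffordAlgebra.involute u := rfl
      rw [map_mul, e1, e3, map_mul, map_neg, envAct_ι, e4, neg_mul]
      have := LinearMap.congr_fun (e2 u) v
      rw [Module.End.mul_apply] at this
      rw [this]
      simp

/-- `ℂ^{1|0} ⊗ A → A` in `Rep(h)`. -/
def leftUnit (A : HRep h) : triv h SuperVect.unit ⊗ᵣ A ⟶ A :=
  Hom.ofCommute (SuperVect.leftUnit A.space) fun a => TensorProduct.ext' fun z v => by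
    rw [LinearMap.comp_apply, tensor_act_tmul, triv_act, LinearMap.zero_apply, zero_tmul, zero_add,
      SuperVect.parity_unit]
    exact ((A.act.lin a).map_smul z.down v).symm

/-- `A ⊗ ℂ^{1|0} → A` in `Rep(h)`. -/
def rightUnit (A : HRep h) : A ⊗ᵣ triv h SuperVect.unit ⟶ A :=
  flip A (triv h SuperVect.unit) ≫ leftUnit A

end HRep

/-! ### The copairing and its exponentials -/

/-- A metric on the purely odd abelian Lie super-algebra `h`: a non-degenerate supersymmetric
pairing. As all elements of `h` are odd, supersymmetry `(a, b) = (-1)^{|a||b|} (b, a)` means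
skew-symmetry, and invariance is automatic. -/
structure OddMetric (h : Type u) [AddCommGroup h] [Module ℂ h] : Type u where
  pairing : LinearMap.BilinForm ℂ h
  supersymm : ∀ a b, pairing a b = -pairing b a
  nondegenerate : pairing.Nondegenerate

/-- The exponential of a nilpotent endomorphism (a finite sum). -/
def expNil {V : Type u} [AddCommGroup V] [Module ℂ V] (X : Module.End ℂ V) : Module.End ℂ V :=
  ∑ k ∈ Finset.range (nilpotencyClass X), ((k.factorial : ℂ)⁻¹) • X ^ k

lemma commute_expNil {V : Type u} [AddCommGroup V] [Module ℂ V] {X Y : Module.End ℂ V}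
    (H : Commute X Y) : Commute X (expNil Y) :=
  Commute.sum_right _ _ _ fun k _ => (H.pow_right k).smul_right _

namespace OddMetric

section

variable {h : Type u} [AddCommGroup h] [Module ℂ h]

/-- Contraction of `U(h)` with a linear form. -/
def contr (d : Module.Dual ℂ h) : ExteriorAlgebra ℂ h →ₗ[ℂ] ExteriorAlgebra ℂ h :=
  CliffordAlgebra.contractLeft (Q := (0 : QuadraticForm ℂ h)) d

lemma contr_ι_mul (d : Module.Dual ℂ h) (a : h) (x : ExteriorAlgebra ℂ h) :
    contr d (ExteriorAlgebra.ι ℂ a * x) = d a • x - ExteriorAlgebra.ι ℂ a * contr d x :=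
  CliffordAlgebra.contractLeft_ι_mul d a x

lemma contr_algebraMap (d : Module.Dual ℂ h) (r : ℂ) :
    contr d (algebraMap ℂ (ExteriorAlgebra ℂ h) r) = 0 :=
  CliffordAlgebra.contractLeft_algebraMap 0 d r

lemma involute_of_mem {m : ℕ} {x : ExteriorAlgebra ℂ h} (hx : x ∈ ⋀[ℂ]^m h) :
    CliffordAlgebra.involute x = (-1 : ℂ) ^ m • x := by
  induction hx using Submodule.pow_induction_on_left' with
  | algebraMap r => simp
  | add x y i hx hy h1 h2 => simp only [map_add, h1, h2, smul_add]
  | mem_mul a ha n x hx ih =>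
    obtain ⟨v, rfl⟩ := ha
    rw [map_mul, ih, CliffordAlgebra.involute_ι, mul_smul_comm, Nat.succ_eq_add_one, pow_succ,
      mul_smul, neg_one_smul, neg_mul]

end

variable {h : Type u} [AddCommGroup h] [Module ℂ h] [FiniteDimensional ℂ h] (S : OddMetric h)

/-- A basis `β` of `h`. -/
def beta (_S : OddMetric h) : Module.Basis (Fin (Module.finrank ℂ h)) ℂ h := Module.finBasis ℂ h

/-- The basis `α` of `h` with `(αⁱ, βʲ) = δᵢⱼ`. -/
def alpha : Module.Basis (Fin (Module.finrank ℂ h)) ℂ h :=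
  S.pairing.dualBasis S.nondegenerate S.beta

lemma pairing_alpha_beta (i j : Fin (Module.finrank ℂ h)) :
    S.pairing (S.alpha i) (S.beta j) = if j = i then 1 else 0 :=
  LinearMap.BilinForm.apply_dualBasis_left _ _ _ _

/-- The number `N` of pairs of symplectic fermions, `dim h = 2 N`. -/
def pairs (_S : OddMetric h) : ℕ := Module.finrank ℂ h / 2

/-- The copairing `Ω = ∑ᵢ βⁱ ⊗ αⁱ`, its first leg acting by `P` and its second leg by `Q`. -/
def omegaOp {V : SuperVect.{u}} (P Q : OddOps h V) : Module.End ℂ V :=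
  ∑ i, P.lin (S.beta i) * Q.lin (S.alpha i)

lemma commute_omegaOp {V : SuperVect.{u}} {P Q : OddOps h V} {X : Module.End ℂ V}
    (hP : ∀ a, X * P.lin a = -(P.lin a * X)) (hQ : ∀ a, X * Q.lin a = -(Q.lin a * X)) :
    Commute X (S.omegaOp P Q) :=
  Commute.sum_right _ _ _ fun i _ => by
    rw [Commute, SemiconjBy, ← mul_assoc, hP, neg_mul, mul_assoc, hQ, mul_neg, neg_neg, mul_assoc]

lemma isNilpotent_omegaOp {V : SuperVect.{u}} {P Q : OddOps h V} (hPP : OddOps.Anticomm P P)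
    (hPQ : OddOps.Anticomm P Q) (hQQ : OddOps.Anticomm Q Q) : IsNilpotent (S.omegaOp P Q) := by
  have sq : ∀ a, P.lin a * P.lin a = 0 := fun a => by
    have h2 : (2 : ℂ) • (P.lin a * P.lin a) = 0 := by
      rw [two_smul]; nth_rewrite 1 [hPP a a]; simp
    exact (smul_eq_zero.mp h2).resolve_left two_ne_zero
  refine Commute.isNilpotent_sum (fun i _ => ⟨2, ?_⟩) (fun i j _ _ => ?_)
  · rw [pow_two, mul_assoc, ← mul_assoc (Q.lin _), hPQ.symm, neg_mul, mul_neg, ← mul_assoc,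
      ← mul_assoc, sq]
    simp
  · have hX : ∀ (R : OddOps h V), OddOps.Anticomm P R → OddOps.Anticomm Q R → ∀ a,
        Commute (P.lin (S.beta i) * Q.lin (S.alpha i)) (R.lin a) := fun R h1 h2 a => by
      rw [Commute, SemiconjBy, mul_assoc, h2, mul_neg, ← mul_assoc, h1, neg_mul, neg_neg,
        mul_assoc]
    exact (hX P hPP hPQ.symm _).mul_right (hX Q hPQ hQQ _)

/-- `exp(c Ω)`, with the legs of `Ω` acting by `P` and `Q`. -/
def expOmega (c : ℂ) {V : SuperVect.{u}} (P Q : OddOps h V) : V ⟶ V :=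
  SuperVect.Hom.ofCommute (expNil (c • S.omegaOp P Q))
    (commute_expNil ((S.commute_omegaOp P.mul_parity Q.mul_parity).smul_right c)).eq.symm

lemma expOmega_comm (c : ℂ) {V : SuperVect.{u}} {P Q R : OddOps h V} (hP : OddOps.Anticomm R P)
    (hQ : OddOps.Anticomm R Q) (a : h) (v : V) :
    (S.expOmega c P Q).lin (R.lin a v) = R.lin a ((S.expOmega c P Q).lin v) :=
  LinearMap.congr_fun
    (commute_expNil ((S.commute_omegaOp (hP a) (hQ a)).smul_right c)).eq.symm v

/-- `Ω^{(11)} = ∑ᵢ βⁱ αⁱ` as an element of `U(h)`. -/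
def omegaElt : ExteriorAlgebra ℂ h :=
  ∑ i, ExteriorAlgebra.ι ℂ (S.beta i) * ExteriorAlgebra.ι ℂ (S.alpha i)

/-- The coefficient of the top monomial of `U(h)` in the basis of ordered monomials. -/
def topCoeff : ExteriorAlgebra ℂ h →ₗ[ℂ] ℂ := S.beta.ExteriorAlgebra.coord Finset.univ

/-- The linear form `λ` on `U(h)` which vanishes outside of the top degree `2N` and satisfies
`λ((Ω^{(11)})^N) = N! (-2/π)^N`. -/
def lambda : ExteriorAlgebra ℂ h →ₗ[ℂ] ℂ :=
  (((S.pairs.factorial : ℂ) * (-2 / (Real.pi : ℂ)) ^ S.pairs) /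
    S.topCoeff (S.omegaElt ^ S.pairs)) • S.topCoeff

section top

lemma euler {m : ℕ} {x : ExteriorAlgebra ℂ h} (hx : x ∈ ⋀[ℂ]^m h) :
    ∑ i, ExteriorAlgebra.ι ℂ (S.beta i) * contr (S.beta.coord i) x = (m : ℂ) • x := by
  induction hx using Submodule.pow_induction_on_left' with
  | algebraMap r => simp [contr_algebraMap]
  | add x y i hx hy h1 h2 => simp only [map_add, mul_add, Finset.sum_add_distrib, h1, h2, smul_add]
  | mem_mul a ha n x hx ih =>
    obtain ⟨v, rfl⟩ := ha
    have e1 : ∀ i, ExteriorAlgebra.ι ℂ (S.beta i) *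
        contr (S.beta.coord i) (ExteriorAlgebra.ι ℂ v * x) =
        ExteriorAlgebra.ι ℂ (S.beta.repr v i • S.beta i) * x +
          ExteriorAlgebra.ι ℂ v * (ExteriorAlgebra.ι ℂ (S.beta i) * contr (S.beta.coord i) x) := by
      intro i
      rw [contr_ι_mul, mul_sub, ← mul_assoc, ← mul_assoc (ExteriorAlgebra.ι ℂ v),
        eq_neg_of_add_eq_zero_left (ExteriorAlgebra.ι_add_mul_swap (S.beta i) v), neg_mul,
        sub_neg_eq_add, map_smul, smul_mul_assoc, mul_smul_comm, Module.Basis.coord_apply]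
    simp only [e1, Finset.sum_add_distrib, ← Finset.mul_sum, ih, ← Finset.sum_mul, ← map_sum,
      S.beta.sum_repr]
    rw [mul_smul_comm, Nat.succ_eq_add_one, Nat.cast_add, add_smul, Nat.cast_one, one_smul,
      add_comm]

lemma coord_of_mem {m : ℕ} {x : ExteriorAlgebra ℂ h} (hx : x ∈ ⋀[ℂ]^m h)
    {s : Finset (Fin (Module.finrank ℂ h))} (hs : s.card ≠ m) :
    S.beta.ExteriorAlgebra.coord s x = 0 := by
  have key : (⟨x, hx⟩ : ⋀[ℂ]^m h) ∈ LinearMap.ker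
      (S.beta.ExteriorAlgebra.coord s ∘ₗ (⋀[ℂ]^m h).subtype) := by
    have : LinearMap.ker (S.beta.ExteriorAlgebra.coord s ∘ₗ (⋀[ℂ]^m h).subtype) = ⊤ := by
      rw [LinearMap.ker_eq_top]
      refine (S.beta.exteriorPower m).ext fun t => ?_
      rw [LinearMap.comp_apply, Submodule.subtype_apply, ← ExteriorAlgebra.basis_eq_coe_basis,
        Module.Basis.coord_apply, Module.Basis.repr_self, LinearMap.zero_apply,
        Finsupp.single_eq_of_ne]
      rintro rfl
      exact hs t.2
    rw [this]; trivial
  exact key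

lemma commute_omegaElt (w : h) : Commute (ExteriorAlgebra.ι ℂ w) S.omegaElt :=
  Commute.sum_right _ _ _ fun i _ => by
    have h1 := eq_neg_of_add_eq_zero_left (ExteriorAlgebra.ι_add_mul_swap (R := ℂ) w (S.beta i))
    have h2 := eq_neg_of_add_eq_zero_left (ExteriorAlgebra.ι_add_mul_swap (R := ℂ) w (S.alpha i))
    rw [Commute, SemiconjBy, ← mul_assoc, h1, neg_mul, mul_assoc, h2, mul_neg, neg_neg, mul_assoc]

lemma sum_alpha (w : h) : ∑ i, S.pairing w (S.beta i) • S.alpha i = w := by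
  conv_rhs => rw [← S.alpha.sum_repr w]
  exact Finset.sum_congr rfl fun i _ => by rw [alpha, LinearMap.BilinForm.dualBasis_repr_apply]

lemma sum_beta (w : h) : ∑ i, S.pairing w (S.alpha i) • S.beta i = -w := by
  have key : ∀ j, S.pairing (∑ i, S.pairing w (S.alpha i) • S.beta i + w) (S.alpha j) = 0 := by
    intro j
    have e : ∀ i, S.pairing (S.beta i) (S.alpha j) = if i = j then -1 else 0 := fun i => by
      rw [S.supersymm, pairing_alpha_beta]; split_ifs <;> simp
    simp [e]
  have : S.pairing (∑ i, S.pairing w (S.alpha i) • S.beta i + w) = 0 := S.alpha.ext key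
  refine eq_neg_of_add_eq_zero_left (S.nondegenerate.1 _ fun y => ?_)
  rw [this]; rfl

lemma contr_omegaElt_mul (w : h) (x : ExteriorAlgebra ℂ h) :
    contr (S.pairing w) (S.omegaElt * x) =
      (2 : ℂ) • (ExteriorAlgebra.ι ℂ w * x) + S.omegaElt * contr (S.pairing w) x := by
  have e : ∀ i, contr (S.pairing w)
      (ExteriorAlgebra.ι ℂ (S.beta i) * ExteriorAlgebra.ι ℂ (S.alpha i) * x) =
      ExteriorAlgebra.ι ℂ (S.pairing w (S.beta i) • S.alpha i) * x -
      ExteriorAlgebra.ι ℂ (S.pairing w (S.alpha i) • S.beta i) * x +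
      ExteriorAlgebra.ι ℂ (S.beta i) * ExteriorAlgebra.ι ℂ (S.alpha i) *
        contr (S.pairing w) x := by
    intro i
    rw [mul_assoc, contr_ι_mul, contr_ι_mul, mul_sub, mul_smul_comm, map_smul, map_smul,
      smul_mul_assoc, smul_mul_assoc, mul_assoc]
    abel
  rw [omegaElt, Finset.sum_mul, map_sum, Finset.sum_congr rfl fun i _ => e i,
    Finset.sum_add_distrib, Finset.sum_sub_distrib, ← Finset.sum_mul, ← Finset.sum_mul,
    ← Finset.sum_mul, ← map_sum, ← map_sum, sum_alpha, sum_beta, map_neg, neg_mul, sub_neg_eq_add,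
    two_smul]

lemma contr_omegaElt_pow (w : h) (k : ℕ) : contr (S.pairing w) (S.omegaElt ^ (k + 1)) =
    (2 * (k + 1) : ℂ) • (ExteriorAlgebra.ι ℂ w * S.omegaElt ^ k) := by
  induction k with
  | zero =>
    have := S.contr_omegaElt_mul w (algebraMap ℂ _ 1)
    rw [contr_algebraMap] at this
    simpa using this
  | succ k ih =>
    rw [pow_succ', contr_omegaElt_mul, ih, mul_smul_comm, ← mul_assoc S.omegaElt,
      ← (S.commute_omegaElt w).eq, mul_assoc, ← pow_succ', ← add_smul]
    congr 1
    push_cast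
    ring

lemma omegaElt_mem : S.omegaElt ∈ ⋀[ℂ]^2 h := by
  refine Submodule.sum_mem _ fun i _ => ?_
  change _ ∈ LinearMap.range (ExteriorAlgebra.ι ℂ) ^ 2
  rw [pow_two]
  exact Submodule.mul_mem_mul ⟨_, rfl⟩ ⟨_, rfl⟩

lemma omegaElt_pow_mem (k : ℕ) : S.omegaElt ^ k ∈ ⋀[ℂ]^(2 * k) h := by
  have := Submodule.pow_mem_pow _ S.omegaElt_mem k
  rwa [← pow_mul] at this

lemma isNilpotent_omegaElt : IsNilpotent S.omegaElt := by
  obtain ⟨k, hk⟩ := S.isNilpotent_omegaOp (HRep.env h).anticomm (HRep.env h).anticomm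
    (HRep.env h).anticomm
  refine ⟨k, ?_⟩
  have e : S.omegaOp (HRep.env h).act (HRep.env h).act =
      Algebra.lmul ℂ (ExteriorAlgebra ℂ h) S.omegaElt := by
    rw [omegaElt, map_sum]
    refine Finset.sum_congr rfl fun i _ => ?_
    rw [map_mul]
    rfl
  rw [e, ← map_pow] at hk
  have := LinearMap.congr_fun hk 1
  simpa using this

/-- The top power of `Ω^{(11)}` sits in the top degree of `U(h)` and does not vanish there. -/
lemma finrank_eq_and_topCoeff_ne_zero :
    Module.finrank ℂ h = 2 * S.pairs ∧ S.topCoeff (S.omegaElt ^ S.pairs) ≠ 0 := by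
  obtain ⟨k, hk, hk'⟩ : ∃ k, S.omegaElt ^ k ≠ 0 ∧ S.omegaElt ^ (k + 1) = 0 := by
    have hn := S.isNilpotent_omegaElt
    classical
    have hpos : Nat.find hn ≠ 0 := fun h0 => by
      have := Nat.find_spec hn
      rw [h0, pow_zero] at this
      exact one_ne_zero this
    refine ⟨Nat.find hn - 1, Nat.find_min hn (Nat.sub_one_lt hpos), ?_⟩
    rw [Nat.sub_add_cancel (Nat.one_le_iff_ne_zero.mpr hpos)]
    exact Nat.find_spec hn
  have hw : ∀ w : h, ExteriorAlgebra.ι ℂ w * S.omegaElt ^ k = 0 := fun w => by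
    have := S.contr_omegaElt_pow w k
    rw [hk', map_zero] at this
    refine (smul_eq_zero.mp this.symm).resolve_left ?_
    exact mul_ne_zero two_ne_zero (by exact_mod_cast Nat.succ_ne_zero k)
  have hdim : Module.finrank ℂ h = 2 * k := by
    have h1 := S.euler (S.omegaElt_pow_mem k)
    have h2 : ∀ i, ExteriorAlgebra.ι ℂ (S.beta i) *
        contr (S.beta.coord i) (S.omegaElt ^ k) = S.omegaElt ^ k := fun i => by
      have := contr_ι_mul (S.beta.coord i) (S.beta i) (S.omegaElt ^ k)
      rw [hw, map_zero] at this
      rw [← sub_eq_zero.mp this.symm]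
      simp
    simp only [h2, Finset.sum_const, Finset.card_univ, Fintype.card_fin] at h1
    rw [← Nat.cast_smul_eq_nsmul ℂ, ← sub_eq_zero, ← sub_smul] at h1
    have := (smul_eq_zero.mp h1).resolve_right hk
    exact_mod_cast sub_eq_zero.mp this
  have hN : S.pairs = k := by rw [pairs, hdim]; simp
  rw [hN]
  refine ⟨hdim, fun h0 => hk ?_⟩
  refine S.beta.ExteriorAlgebra.ext_elem fun s => ?_
  rw [map_zero, Finsupp.zero_apply, ← Module.Basis.coord_apply]
  by_cases hs : s.card = 2 * k
  · rw [← hdim] at hs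
    have : s = Finset.univ := Finset.card_eq_iff_eq_univ s |>.mp (by simpa using hs)
    rw [this]; exact h0
  · exact S.coord_of_mem (S.omegaElt_pow_mem k) hs

lemma lambda_omegaElt_pow : S.lambda (S.omegaElt ^ S.pairs) =
    (S.pairs.factorial : ℂ) * (-2 / (Real.pi : ℂ)) ^ S.pairs := by
  rw [lambda, LinearMap.smul_apply, smul_eq_mul,
    div_mul_cancel₀ _ S.finrank_eq_and_topCoeff_ne_zero.2]

lemma lambda_of_mem {m : ℕ} (hm : m ≠ 2 * S.pairs) {x : ExteriorAlgebra ℂ h}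
    (hx : x ∈ ⋀[ℂ]^m h) : S.lambda x = 0 := by
  rw [lambda, LinearMap.smul_apply, topCoeff, S.coord_of_mem hx, smul_zero]
  rw [Finset.card_univ, Fintype.card_fin, S.finrank_eq_and_topCoeff_ne_zero.1]
  exact hm.symm

lemma lambda_involute (x : ExteriorAlgebra ℂ h) :
    S.lambda (CliffordAlgebra.involute x) = S.lambda x := by
  have : S.lambda ∘ₗ CliffordAlgebra.involute.toLinearMap = S.lambda := by
    refine S.beta.ExteriorAlgebra.ext fun s => ?_
    have hs : S.beta.ExteriorAlgebra s ∈ ⋀[ℂ]^s.card h := by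
      have := ExteriorAlgebra.basis_eq_coe_basis S.beta (m := s.card) ⟨s, rfl⟩
      rw [this]
      exact Submodule.coe_mem _
    rw [LinearMap.comp_apply, AlgHom.toLinearMap_apply, involute_of_mem hs, map_smul]
    by_cases hc : s.card = 2 * S.pairs
    · rw [hc, pow_mul]; simp
    · rw [S.lambda_of_mem hc hs, smul_zero]
  exact LinearMap.congr_fun this x

end top

end OddMetric

/-! ### The category `C` and its tensor product -/

/-- The `ℤ/2`-graded category `C = C₀ + C₁` with `C₀ = Rep(h)` and `C₁ = SVect`: objects are those
of `C₀` and those of `C₁`, and there are no morphisms between the two components. -/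
abbrev GradedCat (h : Type u) [AddCommGroup h] [Module ℂ h] : Type (u + 1) := HRep.{u} h ⊕ SuperVect.{u}

namespace GradedCat

variable {h : Type u} [AddCommGroup h] [Module ℂ h]

/-- A morphism of `C₀` as a morphism of `C`. -/
def hom₀ {A B : HRep.{u} h} (f : A ⟶ B) : (Sum.inl A : GradedCat h) ⟶ Sum.inl B := ULift.up f

/-- A morphism of `C₁` as a morphism of `C`. -/
def hom₁ {A B : SuperVect.{u}} (f : A ⟶ B) : (Sum.inr A : GradedCat h) ⟶ Sum.inr B := ULift.up f

/-- The tensor product `∗` on objects; for `A, B ∈ C₁` it is `U(h) ⊗ A ⊗ B` with `h` acting on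
`U(h)`. -/
def ast : GradedCat h → GradedCat h → GradedCat h
  | Sum.inl A, Sum.inl B => Sum.inl (A ⊗ᵣ B)
  | Sum.inl A, Sum.inr B => Sum.inr (A.space ⊗ₛ B)
  | Sum.inr A, Sum.inl B => Sum.inr (A ⊗ₛ B.space)
  | Sum.inr A, Sum.inr B => Sum.inl (HRep.env h ⊗ᵣ HRep.triv h (A ⊗ₛ B))

/-- The tensor product `∗` on morphisms. -/
def astHom : {A A' B B' : GradedCat h} → (A ⟶ A') → (B ⟶ B') → (ast A B ⟶ ast A' B')
  | Sum.inl _, Sum.inl _, Sum.inl _, Sum.inl _, f, g => hom₀ (HRep.tensorHom f.down g.down)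
  | Sum.inl _, Sum.inl _, Sum.inr _, Sum.inr _, f, g =>
    hom₁ (SuperVect.tensorHom f.down.hom g.down)
  | Sum.inr _, Sum.inr _, Sum.inl _, Sum.inl _, f, g =>
    hom₁ (SuperVect.tensorHom f.down g.down.hom)
  | Sum.inr _, Sum.inr _, Sum.inr _, Sum.inr _, f, g =>
    hom₀ (HRep.tensorHom (𝟙 _) (HRep.trivHom h (SuperVect.tensorHom f.down g.down)))

/-- The tensor unit, the trivial representation `ℂ^{1|0} ∈ C₀`. -/
def one (h : Type u) [AddCommGroup h] [Module ℂ h] : GradedCat h := Sum.inl (HRep.triv h SuperVect.unit)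

/-- The left unit morphism `1 ∗ A → A`, `z ⊗ v ↦ z v`. -/
def leftUnit : (A : GradedCat h) → (ast (one h) A ⟶ A)
  | Sum.inl A => hom₀ (HRep.leftUnit A)
  | Sum.inr A => hom₁ (SuperVect.leftUnit A)

/-- The right unit morphism `A ∗ 1 → A`, `v ⊗ z ↦ z v`. -/
def rightUnit : (A : GradedCat h) → (ast A (one h) ⟶ A)
  | Sum.inl A => hom₀ (HRep.rightUnit A)
  | Sum.inr A => hom₁ (SuperVect.rightUnit A)

end GradedCat

namespace OddMetric

open GradedCat

variable {h : Type u} [AddCommGroup h] [Module ℂ h] [FiniteDimensional ℂ h] (S : OddMetric h)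

/-- The linear form `λ` as an even map. -/
def lambdaHom : HRep.envSpace h ⟶ SuperVect.unit :=
  SuperVect.Hom.ofCommute
    ((ULift.moduleEquiv : ULift.{u} ℂ ≃ₗ[ℂ] ℂ).symm.toLinearMap ∘ₗ S.lambda) (by
    rw [SuperVect.parity_unit, HRep.parity_env]
    exact LinearMap.ext fun x => congrArg ULift.up (S.lambda_involute x))

/-- The element `exp(c Ω)` of `U(h) ⊗ U(h)`. -/
def expOmegaElt (c : ℂ) : ExteriorAlgebra ℂ h ⊗[ℂ] ExteriorAlgebra ℂ h :=
  (S.expOmega c ((HRep.leftMul h).onLeft (HRep.envSpace h))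
    (OddOps.onRight (HRep.envSpace h) (HRep.leftMul h))).lin
    ((1 : ExteriorAlgebra ℂ h) ⊗ₜ[ℂ] (1 : ExteriorAlgebra ℂ h))

lemma parity_expOmegaElt (c : ℂ) :
    (HRep.envSpace h ⊗ₛ HRep.envSpace h).parity (S.expOmegaElt c) = S.expOmegaElt c := by
  rw [expOmegaElt, ← SuperVect.Hom.map_parity, SuperVect.parity_tmul, HRep.parity_env,
    AlgHom.toLinearMap_apply, map_one]

/-- The even map `exp(c Ω) ⊗ id_V : V → U(h) ⊗ U(h) ⊗ V`. -/
def insertExpOmega (c : ℂ) (V : SuperVect.{u}) :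
    V ⟶ (HRep.envSpace h ⊗ₛ HRep.envSpace h) ⊗ₛ V :=
  SuperVect.Hom.ofCommute (TensorProduct.mk ℂ _ _ (S.expOmegaElt c))
    (LinearMap.ext fun v => by
      rw [LinearMap.comp_apply, LinearMap.comp_apply, TensorProduct.mk_apply,
        TensorProduct.mk_apply, SuperVect.parity_tmul, parity_expOmegaElt])

/-- The map `φ = (id ⊗ (λ ∘ μ)) ∘ (exp(-π i Ω) ⊗ id) : U(h) → U(h)`. -/
def phi : HRep.envSpace h ⟶ HRep.envSpace h :=
  S.insertExpOmega (-(Real.pi * Complex.I)) (HRep.envSpace h) ≫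
    SuperVect.assoc _ _ _ ≫
    SuperVect.tensorHom (𝟙 _) (HRep.mulHom h ≫ S.lambdaHom) ≫
    SuperVect.rightUnit _

/-- `exp(c Ω)` on a representation whose action super-commutes with both legs. -/
def expOmegaRep (c : ℂ) (A : HRep h) (P Q : OddOps h A.space) (hP : OddOps.Anticomm A.act P)
    (hQ : OddOps.Anticomm A.act Q) : A ⟶ A :=
  HRep.Hom.mk (S.expOmega c P Q) fun a v => S.expOmega_comm c hP hQ a v

/-- The associator `α_{A,B,C} : A ∗ (B ∗ C) → (A ∗ B) ∗ C`. -/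
def associator : (A B C : GradedCat h) → (ast A (ast B C) ⟶ ast (ast A B) C)
  | Sum.inl A, Sum.inl B, Sum.inl C => hom₀ (HRep.assocInv A B C)
  | Sum.inl A, Sum.inl B, Sum.inr C => hom₁ (SuperVect.assocInv A.space B.space C)
  | Sum.inl A, Sum.inr B, Sum.inl C => hom₁ (
      -- `exp(π i Ω^{(13)})` on `A ⊗ B ⊗ C`
      S.expOmega (Real.pi * Complex.I) (A.act.onLeft (B ⊗ₛ C.space))
        (OddOps.onRight A.space (OddOps.onRight B C.act)) ≫
      SuperVect.assocInv A.space B C.space)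
  | Sum.inr A, Sum.inl B, Sum.inl C => hom₁ (SuperVect.assocInv A B.space C.space)
  | Sum.inl A, Sum.inr B, Sum.inr C => hom₀ (
      HRep.assocInv A (HRep.env h) (HRep.triv h (B ⊗ₛ C)) ≫
      HRep.tensorHom
        -- the map `A ⊗ U(h) → U(h) ⊗ A`
        (HRep.flip A (HRep.env h) ≫
          HRep.tensorHom (HRep.coprodHom h ≫ HRep.flip (HRep.env h) (HRep.env h)) (𝟙 A) ≫
          HRep.assoc (HRep.env h) (HRep.env h) A ≫
          HRep.tensorHom (𝟙 (HRep.env h)) (HRep.antipodeAct A))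
        (𝟙 (HRep.triv h (B ⊗ₛ C))) ≫
      HRep.assoc (HRep.env h) (HRep.triv h A.space) (HRep.triv h (B ⊗ₛ C)) ≫
      HRep.tensorHom (𝟙 (HRep.env h))
        (HRep.trivTensor h A.space (B ⊗ₛ C) ≫ HRep.trivHom h (SuperVect.assocInv A.space B C)))
  | Sum.inr A, Sum.inl B, Sum.inr C => hom₀ (
      -- `exp(π i Ω^{(13)})` on `U(h) ⊗ A ⊗ B ⊗ C`
      S.expOmegaRep (Real.pi * Complex.I)
        (HRep.env h ⊗ᵣ HRep.triv h (A ⊗ₛ (B.space ⊗ₛ C)))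
        ((HRep.leftMul h).onLeft (A ⊗ₛ (B.space ⊗ₛ C)))
        (OddOps.onRight (HRep.envSpace h) (OddOps.onRight A (B.act.onLeft C)))
        (HRep.anticomm_tensor_onLeft (HRep.env h).anticomm)
        (HRep.anticomm_tensor_onRight (HRep.anticomm_triv _)) ≫
      HRep.tensorHom (𝟙 (HRep.env h)) (HRep.trivHom h (SuperVect.assocInv A B.space C)))
  | Sum.inr A, Sum.inr B, Sum.inl C => hom₀ (
      HRep.tensorHom (HRep.coprodHom h) (HRep.trivHom h (SuperVect.assocInv A B C.space)) ≫
      HRep.assoc (HRep.env h) (HRep.env h) (HRep.triv h ((A ⊗ₛ B) ⊗ₛ C.space)) ≫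
      HRep.tensorHom (𝟙 (HRep.env h))
        -- the map `U(h) ⊗ (A ⊗ B) ⊗ C → (A ⊗ B) ⊗ C`
        (HRep.tensorHom (𝟙 (HRep.env h)) (HRep.trivTensorInv h (A ⊗ₛ B) C.space) ≫
          HRep.assocInv (HRep.env h) (HRep.triv h (A ⊗ₛ B)) (HRep.triv h C.space) ≫
          HRep.tensorHom (HRep.flip (HRep.env h) (HRep.triv h (A ⊗ₛ B)))
            (𝟙 (HRep.triv h C.space)) ≫
          HRep.assoc (HRep.triv h (A ⊗ₛ B)) (HRep.env h) (HRep.triv h C.space) ≫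
          HRep.tensorHom (𝟙 (HRep.triv h (A ⊗ₛ B))) (HRep.actIntertwiner C)) ≫
      HRep.assocInv (HRep.env h) (HRep.triv h (A ⊗ₛ B)) C)
  | Sum.inr A, Sum.inr B, Sum.inr C => hom₁ (
      SuperVect.assocInv A (HRep.envSpace h) (B ⊗ₛ C) ≫
      SuperVect.tensorHom
        (SuperVect.flip A (HRep.envSpace h) ≫ SuperVect.tensorHom S.phi (𝟙 A)) (𝟙 (B ⊗ₛ C)) ≫
      SuperVect.assoc (HRep.envSpace h) A (B ⊗ₛ C) ≫
      SuperVect.tensorHom (𝟙 (HRep.envSpace h)) (SuperVect.assocInv A B C) ≫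
      SuperVect.assocInv (HRep.envSpace h) (A ⊗ₛ B) C)

/-- The braiding `c_{A,B} : A ∗ B → B ∗ A`. -/
def braid : (A B : GradedCat h) → (ast A B ⟶ ast B A)
  | Sum.inl A, Sum.inl B => hom₀ (
      -- `τ ∘ exp(-π i Ω^{(12)})`
      S.expOmegaRep (-(Real.pi * Complex.I)) (A ⊗ᵣ B)
        (A.act.onLeft B.space) (OddOps.onRight A.space B.act)
        (HRep.anticomm_tensor_onLeft A.anticomm) (HRep.anticomm_tensor_onRight B.anticomm) ≫
      HRep.flip A B)
  | Sum.inl A, Sum.inr B => hom₁ (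
      -- `τ ∘ exp((π i / 2) Ω^{(11)})`
      S.expOmega (Real.pi * Complex.I / 2) (A.act.onLeft B) (A.act.onLeft B) ≫
      SuperVect.flip A.space B)
  | Sum.inr A, Sum.inl B => hom₁ (
      -- `τ ∘ exp((π i / 2) Ω^{(22)}) ∘ (id ⊗ ω)`
      SuperVect.tensorHom (𝟙 A) B.space.parityHom ≫
      S.expOmega (Real.pi * Complex.I / 2) (OddOps.onRight A B.act) (OddOps.onRight A B.act) ≫
      SuperVect.flip A B.space)
  | Sum.inr A, Sum.inr B => hom₀ (
      -- `exp(-π i N / 4) (id ⊗ τ) ∘ exp(-(π i / 2) Ω^{(11)}) ∘ (id ⊗ id ⊗ ω)`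
      HRep.tensorHom (𝟙 (HRep.env h))
        (HRep.trivHom h (SuperVect.tensorHom (𝟙 A) B.parityHom)) ≫
      S.expOmegaRep (-(Real.pi * Complex.I / 2)) (HRep.env h ⊗ᵣ HRep.triv h (A ⊗ₛ B))
        ((HRep.leftMul h).onLeft (A ⊗ₛ B)) ((HRep.leftMul h).onLeft (A ⊗ₛ B))
        (HRep.anticomm_tensor_onLeft (HRep.env h).anticomm)
        (HRep.anticomm_tensor_onLeft (HRep.env h).anticomm) ≫
      HRep.tensorHom (𝟙 (HRep.env h)) (HRep.trivHom h
        (SuperVect.flip A B ≫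
          SuperVect.scale (Complex.exp (-(Real.pi * Complex.I * S.pairs / 4))) (B ⊗ₛ A))))

/-- `(C, ∗, α)` is a monoidal category, with the unit object and unit isomorphisms above. -/
structure IsMonoidal : Prop where
  /-- `∗` is a functor. -/
  ast_id : ∀ A B : GradedCat h, astHom (𝟙 A) (𝟙 B) = 𝟙 (ast A B)
  ast_comp : ∀ {A A' A'' B B' B'' : GradedCat h} (f : A ⟶ A') (f' : A' ⟶ A'') (g : B ⟶ B')
    (g' : B' ⟶ B''), astHom (f ≫ f') (g ≫ g') = astHom f g ≫ astHom f' g'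
  /-- `α` is a natural isomorphism. -/
  associator_isIso : ∀ A B C : GradedCat h, IsIso (S.associator A B C)
  associator_natural : ∀ {A A' B B' C C' : GradedCat h} (f : A ⟶ A') (g : B ⟶ B') (k : C ⟶ C'),
    astHom f (astHom g k) ≫ S.associator A' B' C' =
      S.associator A B C ≫ astHom (astHom f g) k
  /-- The unit morphisms are natural isomorphisms. -/
  leftUnit_isIso : ∀ A : GradedCat h, IsIso (leftUnit A)
  leftUnit_natural : ∀ {A B : GradedCat h} (f : A ⟶ B),
    astHom (𝟙 (one h)) f ≫ leftUnit B = leftUnit A ≫ f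
  rightUnit_isIso : ∀ A : GradedCat h, IsIso (rightUnit A)
  rightUnit_natural : ∀ {A B : GradedCat h} (f : A ⟶ B),
    astHom f (𝟙 (one h)) ≫ rightUnit B = rightUnit A ≫ f
  /-- The pentagon `A ∗ (B ∗ (C ∗ D)) → ((A ∗ B) ∗ C) ∗ D`. -/
  pentagon : ∀ A B C D : GradedCat h,
    astHom (𝟙 A) (S.associator B C D) ≫ S.associator A (ast B C) D ≫
        astHom (S.associator A B C) (𝟙 D) =
      S.associator A B (ast C D) ≫ S.associator (ast A B) C D
  /-- The triangle `A ∗ (1 ∗ B) → A ∗ B`. -/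
  triangle : ∀ A B : GradedCat h,
    S.associator A (one h) B ≫ astHom (rightUnit A) (𝟙 B) = astHom (𝟙 A) (leftUnit B)

/-- The monoidal category `(C, ∗, α)` in Mathlib's format, whose associators go from
`(A ∗ B) ∗ C` to `A ∗ (B ∗ C)`. -/
@[reducible]
def monoidalCategory (H : S.IsMonoidal) : MonoidalCategory (GradedCat h) where
  tensorObj := ast
  whiskerLeft A _ _ g := astHom (𝟙 A) g
  whiskerRight f B := astHom f (𝟙 B)
  tensorHom f g := astHom f g
  tensorUnit := one h
  associator A B C :=
    haveI := H.associator_isIso A B C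
    (asIso (S.associator A B C)).symm
  leftUnitor A :=
    haveI := H.leftUnit_isIso A
    asIso (leftUnit A)
  rightUnitor A :=
    haveI := H.rightUnit_isIso A
    asIso (rightUnit A)
  tensorHom_def f g := by
    rw [← H.ast_comp, Category.comp_id, Category.id_comp]
  id_tensorHom_id A B := H.ast_id A B
  tensorHom_comp_tensorHom f g f' g' := (H.ast_comp f f' g g').symm
  whiskerLeft_id A B := H.ast_id A B
  id_whiskerRight A B := H.ast_id A B
  associator_naturality {A B C A' B' C'} f g k := by
    have := H.associator_isIso A B C
    have := H.associator_isIso A' B' C'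
    change astHom (astHom f g) k ≫ inv (S.associator A' B' C') =
      inv (S.associator A B C) ≫ astHom f (astHom g k)
    rw [IsIso.comp_inv_eq, Category.assoc, H.associator_natural, IsIso.inv_hom_id_assoc]
  leftUnitor_naturality f := H.leftUnit_natural f
  rightUnitor_naturality f := H.rightUnit_natural f
  pentagon A B C D := by
    have := H.associator_isIso
    have whiskR : ∀ {X Y : GradedCat h} (f : X ⟶ Y) [IsIso f], astHom f (𝟙 D) ≫ astHom (inv f) (𝟙 D) =
        𝟙 _ := fun f _ => by
      rw [← H.ast_comp, IsIso.hom_inv_id, Category.comp_id, H.ast_id]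
    change astHom (inv (S.associator A B C)) (𝟙 D) ≫ inv (S.associator A (ast B C) D) ≫
        astHom (𝟙 A) (inv (S.associator B C D)) =
      inv (S.associator (ast A B) C D) ≫ inv (S.associator A B (ast C D))
    rw [← IsIso.inv_comp]
    refine (IsIso.inv_eq_of_hom_inv_id ?_).symm
    rw [← H.pentagon]
    simp only [Category.assoc]
    rw [reassoc_of% (whiskR (S.associator A B C)), IsIso.hom_inv_id_assoc, ← H.ast_comp,
      IsIso.hom_inv_id, Category.comp_id, H.ast_id]
  triangle A B := by
    have := H.associator_isIso A (one h) B
    change inv (S.associator A (one h) B) ≫ astHom (𝟙 A) (leftUnit B) =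
      astHom (rightUnit A) (𝟙 B)
    rw [IsIso.inv_comp_eq, H.triangle]

end OddMetric

end
end SymplecticFermions

/-!
All identities are checked on underlying super-vector spaces, through the faithful functor
`GradedCat.space` to `SVect`. There, every associator and every braiding, apart from `φ`, is a
composition of exponentials `exp(c Ω(P, Q))`, whose legs `P`, `Q` are families of odd operators
indexed by `h`, a permutation of tensor factors with its Koszul signs and, for the braidings,
parity involutions and a scalar. For the associators of the degrees `011` and `110`, which are
defined through the coproduct of `U = U(h)`, this is `assoc₀₁₁_eq` and `assoc₁₁₀_eq`: they are
`exp(∓Ω)` with one leg acting on a representation and the other one acting on `U` by the odd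
derivations `deriv`, the contractions with `(a, -)`. These derivations are canonically conjugate to
left multiplication on `U`, the class `CanonicalPair`.

An exponential is moved to the front of a composition by `comp_expOmega`, which only needs the
operators that correspond to its legs under the map in front of it. These are found by instance
search for the class `Intertwines`, and the required super-commutations by instance search for
`SuperCommute`. Exponentials with super-commuting legs commute and add up. For those that involve
both the derivations and left multiplication, conjugation is a translation of operators
(`expOmega_intertwines`), which gives the commutation rules `expOmega_conj` and
`expOmega_conj_gaussian`. Once the exponentials cancel, an identity between permutations is left;
it is checked on homogeneous vectors, where moving `u` past `a` replaces `u` by `σ u` for an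
involution `σ` that depends on the parity of `a` (`HasSign`).

The map `φ` is a Fourier transform on the exterior algebra `U`: it exchanges left multiplication
and derivation up to scalars (`intertwines_phi_deriv`, `intertwines_phi_leftMul`), it sends
Gaussians `exp(t Ω^{(11)})` to multiples of Gaussians (`phi_gaussian`), and its square is the
parity involution (`phi_phi`). The first property settles the pentagons with three objects of `C₁`.
In the pentagon of degrees `1111`, both sides transform in the same way under left multiplication
on the two factors `U`, and at `1` they agree because `φ² 1 = 1`. The hexagons of degrees `111`
reduce to the relation `φ G φ = s² G⁻¹ φ G⁻¹` with `G = exp((i π / 2) Ω^{(11)})` and `s² = (-i)^N`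
(`phi_gaussian_phi`); the scalar `s = exp(-i π N / 4)` is the one in the braiding of two objects of
`C₁`.
-/

namespace SymplecticFermions

open CategoryTheory TensorProduct

noncomputable section

/-! ### Odd operators and their intertwiners -/

namespace SuperVect

lemma hom_ext {V W : SuperVect.{u}} {f g : V ⟶ W} (H : ∀ v, f.lin v = g.lin v) : f = g :=
  Hom.ext (LinearMap.ext H)

lemma congr_lin {V W : SuperVect.{u}} {f g : V ⟶ W} (H : f = g) (v : V) : f.lin v = g.lin v := by
  rw [H]

lemma id_lin_apply (V : SuperVect.{u}) (v : V) : Hom.lin (𝟙 V) v = v := rfl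

lemma comp_lin_apply {V W X : SuperVect.{u}} (f : V ⟶ W) (g : W ⟶ X) (v : V) :
    (f ≫ g).lin v = g.lin (f.lin v) := rfl

lemma parityHom_lin_apply (V : SuperVect.{u}) (v : V) : V.parityHom.lin v = V.parity v := rfl

end SuperVect

namespace OddOps

variable {h : Type u} [AddCommGroup h] [Module ℂ h]

lemma ext_lin {V : SuperVect.{u}} {P Q : OddOps h V} (H : ∀ a, P.lin a = Q.lin a) : P = Q := by
  cases P; cases Q
  congr
  exact LinearMap.ext H

/-! The families of odd operators on `V` form a vector space. -/

instance (V : SuperVect.{u}) : Zero (OddOps h V) := ⟨HRep.zeroAct h V⟩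

instance (V : SuperVect.{u}) : Add (OddOps h V) :=
  ⟨fun P Q => ofAnticomm (P.lin + Q.lin) fun a => by
    rw [LinearMap.add_apply, mul_add, add_mul, neg_add, mul_parity, mul_parity]⟩

instance (V : SuperVect.{u}) : SMul ℂ (OddOps h V) :=
  ⟨fun z P => ofAnticomm (z • P.lin) fun a => by
    rw [LinearMap.smul_apply, mul_smul_comm, smul_mul_assoc, mul_parity, smul_neg]⟩

variable {V : SuperVect.{u}}

lemma zero_lin (a : h) : (0 : OddOps h V).lin a = 0 := rfl

lemma add_lin (P Q : OddOps h V) (a : h) : (P + Q).lin a = P.lin a + Q.lin a := rfl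

lemma smul_lin (z : ℂ) (P : OddOps h V) (a : h) : (z • P).lin a = z • P.lin a := rfl

lemma onLeft_add (P Q : OddOps h V) (W : SuperVect.{u}) :
    (P + Q).onLeft W = P.onLeft W + Q.onLeft W :=
  ext_lin fun a => by
    rw [onLeft_lin, add_lin, add_lin, onLeft_lin, onLeft_lin, TensorProduct.map_add_left]

lemma onRight_add (W : SuperVect.{u}) (P Q : OddOps h V) :
    onRight W (P + Q) = onRight W P + onRight W Q :=
  ext_lin fun a => by
    rw [onRight_lin, add_lin, add_lin, onRight_lin, onRight_lin, TensorProduct.map_add_right]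

lemma onLeft_smul (z : ℂ) (P : OddOps h V) (W : SuperVect.{u}) :
    (z • P).onLeft W = z • P.onLeft W :=
  ext_lin fun a => by
    rw [onLeft_lin, smul_lin, smul_lin, onLeft_lin, TensorProduct.map_smul_left]

lemma onRight_smul (W : SuperVect.{u}) (z : ℂ) (P : OddOps h V) :
    onRight W (z • P) = z • onRight W P :=
  ext_lin fun a => by
    rw [onRight_lin, smul_lin, smul_lin, onRight_lin, TensorProduct.map_smul_right]

lemma onLeft_zero (W : SuperVect.{u}) : (0 : OddOps h V).onLeft W = 0 :=
  ext_lin fun a => by rw [onLeft_lin, zero_lin, zero_lin, TensorProduct.map_zero_left]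

lemma onRight_zero (W : SuperVect.{u}) : onRight W (0 : OddOps h V) = 0 :=
  ext_lin fun a => by rw [onRight_lin, zero_lin, zero_lin, TensorProduct.map_zero_right]

lemma add_zero' (P : OddOps h V) : P + 0 = P :=
  ext_lin fun a => by rw [add_lin, zero_lin, add_zero]

lemma onLeft_tmul (P : OddOps h V) (W : SuperVect.{u}) (a : h) (v : V) (w : W) :
    (P.onLeft W).lin a (v ⊗ₜ[ℂ] w) = P.lin a v ⊗ₜ[ℂ] w := rfl

lemma onRight_tmul (W : SuperVect.{u}) (P : OddOps h V) (a : h) (w : W) (v : V) :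
    (onRight W P).lin a (w ⊗ₜ[ℂ] v) = W.parity w ⊗ₜ[ℂ] P.lin a v := rfl

lemma parity_lin (P : OddOps h V) (a : h) (v : V) :
    V.parity (P.lin a v) = -P.lin a (V.parity v) :=
  LinearMap.congr_fun (P.mul_parity a) v

/-- Two families of odd operators super-commute; the class form of `OddOps.Anticomm`, so that
the super-commutation of operators on different tensor factors is found by instance search. -/
class SuperCommute (P Q : OddOps h V) : Prop where
  anticomm : Anticomm P Q

namespace SuperCommute

lemma symm (P Q : OddOps h V) [H : SuperCommute P Q] : SuperCommute Q P := ⟨H.anticomm.symm⟩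

instance (P Q R : OddOps h V) [H : SuperCommute P R] [H' : SuperCommute Q R] :
    SuperCommute (P + Q) R :=
  ⟨fun a b => by rw [add_lin, add_mul, mul_add, H.anticomm, H'.anticomm, neg_add]⟩

instance (P Q R : OddOps h V) [H : SuperCommute R P] [H' : SuperCommute R Q] :
    SuperCommute R (P + Q) :=
  ⟨fun a b => by rw [add_lin, add_mul, mul_add, H.anticomm, H'.anticomm, neg_add]⟩

instance (z : ℂ) (P R : OddOps h V) [H : SuperCommute P R] : SuperCommute (z • P) R :=
  ⟨fun a b => by rw [smul_lin, smul_mul_assoc, mul_smul_comm, H.anticomm, smul_neg]⟩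

instance (z : ℂ) (P R : OddOps h V) [H : SuperCommute R P] : SuperCommute R (z • P) :=
  ⟨fun a b => by rw [smul_lin, smul_mul_assoc, mul_smul_comm, H.anticomm, smul_neg]⟩

instance (P Q : OddOps h V) (W : SuperVect.{u}) [H : SuperCommute P Q] :
    SuperCommute (P.onLeft W) (Q.onLeft W) := ⟨H.anticomm.onLeft W⟩

instance (P Q : OddOps h V) (W : SuperVect.{u}) [H : SuperCommute P Q] :
    SuperCommute (onRight W P) (onRight W Q) := ⟨H.anticomm.onRight W⟩

instance {W : SuperVect.{u}} (P : OddOps h V) (Q : OddOps h W) :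
    SuperCommute (P.onLeft W) (onRight V Q) := ⟨anticomm_onLeft_onRight P Q⟩

instance {W : SuperVect.{u}} (P : OddOps h V) (Q : OddOps h W) :
    SuperCommute (onRight V Q) (P.onLeft W) := ⟨(anticomm_onLeft_onRight P Q).symm⟩

instance (A : HRep h) : SuperCommute A.act A.act := ⟨A.anticomm⟩

instance : SuperCommute (HRep.leftMul h) (HRep.leftMul h) := ⟨(HRep.env h).anticomm⟩

end SuperCommute

/-- `Intertwines f P Q` says that `f ∘ P a = Q a ∘ f` for all `a`. The family `P` on the source is
an output parameter: instance search transports `Q` backwards along `f`. -/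
class Intertwines {V W : SuperVect.{u}} (f : V ⟶ W) (P : outParam (OddOps h V))
    (Q : OddOps h W) : Prop where
  comm : ∀ a v, f.lin (P.lin a v) = Q.lin a (f.lin v)

namespace Intertwines

variable {W X V' W' : SuperVect.{u}}

lemma of_tmul {f : V ⊗ₛ W ⟶ X} {P : OddOps h (V ⊗ₛ W)} {Q : OddOps h X}
    (H : ∀ a v w, f.lin (P.lin a (v ⊗ₜ[ℂ] w)) = Q.lin a (f.lin (v ⊗ₜ[ℂ] w))) :
    Intertwines f P Q :=
  ⟨fun a v => LinearMap.congr_fun (TensorProduct.ext' (H a) :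
    f.lin ∘ₗ P.lin a = Q.lin a ∘ₗ f.lin) v⟩

instance (P : OddOps h V) : Intertwines (𝟙 V) P P := ⟨fun _ _ => rfl⟩

instance (f : V ⟶ W) (g : W ⟶ X) (P : OddOps h V) (Q : OddOps h W) (R : OddOps h X)
    [H' : Intertwines g Q R] [H : Intertwines f P Q] : Intertwines (f ≫ g) P R :=
  ⟨fun a v => by
    rw [SuperVect.comp_lin_apply, H.comm, H'.comm, SuperVect.comp_lin_apply]⟩

instance (f : V ⟶ W) (P P' : OddOps h V) (Q Q' : OddOps h W) [H : Intertwines f P Q]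
    [H' : Intertwines f P' Q'] : Intertwines f (P + P') (Q + Q') := ⟨fun a v => by
  rw [add_lin, add_lin, LinearMap.add_apply, LinearMap.add_apply, map_add, H.comm, H'.comm]⟩

instance (f : V ⟶ W) (z : ℂ) (P : OddOps h V) (Q : OddOps h W) [H : Intertwines f P Q] :
    Intertwines f (z • P) (z • Q) := ⟨fun a v => by
  rw [smul_lin, smul_lin, LinearMap.smul_apply, LinearMap.smul_apply, map_smul, H.comm]⟩

instance (f : V ⟶ V') (g : W ⟶ W') (P : OddOps h V) (Q : OddOps h V') [H : Intertwines f P Q] :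
    Intertwines (SuperVect.tensorHom f g) (P.onLeft W) (Q.onLeft W') := of_tmul fun a v w => by
  rw [onLeft_tmul, SuperVect.tensorHom_tmul, SuperVect.tensorHom_tmul, onLeft_tmul, H.comm]

instance (f : V ⟶ V') (g : W ⟶ W') (P : OddOps h W) (Q : OddOps h W') [H : Intertwines g P Q] :
    Intertwines (SuperVect.tensorHom f g) (onRight V P) (onRight V' Q) := of_tmul fun a v w => by
  rw [onRight_tmul, SuperVect.tensorHom_tmul, SuperVect.tensorHom_tmul, onRight_tmul, H.comm,
    SuperVect.Hom.map_parity]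

lemma of_tmul_tmul {f : (V ⊗ₛ W) ⊗ₛ X ⟶ V'} {P : OddOps h ((V ⊗ₛ W) ⊗ₛ X)} {Q : OddOps h V'}
    (H : ∀ a v w x, f.lin (P.lin a ((v ⊗ₜ[ℂ] w) ⊗ₜ[ℂ] x)) =
      Q.lin a (f.lin ((v ⊗ₜ[ℂ] w) ⊗ₜ[ℂ] x))) :
    Intertwines f P Q :=
  ⟨fun a v => LinearMap.congr_fun (TensorProduct.ext_threefold (H a) :
    f.lin ∘ₗ P.lin a = Q.lin a ∘ₗ f.lin) v⟩

lemma of_tmul_tmul' {f : V ⊗ₛ (W ⊗ₛ X) ⟶ V'} {P : OddOps h (V ⊗ₛ (W ⊗ₛ X))} {Q : OddOps h V'}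
    (H : ∀ a v w x, f.lin (P.lin a (v ⊗ₜ[ℂ] (w ⊗ₜ[ℂ] x))) =
      Q.lin a (f.lin (v ⊗ₜ[ℂ] (w ⊗ₜ[ℂ] x)))) :
    Intertwines f P Q :=
  ⟨fun a v => LinearMap.congr_fun (TensorProduct.ext_threefold' (H a) :
    f.lin ∘ₗ P.lin a = Q.lin a ∘ₗ f.lin) v⟩

-- `no_index` below lets the discrimination trees match a tensor product up to the unfolding of its
-- carrier.
instance (P : OddOps h V) : Intertwines (SuperVect.assoc V W X)
    ((P.onLeft W).onLeft X) (P.onLeft (no_index (W ⊗ₛ X))) := of_tmul_tmul fun _ _ _ _ => rfl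

instance (P : OddOps h W) : Intertwines (SuperVect.assoc V W X)
    ((onRight V P).onLeft X) (onRight V (P.onLeft X)) := of_tmul_tmul fun _ _ _ _ => rfl

instance (P : OddOps h X) : Intertwines (SuperVect.assoc V W X)
    (onRight (V ⊗ₛ W) P) (onRight V (onRight W P)) := of_tmul_tmul fun a v w x => by
  rw [onRight_tmul, SuperVect.parity_tmul]; rfl

instance (P : OddOps h V) : Intertwines (SuperVect.assocInv V W X)
    (P.onLeft (W ⊗ₛ X)) ((P.onLeft W).onLeft X) := of_tmul_tmul' fun _ _ _ _ => rfl

instance (P : OddOps h W) : Intertwines (SuperVect.assocInv V W X)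
    (onRight V (P.onLeft X)) ((onRight V P).onLeft X) := of_tmul_tmul' fun _ _ _ _ => rfl

instance (P : OddOps h X) : Intertwines (SuperVect.assocInv V W X)
    (onRight V (onRight W P)) (onRight (no_index (V ⊗ₛ W)) P) := of_tmul_tmul' fun a v w x => by
  rw [SuperVect.assocInv_tmul, onRight_tmul (V ⊗ₛ W), SuperVect.parity_tmul]; rfl

instance (P : OddOps h W) : Intertwines (SuperVect.flip V W)
    (onRight V P) (P.onLeft V) := of_tmul fun a v w => by
  rw [onRight_tmul, SuperVect.flip_tmul, SuperVect.flip_tmul, map_add, onLeft_tmul, onLeft_tmul,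
    parity_lin]
  simp only [SuperVect.evenPart_eq, SuperVect.oddPart_eq, LinearMap.smul_apply, LinearMap.add_apply,
    LinearMap.sub_apply, Module.End.one_apply, SuperVect.parity_parity, tmul_smul, tmul_add,
    tmul_sub, neg_tmul]
  module

instance (P : OddOps h V) : Intertwines (SuperVect.flip V W)
    (P.onLeft W) (onRight W P) := of_tmul fun a v w => by
  rw [onLeft_tmul, SuperVect.flip_tmul, SuperVect.flip_tmul, map_add, onRight_tmul, onRight_tmul]
  simp only [SuperVect.evenPart_eq, SuperVect.oddPart_eq, LinearMap.smul_apply, LinearMap.add_apply,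
    LinearMap.sub_apply, Module.End.one_apply, SuperVect.parity_parity, tmul_smul, tmul_add,
    tmul_sub, parity_lin, map_smul, map_add, map_sub, tmul_neg]
  module

instance (P : OddOps h V) : Intertwines V.parityHom ((-1 : ℂ) • P) P := ⟨fun a v => by
  rw [SuperVect.parityHom_lin_apply, smul_lin, LinearMap.smul_apply, map_smul, parity_lin,
    SuperVect.parityHom_lin_apply, neg_one_smul, neg_neg]⟩

instance {A B : HRep h} (f : A ⟶ B) : Intertwines f.hom A.act B.act := ⟨f.comm⟩

end Intertwines

end OddOps

/-! ### Exponentials of the copairing -/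

section exponential

variable {V W : Type*} [AddCommGroup V] [Module ℂ V] [AddCommGroup W] [Module ℂ W]

lemma expNil_eq_sum {X : Module.End ℂ V} {n : ℕ} (hn : X ^ n = 0) :
    expNil X = ∑ k ∈ Finset.range n, ((k.factorial : ℂ)⁻¹) • X ^ k := by
  have hle : nilpotencyClass X ≤ n := csInf_le' hn
  rw [expNil, Finset.sum_subset (Finset.range_mono hle)]
  intro k _ hk
  rw [pow_eq_zero_of_le (Finset.mem_range.not.mp hk |> not_lt.mp)
    (pow_nilpotencyClass ⟨n, hn⟩), smul_zero]

lemma expNil_zero : expNil (0 : Module.End ℂ V) = 1 := by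
  rw [expNil_eq_sum (pow_one 0)]; simp

/-- `expNil` agrees with the exponential of nilpotent elements of a `ℚ`-algebra. -/
lemma expNil_add {X Y : Module.End ℂ V} (H : Commute X Y) (hX : IsNilpotent X)
    (hY : IsNilpotent Y) : expNil (X + Y) = expNil X * expNil Y := by
  let _ : Module ℚ (Module.End ℂ V) := Module.compHom _ (algebraMap ℚ ℂ)
  have key : ∀ Z : Module.End ℂ V, expNil Z = IsNilpotent.exp Z := fun Z => by
    rw [expNil, IsNilpotent.exp]
    refine Finset.sum_congr rfl fun k _ => ?_
    change _ = algebraMap ℚ ℂ (k.factorial : ℚ)⁻¹ • Z ^ k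
    simp
  rw [key, key, key, IsNilpotent.exp_add_of_commute H hX hY]

lemma comp_expNil {f : V →ₗ[ℂ] W} {X : Module.End ℂ V} {Y : Module.End ℂ W}
    (H : ∀ v, f (X v) = Y (f v)) (hX : IsNilpotent X) (hY : IsNilpotent Y) (v : V) :
    f (expNil X v) = expNil Y (f v) := by
  obtain ⟨m, hm⟩ := hX
  obtain ⟨n, hn⟩ := hY
  have hp : ∀ k v, f ((X ^ k) v) = (Y ^ k) (f v) := by
    intro k
    induction k with
    | zero => simp
    | succ k ih => intro v; rw [pow_succ, pow_succ, Module.End.mul_apply, ih, H]; rfl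
  rw [expNil_eq_sum (pow_eq_zero_of_le (le_max_left m n) hm),
    expNil_eq_sum (pow_eq_zero_of_le (le_max_right m n) hn)]
  simp [LinearMap.sum_apply, hp]

end exponential

namespace OddMetric

open OddOps

variable {h : Type u} [AddCommGroup h] [Module ℂ h] [FiniteDimensional ℂ h] (S : OddMetric h)
variable {V W X : SuperVect.{u}}

lemma expOmega_lin_apply (c : ℂ) (P Q : OddOps h V) (v : V) :
    (S.expOmega c P Q).lin v = expNil (c • S.omegaOp P Q) v := rfl

lemma isNilpotent_smul_omegaOp (c : ℂ) (P Q : OddOps h V) [hP : SuperCommute P P]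
    [hPQ : SuperCommute P Q] [hQ : SuperCommute Q Q] : IsNilpotent (c • S.omegaOp P Q) :=
  (S.isNilpotent_omegaOp hP.anticomm hPQ.anticomm hQ.anticomm).smul c

/-- `Ω` commutes with the odd operators which super-commute with both legs. -/
lemma commute_omegaOp_omegaOp (P Q R T : OddOps h V) [h1 : SuperCommute P R]
    [h2 : SuperCommute P T] [h3 : SuperCommute Q R] [h4 : SuperCommute Q T] :
    Commute (S.omegaOp P Q) (S.omegaOp R T) := by
  refine Commute.sum_left _ _ _ fun i _ => ?_
  have key : ∀ R : OddOps h V, Anticomm P R → Anticomm Q R → ∀ a,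
      Commute (P.lin (S.beta i) * Q.lin (S.alpha i)) (R.lin a) := fun R h1 h2 a => by
    rw [Commute, SemiconjBy, mul_assoc, h2, mul_neg, ← mul_assoc, h1, neg_mul, neg_neg, mul_assoc]
  exact Commute.sum_right _ _ _ fun j _ =>
    (key R h1.anticomm h3.anticomm _).mul_right (key T h2.anticomm h4.anticomm _)

/-- `exp` turns a decomposition of `e Ω(P', Q')` into a sum of commuting parts into a composition.
-/
lemma expOmega_add (c d : ℂ) (P Q R T P' Q' : OddOps h V) [SuperCommute P R]
    [SuperCommute P T] [SuperCommute Q R] [SuperCommute Q T] [SuperCommute P P]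
    [SuperCommute P Q] [SuperCommute Q Q] [SuperCommute R R]
    [SuperCommute R T] [SuperCommute T T] (e : ℂ)
    (H : e • S.omegaOp P' Q' = c • S.omegaOp P Q + d • S.omegaOp R T) :
    S.expOmega e P' Q' = S.expOmega c P Q ≫ S.expOmega d R T :=
  SuperVect.hom_ext fun v => by
    have hc := S.commute_omegaOp_omegaOp P Q R T
    rw [SuperVect.comp_lin_apply, expOmega_lin_apply, expOmega_lin_apply, expOmega_lin_apply, H,
      add_comm, expNil_add ((hc.smul_left c).smul_right d).symm (S.isNilpotent_smul_omegaOp d R T)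
      (S.isNilpotent_smul_omegaOp c P Q), Module.End.mul_apply]

/-- The legs of the copairing may be exchanged, at the cost of a sign. -/
lemma sum_swap {M : Type*} [AddCommGroup M] [Module ℂ M] (B : h →ₗ[ℂ] h →ₗ[ℂ] M) :
    ∑ i, B (S.beta i) (S.alpha i) = -∑ i, B (S.alpha i) (S.beta i) := by
  have e : ∀ j, S.alpha j = -∑ i, S.pairing (S.alpha j) (S.alpha i) • S.beta i := fun j => by
    rw [S.sum_beta, neg_neg]
  have e1 : ∀ j, B (S.beta j) (S.alpha j) =
      -∑ i, S.pairing (S.alpha j) (S.alpha i) • B (S.beta j) (S.beta i) := fun j => by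
    conv_lhs => rw [e j, map_neg, map_sum]
    simp only [map_smul]
  have e2 : ∀ j, B (S.alpha j) (S.beta j) =
      -∑ i, S.pairing (S.alpha j) (S.alpha i) • B (S.beta i) (S.beta j) := fun j => by
    conv_lhs => rw [e j, map_neg, map_sum]
    simp only [map_smul, LinearMap.neg_apply, LinearMap.sum_apply, LinearMap.smul_apply]
  simp only [e1, e2, Finset.sum_neg_distrib, neg_neg]
  rw [Finset.sum_comm, ← Finset.sum_neg_distrib]
  refine Finset.sum_congr rfl fun i _ => ?_
  rw [← Finset.sum_neg_distrib]
  exact Finset.sum_congr rfl fun j _ => by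
    rw [S.supersymm (S.alpha j), neg_smul, neg_neg]

lemma omegaOp_symm (P Q : OddOps h V) [H : SuperCommute P Q] :
    S.omegaOp P Q = S.omegaOp Q P := by
  have := S.sum_swap ((LinearMap.mul ℂ (Module.End ℂ V)).compl₁₂ P.lin Q.lin)
  simp only [LinearMap.compl₁₂_apply, LinearMap.mul_apply'] at this
  rw [omegaOp, this, omegaOp, ← Finset.sum_neg_distrib]
  exact Finset.sum_congr rfl fun i _ => by rw [H.anticomm, neg_neg]

lemma omegaOp_add_left (P P' Q : OddOps h V) :
    S.omegaOp (P + P') Q = S.omegaOp P Q + S.omegaOp P' Q := by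
  simp only [omegaOp, add_lin, add_mul, Finset.sum_add_distrib]

lemma omegaOp_add_right (P Q Q' : OddOps h V) :
    S.omegaOp P (Q + Q') = S.omegaOp P Q + S.omegaOp P Q' := by
  simp only [omegaOp, add_lin, mul_add, Finset.sum_add_distrib]

lemma omegaOp_smul_left (z : ℂ) (P Q : OddOps h V) :
    S.omegaOp (z • P) Q = z • S.omegaOp P Q := by
  simp only [omegaOp, smul_lin, smul_mul_assoc, Finset.smul_sum]

lemma omegaOp_smul_right (z : ℂ) (P Q : OddOps h V) :
    S.omegaOp P (z • Q) = z • S.omegaOp P Q := by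
  simp only [omegaOp, smul_lin, mul_smul_comm, Finset.smul_sum]

lemma expOmega_congr {c d : ℂ} {P Q R T : OddOps h V}
    (H : c • S.omegaOp P Q = d • S.omegaOp R T) : S.expOmega c P Q = S.expOmega d R T :=
  SuperVect.hom_ext fun v => by rw [expOmega_lin_apply, expOmega_lin_apply, H]

lemma expOmega_eq_id {c : ℂ} {P Q : OddOps h V} (H : c • S.omegaOp P Q = 0) :
    S.expOmega c P Q = 𝟙 V :=
  SuperVect.hom_ext fun v => by rw [expOmega_lin_apply, H, expNil_zero]; rfl

lemma expOmega_symm (c : ℂ) (P Q : OddOps h V) [SuperCommute P Q] :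
    S.expOmega c P Q = S.expOmega c Q P := S.expOmega_congr (by rw [omegaOp_symm])

lemma expOmega_zero (P Q : OddOps h V) : S.expOmega 0 P Q = 𝟙 V :=
  S.expOmega_eq_id (zero_smul _ _)

lemma expOmega_zero_right (c : ℂ) (Q : OddOps h V) : S.expOmega c Q 0 = 𝟙 V :=
  S.expOmega_eq_id (by simp [omegaOp, zero_lin])

lemma expOmega_smul_left (c z : ℂ) (P Q : OddOps h V) :
    S.expOmega c (z • P) Q = S.expOmega (c * z) P Q :=
  S.expOmega_congr (by rw [omegaOp_smul_left, smul_smul])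

lemma expOmega_smul_right (c z : ℂ) (P Q : OddOps h V) :
    S.expOmega c P (z • Q) = S.expOmega (c * z) P Q :=
  S.expOmega_congr (by rw [omegaOp_smul_right, smul_smul])

section

variable (c : ℂ) (P P' Q Q' : OddOps h V)

lemma expOmega_add_left [SuperCommute P P] [SuperCommute P P'] [SuperCommute P Q]
    [SuperCommute P' P'] [SuperCommute P' Q] [SuperCommute Q P'] [SuperCommute Q Q] :
    S.expOmega c (P + P') Q = S.expOmega c P Q ≫ S.expOmega c P' Q :=
  S.expOmega_add c c P Q P' Q _ _ c (by rw [omegaOp_add_left, smul_add])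

lemma expOmega_add_right [SuperCommute P P] [SuperCommute P Q] [SuperCommute P Q']
    [SuperCommute Q P] [SuperCommute Q Q] [SuperCommute Q Q'] [SuperCommute Q' Q'] :
    S.expOmega c P (Q + Q') = S.expOmega c P Q ≫ S.expOmega c P Q' :=
  S.expOmega_add c c P Q P Q' _ _ c (by rw [omegaOp_add_right, smul_add])

variable [SuperCommute P P] [SuperCommute P Q] [SuperCommute Q Q]

lemma expOmega_comp [SuperCommute Q P] (d : ℂ) :
    S.expOmega c P Q ≫ S.expOmega d P Q = S.expOmega (c + d) P Q :=
  (S.expOmega_add c d P Q P Q P Q (c + d) (add_smul _ _ _)).symm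

lemma expOmega_comp_assoc [SuperCommute Q P] (d : ℂ) (f : V ⟶ W) :
    S.expOmega c P Q ≫ S.expOmega d P Q ≫ f = S.expOmega (c + d) P Q ≫ f := by
  rw [← Category.assoc, expOmega_comp]

/-- The exponential of a square: the two mixed terms of `Ω(P + P', P + P')` agree. -/
lemma expOmega_square [SuperCommute P P'] [SuperCommute P' P] [SuperCommute P' P'] :
    S.expOmega c (P + P') (P + P') =
      S.expOmega c P P ≫ S.expOmega (2 * c) P P' ≫ S.expOmega c P' P' := by
  -- `Ω(P + P', P + P') = Ω(P, P) + Ω(P + P'/2, 2 P')`, and the last term is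
  -- `2 Ω(P, P') + Ω(P', P')`.
  rw [← S.expOmega_add (2 * c) c P P' P' P' (P + (2⁻¹ : ℂ) • P') ((2 : ℂ) • P') c,
    ← S.expOmega_add c c P P _ _ _ _ c]
  · simp only [omegaOp_add_left, omegaOp_add_right, omegaOp_smul_left, omegaOp_smul_right,
      S.omegaOp_symm P' P]
    module
  · simp only [omegaOp_add_left, omegaOp_smul_left, omegaOp_smul_right]
    module

/-- Exponentials of `Ω` with super-commuting legs commute. -/
lemma expOmega_commute (d : ℂ) (R T : OddOps h V) [SuperCommute P R] [SuperCommute P T]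
    [SuperCommute Q R] [SuperCommute Q T] [SuperCommute R R] [SuperCommute R T]
    [SuperCommute T T] : S.expOmega c P Q ≫ S.expOmega d R T =
      S.expOmega d R T ≫ S.expOmega c P Q :=
  SuperVect.hom_ext fun v => by
    have hc := ((S.commute_omegaOp_omegaOp P Q R T).smul_left c).smul_right d
    have h1 := expNil_add hc (S.isNilpotent_smul_omegaOp c P Q) (S.isNilpotent_smul_omegaOp d R T)
    have h2 := expNil_add hc.symm (S.isNilpotent_smul_omegaOp d R T)
      (S.isNilpotent_smul_omegaOp c P Q)
    rw [add_comm, h1] at h2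
    exact LinearMap.congr_fun h2.symm v

end

/-- Exponentials of `Ω` can be moved to the front of a composition. -/
lemma comp_expOmega (f : V ⟶ W) (c : ℂ) (P Q : OddOps h W) {P₀ Q₀ : OddOps h V}
    [HP : Intertwines f P₀ P] [HQ : Intertwines f Q₀ Q] [SuperCommute P₀ P₀] [SuperCommute P₀ Q₀]
    [SuperCommute Q₀ Q₀] [SuperCommute P P] [SuperCommute P Q] [SuperCommute Q Q] :
    f ≫ S.expOmega c P Q = S.expOmega c P₀ Q₀ ≫ f :=
  SuperVect.hom_ext fun v => by
    rw [SuperVect.comp_lin_apply, SuperVect.comp_lin_apply, expOmega_lin_apply, expOmega_lin_apply]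
    refine (comp_expNil (fun v => ?_) (S.isNilpotent_smul_omegaOp c P₀ Q₀)
      (S.isNilpotent_smul_omegaOp c P Q) v).symm
    simp only [omegaOp, LinearMap.smul_apply, LinearMap.sum_apply, Module.End.mul_apply, map_smul,
      map_sum, HP.comm, HQ.comm]

lemma comp_expOmega_assoc (f : V ⟶ W) (c : ℂ) (P Q : OddOps h W) {P₀ Q₀ : OddOps h V}
    [HP : Intertwines f P₀ P] [HQ : Intertwines f Q₀ Q] [SuperCommute P₀ P₀] [SuperCommute P₀ Q₀]
    [SuperCommute Q₀ Q₀] [SuperCommute P P] [SuperCommute P Q] [SuperCommute Q Q] (g : W ⟶ X) :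
    f ≫ S.expOmega c P Q ≫ g = S.expOmega c P₀ Q₀ ≫ f ≫ g := by
  rw [← Category.assoc, S.comp_expOmega f c P Q, Category.assoc]

lemma tensorHom_id_expOmega (c : ℂ) (P Q : OddOps h V) [SuperCommute P P] [SuperCommute P Q]
    [SuperCommute Q Q] :
    SuperVect.tensorHom (𝟙 W) (S.expOmega c P Q) =
      S.expOmega c (OddOps.onRight W P) (OddOps.onRight W Q) :=
  SuperVect.Hom.ext (TensorProduct.ext' fun w v => by
    rw [SuperVect.tensorHom_tmul, expOmega_lin_apply, expOmega_lin_apply, SuperVect.id_lin_apply]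
    refine comp_expNil (f := TensorProduct.mk ℂ W V w) (fun v => ?_)
      (S.isNilpotent_smul_omegaOp c P Q) (S.isNilpotent_smul_omegaOp c _ _) v
    simp only [omegaOp, LinearMap.smul_apply, LinearMap.sum_apply, TensorProduct.mk_apply,
      tmul_smul, tmul_sum, Module.End.mul_apply]
    refine congrArg _ (Finset.sum_congr rfl fun i _ => ?_)
    rw [onRight_tmul, onRight_tmul, SuperVect.parity_parity])

lemma tensorHom_expOmega_id (c : ℂ) (P Q : OddOps h V) [SuperCommute P P] [SuperCommute P Q]
    [SuperCommute Q Q] :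
    SuperVect.tensorHom (S.expOmega c P Q) (𝟙 W) = S.expOmega c (P.onLeft W) (Q.onLeft W) :=
  SuperVect.Hom.ext (TensorProduct.ext' fun v w => by
    rw [SuperVect.tensorHom_tmul, expOmega_lin_apply, expOmega_lin_apply, SuperVect.id_lin_apply]
    refine comp_expNil (f := (TensorProduct.mk ℂ V W).flip w) (fun v => ?_)
      (S.isNilpotent_smul_omegaOp c P Q) (S.isNilpotent_smul_omegaOp c _ _) v
    simp only [omegaOp, LinearMap.smul_apply, LinearMap.sum_apply, LinearMap.flip_apply,
      TensorProduct.mk_apply, ← smul_tmul', sum_tmul, Module.End.mul_apply]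
    refine congrArg _ (Finset.sum_congr rfl fun i _ => ?_)
    rw [onLeft_tmul, onLeft_tmul])

/-- The families `P` and `R` super-commute up to scalars: `{P b, R a} = s (b, a)`. -/
class CanonicalPair (P R : OddOps h V) (s : outParam ℂ) : Prop where
  anticomm : ∀ a b, P.lin b * R.lin a + R.lin a * P.lin b = (s * S.pairing b a) • 1

instance (P R : OddOps h V) (s : ℂ) [H : S.CanonicalPair P R s] :
    S.CanonicalPair (P.onLeft W) (R.onLeft W) s := ⟨fun a b => by
  rw [onLeft_lin, onLeft_lin, ← TensorProduct.map_mul, ← TensorProduct.map_mul,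
    ← TensorProduct.map_add_left, H.anticomm, TensorProduct.map_smul_left, mul_one,
    TensorProduct.map_one]⟩

instance (P R : OddOps h V) (s : ℂ) [H : S.CanonicalPair P R s] :
    S.CanonicalPair (onRight W P) (onRight W R) s := ⟨fun a b => by
  rw [onRight_lin, onRight_lin, ← TensorProduct.map_mul, ← TensorProduct.map_mul,
    ← TensorProduct.map_add_right, H.anticomm, TensorProduct.map_smul_right,
    SuperVect.parity_mul_parity, TensorProduct.map_one]⟩

instance (P R : OddOps h V) (z s : ℂ) [H : S.CanonicalPair P R s] :
    S.CanonicalPair P (z • R) (z * s) := ⟨fun a b => by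
  rw [smul_lin, mul_smul_comm, smul_mul_assoc, ← smul_add, H.anticomm, smul_smul, mul_assoc]⟩

/-- Operators whose super-commutators with both legs of `Ω` are scalar have a linear commutator with
`Ω`. -/
lemma commutator_omegaOp (P Q R : OddOps h V) (s t : ℂ)
    (HP : ∀ a b, P.lin b * R.lin a + R.lin a * P.lin b = (s * S.pairing b a) • 1)
    (HQ : ∀ a b, Q.lin b * R.lin a + R.lin a * Q.lin b = (t * S.pairing b a) • 1) (a : h) :
    S.omegaOp P Q * R.lin a = R.lin a * S.omegaOp P Q + (s • Q + t • P).lin a := by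
  have e : ∀ i, P.lin (S.beta i) * Q.lin (S.alpha i) * R.lin a =
      R.lin a * (P.lin (S.beta i) * Q.lin (S.alpha i)) +
        (s • S.pairing a (S.beta i) • Q.lin (S.alpha i) -
          t • S.pairing a (S.alpha i) • P.lin (S.beta i)) := fun i => by
    rw [mul_assoc, eq_sub_of_add_eq (HQ a (S.alpha i)), mul_sub, ← mul_assoc (P.lin _),
      eq_sub_of_add_eq (HP a (S.beta i)), sub_mul, S.supersymm _ a, S.supersymm _ a,
      smul_mul_assoc, one_mul, mul_smul_comm, mul_one, mul_assoc]
    module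
  rw [omegaOp, Finset.sum_mul, Finset.sum_congr rfl fun i _ => e i, Finset.sum_add_distrib,
    ← Finset.mul_sum, Finset.sum_sub_distrib, ← Finset.smul_sum, ← Finset.smul_sum]
  have h1 := congrArg Q.lin (S.sum_alpha a)
  have h2 := congrArg P.lin (S.sum_beta a)
  simp only [map_sum, map_smul, map_neg] at h1 h2
  rw [h1, h2, add_lin, smul_lin, smul_lin, smul_neg, sub_neg_eq_add]

/-- If the commutator `T` of `N` and `R` commutes with `N`, then `e^N R = (R + T) e^N`. -/
lemma expNil_mul_of_commutator {V : Type u} [AddCommGroup V] [Module ℂ V]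
    {N R T : Module.End ℂ V} (hN : IsNilpotent N) (H : N * R = R * N + T) (HT : Commute N T) :
    expNil N * R = (R + T) * expNil N := by
  have hp : ∀ k : ℕ, N ^ (k + 1) * R = R * N ^ (k + 1) + (k + 1 : ℂ) • (T * N ^ k) := by
    intro k
    induction k with
    | zero => simpa using H
    | succ k ih =>
      rw [pow_succ', mul_assoc, ih, mul_add, ← mul_assoc, H, add_mul, mul_smul_comm, ← mul_assoc N,
        HT.eq, mul_assoc T, ← pow_succ', mul_assoc R, ← pow_succ']
      push_cast
      module
  obtain ⟨n, hn⟩ := hN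
  have hn' : N ^ (n + 1) = 0 := pow_eq_zero_of_le n.le_succ hn
  have e : ∀ k : ℕ, (((k + 1).factorial : ℂ)⁻¹ • N ^ (k + 1)) * R =
      R * (((k + 1).factorial : ℂ)⁻¹ • N ^ (k + 1)) + T * ((k.factorial : ℂ)⁻¹ • N ^ k) := by
    intro k
    rw [smul_mul_assoc, hp, mul_smul_comm, mul_smul_comm, smul_add, smul_smul]
    congr 2
    have h1 : (k.factorial : ℂ) ≠ 0 := by exact_mod_cast k.factorial_ne_zero
    have h2 : (k + 1 : ℂ) ≠ 0 := by exact_mod_cast k.succ_ne_zero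
    rw [Nat.factorial_succ]
    push_cast
    field_simp
  rw [add_mul]
  conv_lhs => rw [expNil_eq_sum hn', Finset.sum_range_succ', add_mul, Finset.sum_mul]
  conv_rhs =>
    congr
    · rw [expNil_eq_sum hn', Finset.sum_range_succ', mul_add, Finset.mul_sum]
    · rw [expNil_eq_sum hn, Finset.mul_sum]
  simp only [e, Finset.sum_add_distrib]
  simp only [Nat.factorial_zero, Nat.cast_one, inv_one, pow_zero, one_smul, one_mul, mul_one]
  abel

/-- Conjugation with `exp(c Ω(P, Q))` is a translation of the operators which are canonically paired
with its legs. -/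
lemma expOmega_intertwines (c : ℂ) (P Q R : OddOps h V) (s t : ℂ)
    (HP : ∀ a b, P.lin b * R.lin a + R.lin a * P.lin b = (s * S.pairing b a) • 1)
    (HQ : ∀ a b, Q.lin b * R.lin a + R.lin a * Q.lin b = (t * S.pairing b a) • 1)
    [h1 : SuperCommute P P] [h2 : SuperCommute P Q] [h3 : SuperCommute Q Q] (a : h) (v : V) :
    (S.expOmega c P Q).lin (R.lin a v) =
      (R + c • (s • Q + t • P)).lin a ((S.expOmega c P Q).lin v) := by
  have _ := SuperCommute.symm P Q
  have hT : SuperCommute (s • Q + t • P) P := inferInstance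
  have hT' : SuperCommute (s • Q + t • P) Q := inferInstance
  refine LinearMap.congr_fun (expNil_mul_of_commutator (S.isNilpotent_smul_omegaOp c P Q)
    (T := (c • (s • Q + t • P)).lin a) ?_ ?_) v
  · rw [smul_mul_assoc, S.commutator_omegaOp P Q R s t HP HQ, smul_add, mul_smul_comm, smul_lin]
  · exact (((S.commute_omegaOp (fun b => hT.anticomm a b)
      (fun b => hT'.anticomm a b)).smul_right c).smul_left c).symm

/-- Conjugation with `exp(c Ω)` shifts the operators which are canonically paired with its first
leg by multiples of its second leg. -/
instance (c : ℂ) (P Q R : OddOps h V) (s : ℂ) [H : S.CanonicalPair P R s] [HQ : SuperCommute Q R]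
    [SuperCommute P P] [SuperCommute P Q] [SuperCommute Q Q] :
    Intertwines (S.expOmega c P Q) (R + (-(c * s)) • Q) R := ⟨fun a v => by
  have h1 := S.expOmega_intertwines c P Q R s 0 H.anticomm (fun a b => by
    rw [HQ.anticomm, neg_add_cancel, zero_mul, zero_smul]) a v
  have h2 := S.expOmega_comm c (R := Q) (SuperCommute.symm P Q).anticomm
    (inferInstance : SuperCommute Q Q).anticomm a v
  rw [add_lin, LinearMap.add_apply, map_add, h1, smul_lin, LinearMap.smul_apply, map_smul, h2]
  simp only [add_lin, smul_lin, LinearMap.add_apply, LinearMap.smul_apply]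
  module⟩

/-- Conjugation with the Gaussian `exp(c Ω)` with equal legs. -/
lemma intertwines_expOmega_self (c : ℂ) (P R : OddOps h V) (s : ℂ) [H : S.CanonicalPair P R s]
    [SuperCommute P P] :
    Intertwines (S.expOmega c P P) (R + (-(2 * c * s)) • P) R := ⟨fun a v => by
  have h1 := S.expOmega_intertwines c P P R s s H.anticomm H.anticomm a v
  have h2 := S.expOmega_comm c (R := P) (inferInstance : SuperCommute P P).anticomm
    (inferInstance : SuperCommute P P).anticomm a v
  rw [add_lin, LinearMap.add_apply, map_add, h1, smul_lin, LinearMap.smul_apply, map_smul, h2]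
  simp only [add_lin, smul_lin, LinearMap.add_apply, LinearMap.smul_apply]
  module⟩

instance intertwines_expOmega_of_superCommute (c : ℂ) (P Q R : OddOps h V) [H : SuperCommute R P]
    [H' : SuperCommute R Q] : Intertwines (S.expOmega c P Q) R R :=
  ⟨fun a v => S.expOmega_comm c H.anticomm H'.anticomm a v⟩

end OddMetric

/-! ### Derivations and Gaussians in the enveloping algebra -/

namespace OddMetric

open OddOps

section

variable {h : Type u} [AddCommGroup h] [Module ℂ h]

lemma involute_contr (d : Module.Dual ℂ h) (x : ExteriorAlgebra ℂ h) :
    CliffordAlgebra.involute (contr d x) = -contr d (CliffordAlgebra.involute x) := by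
  induction x using CliffordAlgebra.left_induction with
  | algebraMap r =>
    rw [AlgHom.commutes]
    erw [contr_algebraMap]
    simp
  | add x y hx hy => rw [map_add, map_add, hx, hy, map_add, map_add, neg_add]
  | ι_mul x v hx =>
    have h1 := contr_ι_mul d v x
    have h2 := contr_ι_mul d v (CliffordAlgebra.involute x)
    rw [ExteriorAlgebra.ι] at h1 h2
    rw [h1, map_mul, CliffordAlgebra.involute_ι, neg_mul, map_neg, h2, map_sub, map_smul, map_mul,
      hx, CliffordAlgebra.involute_ι]
    simp

/-- Contractions are odd derivations. -/
lemma contr_mul (d : Module.Dual ℂ h) (x y : ExteriorAlgebra ℂ h) :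
    contr d (x * y) = contr d x * y + CliffordAlgebra.involute x * contr d y := by
  induction x using CliffordAlgebra.left_induction with
  | algebraMap r =>
    erw [AlgHom.commutes, contr_algebraMap, zero_mul, zero_add, ← Algebra.smul_def, map_smul,
      ← Algebra.smul_def]
  | add x y hx hy => simp only [add_mul, map_add, hx, hy]; abel
  | ι_mul x v hx =>
    have h1 := contr_ι_mul d v x
    have h2 := contr_ι_mul d v (x * y)
    rw [ExteriorAlgebra.ι] at h1 h2
    rw [mul_assoc, h1, h2, hx, map_mul, CliffordAlgebra.involute_ι]
    simp only [mul_add, sub_mul, smul_mul_assoc, mul_assoc, neg_mul]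
    abel

/-- Contractions lower the degree by one. -/
lemma contr_mem (d : Module.Dual ℂ h) {m : ℕ} {x : ExteriorAlgebra ℂ h} (hx : x ∈ ⋀[ℂ]^m h) :
    (m = 0 → contr d x = 0) ∧ ∀ k, m = k + 1 → contr d x ∈ ⋀[ℂ]^k h := by
  induction hx using Submodule.pow_induction_on_left' with
  | algebraMap r =>
    exact ⟨fun _ => contr_algebraMap d r, fun k hk => absurd hk.symm k.succ_ne_zero⟩
  | add x y i hx hy h1 h2 =>
    refine ⟨fun hi => ?_, fun k hk => ?_⟩
    · rw [map_add, h1.1 hi, h2.1 hi, add_zero]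
    · rw [map_add]
      exact Submodule.add_mem _ (h1.2 k hk) (h2.2 k hk)
  | mem_mul a ha n x hx ih =>
    obtain ⟨v, rfl⟩ := ha
    refine ⟨fun hn => absurd hn n.succ_ne_zero, fun k hk => ?_⟩
    obtain rfl : n = k := by omega
    rw [contr_ι_mul]
    refine Submodule.sub_mem _ (Submodule.smul_mem _ _ hx) ?_
    cases n with
    | zero => rw [ih.1 rfl, mul_zero]; exact Submodule.zero_mem _
    | succ l =>
      have := Submodule.mul_mem_mul (LinearMap.mem_range_self (ExteriorAlgebra.ι ℂ) v) (ih.2 l rfl)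
      rwa [← pow_succ'] at this

variable (S : OddMetric h)

/-- The odd derivations of `U(h)`, the element `w` of `h` acting by contraction with `(w, -)`. -/
def deriv : OddOps h (HRep.envSpace h) :=
  ofAnticomm (CliffordAlgebra.contractLeft (Q := (0 : QuadraticForm ℂ h)) ∘ₗ S.pairing) fun a => by
    rw [HRep.parity_env]
    exact LinearMap.ext fun x => involute_contr (S.pairing a) x

lemma deriv_lin (a : h) (x : ExteriorAlgebra ℂ h) : S.deriv.lin a x = contr (S.pairing a) x := rfl

lemma deriv_one (a : h) : S.deriv.lin a (1 : ExteriorAlgebra ℂ h) = 0 :=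
  CliffordAlgebra.contractLeft_one 0 _

/-- Linear maps out of `U(h)` are determined by their value at `1` and by the way they intertwine
left multiplication. -/
lemma env_ext {Y : Type*} [AddCommGroup Y] [Module ℂ Y] {f g : ExteriorAlgebra ℂ h →ₗ[ℂ] Y}
    (T : h → Module.End ℂ Y) (hf : ∀ a x, f (ExteriorAlgebra.ι ℂ a * x) = T a (f x))
    (hg : ∀ a x, g (ExteriorAlgebra.ι ℂ a * x) = T a (g x)) (H : f 1 = g 1) : f = g := by
  refine LinearMap.ext fun x => ?_
  induction x using CliffordAlgebra.left_induction with
  | algebraMap r =>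
    erw [Algebra.algebraMap_eq_smul_one, map_smul, map_smul, H]
  | add x y hx hy => rw [map_add, map_add, hx, hy]
  | ι_mul x v hx =>
    have h1 := hf v x
    have h2 := hg v x
    rw [ExteriorAlgebra.ι] at h1 h2
    rw [h1, h2, hx]

end

end OddMetric

lemma HRep.leftMul_lin {h : Type u} [AddCommGroup h] [Module ℂ h] (a : h)
    (x : ExteriorAlgebra ℂ h) : (HRep.leftMul h).lin a x = ExteriorAlgebra.ι ℂ a * x := rfl

namespace OddMetric
open OddOps
variable {h : Type u} [AddCommGroup h] [Module ℂ h] [FiniteDimensional ℂ h] (S : OddMetric h)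

instance : SuperCommute S.deriv S.deriv := ⟨fun a b => by
  refine LinearMap.ext fun (x : ExteriorAlgebra ℂ h) => ?_
  exact CliffordAlgebra.contractLeft_comm (Q := (0 : QuadraticForm ℂ h)) (S.pairing a)
    (S.pairing b) x⟩

instance : S.CanonicalPair S.deriv (HRep.leftMul h) 1 := ⟨fun a b => by
  refine LinearMap.ext fun (x : ExteriorAlgebra ℂ h) => ?_
  change contr (S.pairing b) (ExteriorAlgebra.ι ℂ a * x) +
    ExteriorAlgebra.ι ℂ a * contr (S.pairing b) x = (1 * S.pairing b a) • x
  rw [contr_ι_mul, sub_add_cancel, one_mul]⟩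

instance : S.CanonicalPair (HRep.leftMul h) S.deriv (-1) := ⟨fun a b => by
  refine LinearMap.ext fun (x : ExteriorAlgebra ℂ h) => ?_
  change ExteriorAlgebra.ι ℂ b * contr (S.pairing a) x +
    contr (S.pairing a) (ExteriorAlgebra.ι ℂ b * x) = (-1 * S.pairing b a) • x
  rw [contr_ι_mul, add_sub_cancel, S.supersymm, neg_one_mul]⟩

/-- Integration by parts: a contraction has no component of top degree. -/
lemma lambda_contr (d : Module.Dual ℂ h) (x : ExteriorAlgebra ℂ h) : S.lambda (contr d x) = 0 := by
  have : S.lambda ∘ₗ contr d = 0 := by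
    refine S.beta.ExteriorAlgebra.ext fun s => ?_
    have hs : S.beta.ExteriorAlgebra s ∈ ⋀[ℂ]^s.card h := by
      have := ExteriorAlgebra.basis_eq_coe_basis S.beta (m := s.card) ⟨s, rfl⟩
      rw [this]
      exact Submodule.coe_mem _
    have hc : s.card ≤ 2 * S.pairs := by
      rw [← S.finrank_eq_and_topCoeff_ne_zero.1]; simpa using s.card_le_univ
    rw [LinearMap.comp_apply, LinearMap.zero_apply]
    obtain h0 | ⟨k, hk⟩ : s.card = 0 ∨ ∃ k, s.card = k + 1 := by cases s.card <;> simp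
    · rw [(contr_mem d hs).1 h0, map_zero]
    · exact S.lambda_of_mem (by omega) ((contr_mem d hs).2 k hk)
  exact LinearMap.congr_fun this x

lemma coord_beta (i : Fin (Module.finrank ℂ h)) : S.beta.coord i = S.pairing (S.alpha i) :=
  S.beta.ext fun j => by
    rw [S.pairing_alpha_beta, Module.Basis.coord_apply, Module.Basis.repr_self,
      Finsupp.single_apply]

/-- The common kernel of all derivations consists of the scalars. -/
lemma eq_algebraMap_of_deriv_eq_zero {x : ExteriorAlgebra ℂ h} (hx : ∀ a, S.deriv.lin a x = 0) :
    x = algebraMap ℂ _ (ExteriorAlgebra.algebraMapInv x) := by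
  -- The Euler operator kills `x`; it multiplies an element of degree `m` by `m`.
  have key : (∑ i, LinearMap.mul ℂ (ExteriorAlgebra ℂ h) (ExteriorAlgebra.ι ℂ (S.beta i)) ∘ₗ
      contr (S.beta.coord i)) x = 0 := by
    rw [LinearMap.sum_apply]
    refine Finset.sum_eq_zero fun i _ => ?_
    rw [LinearMap.comp_apply, coord_beta, ← deriv_lin, hx, map_zero]
  have hb : ∀ s, S.beta.ExteriorAlgebra s ∈ ⋀[ℂ]^s.card h := fun s => by
    have := ExteriorAlgebra.basis_eq_coe_basis S.beta (m := s.card) ⟨s, rfl⟩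
    rw [this]
    exact Submodule.coe_mem _
  have hc : ∀ s : Finset (Fin (Module.finrank ℂ h)), s ≠ ∅ →
      S.beta.ExteriorAlgebra.repr x s = 0 := by
    intro s hs
    rw [← S.beta.ExteriorAlgebra.sum_repr x, map_sum] at key
    have e : ∀ t, (∑ i, LinearMap.mul ℂ (ExteriorAlgebra ℂ h) (ExteriorAlgebra.ι ℂ (S.beta i)) ∘ₗ
        contr (S.beta.coord i)) (S.beta.ExteriorAlgebra.repr x t • S.beta.ExteriorAlgebra t) =
        (S.beta.ExteriorAlgebra.repr x t * t.card) • S.beta.ExteriorAlgebra t := fun t => by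
      have := S.euler (hb t)
      rw [map_smul, LinearMap.sum_apply]
      simp only [LinearMap.comp_apply, LinearMap.mul_apply', this, smul_smul]
    rw [Finset.sum_congr rfl fun t _ => e t] at key
    have := (Fintype.linearIndependent_iff.mp S.beta.ExteriorAlgebra.linearIndependent _ key s)
    refine (mul_eq_zero.mp this).resolve_right ?_
    simpa using hs
  have hx' : x ∈ ⋀[ℂ]^0 h := by
    rw [← S.beta.ExteriorAlgebra.sum_repr x]
    refine Submodule.sum_mem _ fun s _ => ?_
    by_cases hs : s = ∅
    · exact Submodule.smul_mem _ _ (by simpa [hs] using hb s)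
    · rw [hc s hs, zero_smul]; exact Submodule.zero_mem _
  change x ∈ LinearMap.range (ExteriorAlgebra.ι ℂ) ^ 0 at hx'
  rw [pow_zero, Submodule.mem_one] at hx'
  obtain ⟨r, rfl⟩ := hx'
  rw [ExteriorAlgebra.algebraMap_leftInverse]

/-- The Gaussian `exp(t Ω^{(11)})` in `U(h)`. -/
def gaussian (t : ℂ) : ExteriorAlgebra ℂ h :=
  (S.expOmega t (HRep.leftMul h) (HRep.leftMul h)).lin (1 : ExteriorAlgebra ℂ h)

lemma omegaOp_leftMul_apply (x : ExteriorAlgebra ℂ h) :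
    S.omegaOp (HRep.leftMul h) (HRep.leftMul h) x = S.omegaElt * x := by
  simp only [omegaOp, omegaElt, LinearMap.sum_apply, Module.End.mul_apply, Finset.sum_mul]
  exact Finset.sum_congr rfl fun i _ => (mul_assoc _ _ _).symm

/-- The Gaussian integral: only the `N`-th term of the exponential series has top degree. -/
lemma lambda_gaussian (t : ℂ) : S.lambda (S.gaussian t) = (t * (-2 / (Real.pi : ℂ))) ^ S.pairs := by
  obtain ⟨n, hn⟩ := S.isNilpotent_smul_omegaOp t (HRep.leftMul h) (HRep.leftMul h)
  have hp : ∀ k : ℕ, ((t • S.omegaOp (HRep.leftMul h) (HRep.leftMul h)) ^ k)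
      (1 : ExteriorAlgebra ℂ h) = t ^ k • S.omegaElt ^ k := by
    intro k
    induction k with
    | zero => simp
    | succ k ih =>
      rw [pow_succ', Module.End.mul_apply, ih, LinearMap.smul_apply]
      erw [omegaOp_leftMul_apply]
      rw [mul_smul_comm, smul_smul, ← pow_succ', ← pow_succ']
  have hn' := pow_eq_zero_of_le (le_max_left n (S.pairs + 1)) hn
  rw [gaussian, expOmega_lin_apply, expNil_eq_sum hn', LinearMap.sum_apply, map_sum,
    Finset.sum_eq_single S.pairs]
  · rw [LinearMap.smul_apply, hp, map_smul, map_smul, lambda_omegaElt_pow, smul_eq_mul, smul_eq_mul,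
      mul_pow]
    have h1 : (S.pairs.factorial : ℂ) ≠ 0 := by exact_mod_cast S.pairs.factorial_ne_zero
    field_simp
  · intro k _ hk
    rw [LinearMap.smul_apply, hp, map_smul, map_smul, S.lambda_of_mem _ (S.omegaElt_pow_mem k),
      smul_zero, smul_zero]
    omega
  · intro H
    exact absurd (Finset.mem_range.mpr (lt_of_lt_of_le (Nat.lt_succ_self _) (le_max_right _ _))) H

end OddMetric

/-! ### The Fourier transform `φ` -/

namespace OddMetric
open OddOps
variable {h : Type u} [AddCommGroup h] [Module ℂ h] [FiniteDimensional ℂ h] (S : OddMetric h)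

/-- The pairing `x ⊗ y ↦ λ(y u) x` of the second leg with `u`, through which `φ` is defined. -/
def legPairing (u : ExteriorAlgebra ℂ h) :
    ExteriorAlgebra ℂ h ⊗[ℂ] ExteriorAlgebra ℂ h →ₗ[ℂ] ExteriorAlgebra ℂ h :=
  TensorProduct.lift ((LinearMap.lsmul ℂ (ExteriorAlgebra ℂ h) :
    ℂ →ₗ[ℂ] Module.End ℂ (ExteriorAlgebra ℂ h)).flip.compl₂
      (S.lambda ∘ₗ (LinearMap.mul ℂ (ExteriorAlgebra ℂ h)).flip u))

lemma legPairing_tmul (u x y : ExteriorAlgebra ℂ h) :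
    S.legPairing u (x ⊗ₜ y) = S.lambda (y * u) • x := rfl

lemma phi_lin_apply (u : ExteriorAlgebra ℂ h) :
    S.phi.lin u = S.legPairing u (S.expOmegaElt (-(Real.pi * Complex.I))) := by
  have key : ∀ z : ExteriorAlgebra ℂ h ⊗[ℂ] ExteriorAlgebra ℂ h,
      (SuperVect.rightUnit (HRep.envSpace h)).lin
        ((SuperVect.tensorHom (𝟙 (HRep.envSpace h)) (HRep.mulHom h ≫ S.lambdaHom)).lin
          ((SuperVect.assoc (HRep.envSpace h) (HRep.envSpace h) (HRep.envSpace h)).lin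
            (z ⊗ₜ[ℂ] u))) = S.legPairing u z := by
    intro z
    induction z with
    | zero => rw [zero_tmul, map_zero, map_zero, map_zero, map_zero]
    | add x y hx hy => rw [add_tmul, map_add, map_add, map_add, map_add, hx, hy]
    | tmul x y =>
      rw [legPairing_tmul]
      change (SuperVect.leftUnit (HRep.envSpace h)).lin ((SuperVect.flip _ _).lin
        (x ⊗ₜ[ℂ] (ULift.up (S.lambda (y * u)) : SuperVect.unit))) = _
      exact congrArg (SuperVect.leftUnit (HRep.envSpace h)).lin
        (SuperVect.flip_tmul_of_even_right (V := HRep.envSpace h) (W := SuperVect.unit) x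
          (w := ULift.up (S.lambda (y * u))) trivial)
  exact key _

/-- `exp(c Ω)` turns multiplication on its second leg into a derivation of the first one. -/
lemma deriv_expOmegaElt (c : ℂ) (a : h) :
    (S.deriv.onLeft (HRep.envSpace h)).lin a (S.expOmegaElt c) =
      c • (onRight (HRep.envSpace h) (HRep.leftMul h)).lin a (S.expOmegaElt c) := by
  have H := S.expOmega_comm c (R := onRight (HRep.envSpace h) (HRep.leftMul h))
    (P := (HRep.leftMul h).onLeft (HRep.envSpace h))
    (Q := onRight (HRep.envSpace h) (HRep.leftMul h))
    (inferInstance : SuperCommute _ _).anticomm (inferInstance : SuperCommute _ _).anticomm a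
    ((1 : ExteriorAlgebra ℂ h) ⊗ₜ[ℂ] (1 : ExteriorAlgebra ℂ h))
  have H' := (inferInstance : Intertwines (S.expOmega c
    ((HRep.leftMul h).onLeft (HRep.envSpace h)) (onRight (HRep.envSpace h) (HRep.leftMul h))) _
    (S.deriv.onLeft (HRep.envSpace h))).comm a
    ((1 : ExteriorAlgebra ℂ h) ⊗ₜ[ℂ] (1 : ExteriorAlgebra ℂ h))
  rw [add_lin, LinearMap.add_apply, onLeft_tmul, deriv_one, zero_tmul, zero_add, smul_lin,
    LinearMap.smul_apply, map_smul, H] at H'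
  rw [expOmegaElt, ← H']
  simp

/-- `exp(c Ω)` turns multiplication on its first leg into a derivation of the second one. -/
lemma deriv_expOmegaElt' (c : ℂ) (a : h) :
    (onRight (HRep.envSpace h) S.deriv).lin a (S.expOmegaElt c) =
      c • ((HRep.leftMul h).onLeft (HRep.envSpace h)).lin a (S.expOmegaElt c) := by
  have H := S.expOmega_comm c (R := (HRep.leftMul h).onLeft (HRep.envSpace h))
    (Q := (HRep.leftMul h).onLeft (HRep.envSpace h))
    (P := onRight (HRep.envSpace h) (HRep.leftMul h))
    (inferInstance : SuperCommute _ _).anticomm (inferInstance : SuperCommute _ _).anticomm a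
    ((1 : ExteriorAlgebra ℂ h) ⊗ₜ[ℂ] (1 : ExteriorAlgebra ℂ h))
  have H' := (inferInstance : Intertwines (S.expOmega c
    (onRight (HRep.envSpace h) (HRep.leftMul h)) ((HRep.leftMul h).onLeft (HRep.envSpace h))) _
    (onRight (HRep.envSpace h) S.deriv)).comm a
    ((1 : ExteriorAlgebra ℂ h) ⊗ₜ[ℂ] (1 : ExteriorAlgebra ℂ h))
  rw [add_lin, LinearMap.add_apply, onRight_tmul, deriv_one, tmul_zero, zero_add, smul_lin,
    LinearMap.smul_apply, map_smul, H] at H'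
  rw [expOmegaElt, S.expOmega_symm, ← H']
  simp

lemma legPairing_deriv (u : ExteriorAlgebra ℂ h) (a : h)
    (z : ExteriorAlgebra ℂ h ⊗[ℂ] ExteriorAlgebra ℂ h) :
    S.legPairing u ((S.deriv.onLeft (HRep.envSpace h)).lin a z) =
      S.deriv.lin a (S.legPairing u z) := by
  induction z with
  | zero => simp only [map_zero]
  | add x y hx hy => simp only [map_add, hx, hy]
  | tmul x y => exact ((S.deriv.lin a).map_smul (S.lambda (y * u)) x).symm

lemma legPairing_leftMul (u : ExteriorAlgebra ℂ h) (a : h)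
    (z : ExteriorAlgebra ℂ h ⊗[ℂ] ExteriorAlgebra ℂ h) :
    S.legPairing u (((HRep.leftMul h).onLeft (HRep.envSpace h)).lin a z) =
      (HRep.leftMul h).lin a (S.legPairing u z) := by
  induction z with
  | zero => simp only [map_zero]
  | add x y hx hy => simp only [map_add, hx, hy]
  | tmul x y => exact (((HRep.leftMul h).lin a).map_smul (S.lambda (y * u)) x).symm

lemma legPairing_onRight_leftMul (u : ExteriorAlgebra ℂ h) (a : h)
    (z : ExteriorAlgebra ℂ h ⊗[ℂ] ExteriorAlgebra ℂ h) :
    S.legPairing u ((onRight (HRep.envSpace h) (HRep.leftMul h)).lin a z) =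
      S.legPairing (ExteriorAlgebra.ι ℂ a * u)
        ((HRep.envSpace h ⊗ₛ HRep.envSpace h).parity z) := by
  induction z with
  | zero => simp only [map_zero]
  | add x y hx hy => simp only [map_add, hx, hy]
  | tmul x y =>
    have e : ∀ y : ExteriorAlgebra ℂ h, ExteriorAlgebra.ι ℂ a * y =
        CliffordAlgebra.involute y * ExteriorAlgebra.ι ℂ a := by
      intro y
      induction y using ExteriorAlgebra.induction with
      | algebraMap r => simp [Algebra.commutes]
      | ι b =>
        have := CliffordAlgebra.involute_ι (Q := (0 : QuadraticForm ℂ h)) b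
        change CliffordAlgebra.involute (ExteriorAlgebra.ι ℂ b) = - ExteriorAlgebra.ι ℂ b at this
        rw [this, neg_mul]
        exact eq_neg_of_add_eq_zero_left (ExteriorAlgebra.ι_add_mul_swap a b)
      | mul x y hx hy => rw [map_mul, ← mul_assoc, hx, mul_assoc, hy, mul_assoc]
      | add x y hx hy => rw [map_add, mul_add, add_mul, hx, hy]
    refine Eq.trans ?_ (congrArg (S.legPairing (ExteriorAlgebra.ι ℂ a * u))
      (SuperVect.parity_tmul (HRep.envSpace h) (HRep.envSpace h) x y)).symm
    rw [HRep.parity_env]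
    change S.lambda (ExteriorAlgebra.ι ℂ a * y * u) • (HRep.envSpace h).parity x =
      S.lambda (CliffordAlgebra.involute y * (ExteriorAlgebra.ι ℂ a * u)) • _
    rw [HRep.parity_env, ← mul_assoc, ← e]

/-- Integration by parts on the second leg. -/
lemma legPairing_onRight_deriv (u : ExteriorAlgebra ℂ h) (a : h)
    (z : ExteriorAlgebra ℂ h ⊗[ℂ] ExteriorAlgebra ℂ h) :
    S.legPairing u ((onRight (HRep.envSpace h) S.deriv).lin a z) =
      -S.legPairing (S.deriv.lin a u) ((HRep.envSpace h ⊗ₛ HRep.envSpace h).parity z) := by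
  induction z with
  | zero => simp only [map_zero, neg_zero]
  | add x y hx hy => simp only [map_add, hx, hy, neg_add]
  | tmul x y =>
    have e := S.lambda_contr (S.pairing a) (y * u)
    rw [contr_mul, map_add] at e
    refine Eq.trans ?_ (congrArg (fun z => -S.legPairing (S.deriv.lin a u) z)
      (SuperVect.parity_tmul (HRep.envSpace h) (HRep.envSpace h) x y)).symm
    rw [HRep.parity_env]
    change S.lambda (contr (S.pairing a) y * u) • (HRep.envSpace h).parity x =
      -(S.lambda (CliffordAlgebra.involute y * contr (S.pairing a) u) • _)
    rw [HRep.parity_env, eq_neg_of_add_eq_zero_left e, neg_smul]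

/-- `φ` is a Fourier transform: it exchanges multiplications and derivations. -/
instance intertwines_phi_deriv : Intertwines S.phi ((-(Real.pi * Complex.I) : ℂ) • HRep.leftMul h)
    S.deriv := ⟨fun a u => by
  have e := S.parity_expOmegaElt (-(Real.pi * Complex.I))
  rw [smul_lin, LinearMap.smul_apply, map_smul, phi_lin_apply, HRep.leftMul_lin, phi_lin_apply,
    ← legPairing_deriv, deriv_expOmegaElt, map_smul, legPairing_onRight_leftMul, e]⟩

lemma pi_mul_I_ne_zero : (Real.pi * Complex.I : ℂ) ≠ 0 :=
  mul_ne_zero (by exact_mod_cast Real.pi_ne_zero) Complex.I_ne_zero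

/-- The Fourier transform of a derivative is a multiple of the Fourier transform. -/
instance intertwines_phi_leftMul : Intertwines S.phi ((Real.pi * Complex.I : ℂ)⁻¹ • S.deriv)
    (HRep.leftMul h) := ⟨fun a u => by
  have e := S.parity_expOmegaElt (-(Real.pi * Complex.I))
  rw [smul_lin, LinearMap.smul_apply, map_smul, phi_lin_apply, phi_lin_apply, ← legPairing_leftMul,
    inv_smul_eq_iff₀ pi_mul_I_ne_zero]
  have := S.legPairing_onRight_deriv u a (S.expOmegaElt (-(Real.pi * Complex.I)))
  rw [e, deriv_expOmegaElt', map_smul, neg_smul] at this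
  exact (neg_inj.mp this).symm⟩

/-- The differential equation of a Gaussian. -/
lemma deriv_gaussian (t : ℂ) (a : h) :
    S.deriv.lin a (S.gaussian t) = (2 * t) • (HRep.leftMul h).lin a (S.gaussian t) := by
  have H := S.expOmega_comm t (R := HRep.leftMul h) (P := HRep.leftMul h) (Q := HRep.leftMul h)
    (HRep.env h).anticomm (HRep.env h).anticomm a (1 : ExteriorAlgebra ℂ h)
  have H' := (S.intertwines_expOmega_self t (HRep.leftMul h) S.deriv (-1)).comm a
    (1 : ExteriorAlgebra ℂ h)
  rw [add_lin, LinearMap.add_apply, deriv_one, zero_add, smul_lin, LinearMap.smul_apply, map_smul,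
    H] at H'
  rw [gaussian, ← H']
  simp

lemma expOmega_comp_neg {V : SuperVect.{u}} (c : ℂ) (P Q : OddOps h V) [SuperCommute P P]
    [SuperCommute P Q] [SuperCommute Q P] [SuperCommute Q Q] :
    S.expOmega c P Q ≫ S.expOmega (-c) P Q = 𝟙 V := by
  rw [expOmega_comp, add_neg_cancel, expOmega_zero]

lemma expOmega_neg_comp {V : SuperVect.{u}} (c : ℂ) (P Q : OddOps h V) [SuperCommute P P]
    [SuperCommute P Q] [SuperCommute Q P] [SuperCommute Q Q] :
    S.expOmega (-c) P Q ≫ S.expOmega c P Q = 𝟙 V := by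
  rw [expOmega_comp, neg_add_cancel, expOmega_zero]

lemma algebraMapInv_expOmega (t : ℂ) (x : ExteriorAlgebra ℂ h) :
    ExteriorAlgebra.algebraMapInv ((S.expOmega t (HRep.leftMul h) (HRep.leftMul h)).lin x) =
      ExteriorAlgebra.algebraMapInv x := by
  have := comp_expNil
    (f := (ExteriorAlgebra.algebraMapInv : ExteriorAlgebra ℂ h →ₐ[ℂ] ℂ).toLinearMap)
    (X := t • S.omegaOp (HRep.leftMul h) (HRep.leftMul h)) (Y := 0) (fun v => ?_)
    (S.isNilpotent_smul_omegaOp t _ _) ⟨1, pow_one 0⟩ x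
  · rw [expNil_zero] at this
    exact this
  · rw [LinearMap.smul_apply, map_smul]
    erw [omegaOp_leftMul_apply]
    simp [omegaElt, ExteriorAlgebra.algebraMapInv]

/-- Gaussians are characterised, up to scalars, by a differential equation. -/
lemma eq_smul_gaussian {t : ℂ} {x : ExteriorAlgebra ℂ h}
    (hx : ∀ a, S.deriv.lin a x = (2 * t) • (HRep.leftMul h).lin a x) :
    x = ExteriorAlgebra.algebraMapInv x • S.gaussian t := by
  -- After division by the Gaussian all derivatives vanish, so that a scalar is left.
  have hE := fun a => S.expOmega_comm (-t) (R := HRep.leftMul h) (P := HRep.leftMul h)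
    (Q := HRep.leftMul h) (HRep.env h).anticomm (HRep.env h).anticomm a x
  have key : ∀ a,
      S.deriv.lin a ((S.expOmega (-t) (HRep.leftMul h) (HRep.leftMul h)).lin x) = 0 := by
    intro a
    rw [← (S.intertwines_expOmega_self (-t) (HRep.leftMul h) S.deriv (-1)).comm, add_lin,
      LinearMap.add_apply, hx, smul_lin, LinearMap.smul_apply, ← add_smul]
    ring_nf
    rw [zero_smul, map_zero]
  have h2 := S.eq_algebraMap_of_deriv_eq_zero key
  erw [algebraMapInv_expOmega] at h2
  have h3 := SuperVect.congr_lin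
    (S.expOmega_neg_comp t (HRep.leftMul h) (HRep.leftMul h)) x
  rw [SuperVect.comp_lin_apply, SuperVect.id_lin_apply] at h3
  rw [← h3]
  conv_lhs => erw [h2]
  rw [h3, Algebra.algebraMap_eq_smul_one]
  erw [map_smul]
  rfl

/-- The degree zero part of a Fourier transform is the integral. -/
lemma algebraMapInv_phi (u : ExteriorAlgebra ℂ h) :
    ExteriorAlgebra.algebraMapInv (S.phi.lin u : ExteriorAlgebra ℂ h) = S.lambda u := by
  -- the counit applied to the first leg
  let f : ExteriorAlgebra ℂ h ⊗[ℂ] ExteriorAlgebra ℂ h →ₗ[ℂ] ExteriorAlgebra ℂ h :=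
    TensorProduct.lift ((LinearMap.lsmul ℂ (ExteriorAlgebra ℂ h) :
      ℂ →ₗ[ℂ] Module.End ℂ (ExteriorAlgebra ℂ h)) ∘ₗ
      (ExteriorAlgebra.algebraMapInv : ExteriorAlgebra ℂ h →ₐ[ℂ] ℂ).toLinearMap)
  have h1 : ∀ z, ExteriorAlgebra.algebraMapInv (S.legPairing u z) = S.lambda (f z * u) := by
    intro z
    induction z with
    | zero => simp
    | add x y hx hy => simp only [map_add, hx, hy, add_mul]
    | tmul x y => simp [f, legPairing_tmul, mul_comm]
  have h2 : f (S.expOmegaElt (-(Real.pi * Complex.I))) = 1 := by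
    have := comp_expNil (f := f) (X := (-(Real.pi * Complex.I) : ℂ) • S.omegaOp
      ((HRep.leftMul h).onLeft (HRep.envSpace h)) (onRight (HRep.envSpace h) (HRep.leftMul h)))
      (Y := 0) (fun v => ?_) (S.isNilpotent_smul_omegaOp _ _ _) ⟨1, pow_one 0⟩ (1 ⊗ₜ 1)
    · rw [expNil_zero] at this
      refine this.trans ?_
      simp [f]
    · rw [LinearMap.smul_apply, map_smul, omegaOp, LinearMap.sum_apply, map_sum,
        Finset.sum_eq_zero, smul_zero, LinearMap.zero_apply]
      intro i _
      have : ∀ (a : h) (z : ExteriorAlgebra ℂ h ⊗[ℂ] ExteriorAlgebra ℂ h),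
          f (((HRep.leftMul h).onLeft (HRep.envSpace h)).lin a z) = 0 := by
        intro a z
        induction z with
        | zero => simp
        | add x y hx hy => rw [map_add, map_add, hx, hy, add_zero]
        | tmul x y =>
          change ExteriorAlgebra.algebraMapInv (ExteriorAlgebra.ι ℂ a * x) • y = 0
          simp [ExteriorAlgebra.algebraMapInv]
      exact this _ _
  rw [phi_lin_apply, h1, h2, one_mul]

/-- The Fourier transform of a Gaussian is a Gaussian. -/
lemma phi_gaussian {t : ℂ} (ht : t ≠ 0) : S.phi.lin (S.gaussian t) =
    (t * (-2 / (Real.pi : ℂ))) ^ S.pairs • S.gaussian (Real.pi ^ 2 / (4 * t)) := by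
  -- `φ` transports the differential equation, and the scalar is the integral.
  rw [← lambda_gaussian, ← algebraMapInv_phi]
  refine S.eq_smul_gaussian fun a => ?_
  rw [← S.intertwines_phi_deriv.comm, smul_lin, LinearMap.smul_apply, map_smul,
    ← S.intertwines_phi_leftMul.comm, smul_lin, LinearMap.smul_apply, map_smul, deriv_gaussian,
    map_smul, smul_smul, smul_smul]
  congr 1
  have h1 : (Real.pi : ℂ) ≠ 0 := by exact_mod_cast Real.pi_ne_zero
  have h2 := Complex.I_ne_zero
  have h3 := Complex.I_sq
  field_simp
  rw [h3]
  ring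

lemma phi_comp_expOmega (t : ℂ) :
    (S.phi ≫ S.phi) ≫ S.expOmega t (HRep.leftMul h) (HRep.leftMul h) =
      S.expOmega t (HRep.leftMul h) (HRep.leftMul h) ≫ S.phi ≫ S.phi := by
  rw [comp_expOmega]
  congr 1
  simp only [expOmega_smul_left, expOmega_smul_right]
  congr 1
  have := pi_mul_I_ne_zero
  field_simp

/-- This follows from the case of a Gaussian, as `φ²` commutes with the exponentials of
`Ω^{(11)}`. -/
lemma phi_phi_one :
    S.phi.lin (S.phi.lin (1 : ExteriorAlgebra ℂ h)) = (1 : ExteriorAlgebra ℂ h) := by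
  have h1 : (Real.pi : ℂ) ≠ 0 := by exact_mod_cast Real.pi_ne_zero
  have e := SuperVect.congr_lin (S.phi_comp_expOmega 1) (1 : ExteriorAlgebra ℂ h)
  rw [SuperVect.comp_lin_apply, SuperVect.comp_lin_apply, SuperVect.comp_lin_apply,
    SuperVect.comp_lin_apply] at e
  have e2 : S.phi.lin (S.phi.lin (S.gaussian 1)) = S.gaussian 1 := by
    rw [S.phi_gaussian one_ne_zero]
    erw [map_smul]
    rw [S.phi_gaussian (by simp [h1]), smul_smul, ← mul_pow]
    have h2 : (4 * ((Real.pi : ℂ) ^ 2 / (4 * 1))) ≠ 0 := by simp [h1]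
    have h3 : (Real.pi : ℂ) ^ 2 / (4 * ((Real.pi : ℂ) ^ 2 / (4 * 1))) = 1 := by field_simp
    have h4 : 1 * (-2 / (Real.pi : ℂ)) *
        ((Real.pi : ℂ) ^ 2 / (4 * 1) * (-2 / (Real.pi : ℂ))) = 1 := by
      field_simp
      norm_num
    rw [h3, h4, one_pow, one_smul]
  rw [gaussian] at e2
  rw [e2] at e
  have := congrArg (S.expOmega (-1) (HRep.leftMul h) (HRep.leftMul h)).lin e
  rwa [← SuperVect.comp_lin_apply, expOmega_comp_neg, ← SuperVect.comp_lin_apply (S.expOmega 1 _ _),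
    expOmega_comp_neg] at this

/-- The Fourier transform squares to the parity involution. -/
lemma phi_phi : S.phi ≫ S.phi = (HRep.envSpace h).parityHom := by
  -- Both sides anticommute with left multiplication, and they agree at `1`.
  refine SuperVect.Hom.ext (env_ext (fun a => -(HRep.leftMul h).lin a) (fun a x => ?_)
    (fun a x => ?_) ?_)
  · have H := (inferInstance : Intertwines (S.phi ≫ S.phi) _ (HRep.leftMul h)).comm a x
    have e : (Real.pi * Complex.I : ℂ)⁻¹ * (-(Real.pi * Complex.I) : ℂ) = -1 := by
      have := pi_mul_I_ne_zero
      field_simp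
    rw [smul_lin, smul_lin, smul_smul, e, neg_one_smul, LinearMap.neg_apply, map_neg] at H
    rw [LinearMap.neg_apply, ← H, neg_neg]
    rfl
  · have H := (inferInstance : Intertwines (HRep.envSpace h).parityHom _ (HRep.leftMul h)).comm a x
    rw [smul_lin, neg_one_smul, LinearMap.neg_apply, map_neg] at H
    rw [LinearMap.neg_apply, ← H, neg_neg]
    rfl
  · refine (S.phi_phi_one).trans ?_
    change (1 : ExteriorAlgebra ℂ h) = (HRep.envSpace h).parity (1 : ExteriorAlgebra ℂ h)
    rw [HRep.parity_env, AlgHom.toLinearMap_apply, map_one]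

end OddMetric

/-! ### Associators as exponentials -/

namespace OddOps

variable {h : Type u} [AddCommGroup h] [Module ℂ h]

lemma tensor_act_eq (A B : HRep h) :
    (A ⊗ᵣ B).act = A.act.onLeft B.space + onRight A.space B.act := rfl

lemma triv_act_eq (V : SuperVect.{u}) : (HRep.triv h V).act = 0 := rfl

lemma tensor_triv_act_eq (A : HRep h) (V : SuperVect.{u}) :
    (A ⊗ᵣ HRep.triv h V).act = A.act.onLeft V := by
  rw [tensor_act_eq, triv_act_eq, onRight_zero, add_zero']

/-- The operators which act on the source of the `011` associator, in the form which instance search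
for `Intertwines` produces. -/
lemma add_neg_neg_smul {V : SuperVect.{u}} (P Q : OddOps h V) :
    P + (-(-1 * 1) : ℂ) • Q = Q + P :=
  ext_lin fun a => by
    simp only [add_lin, smul_lin]
    module

/-- The operators which act on the source of the `110` associator, in the form which instance search
for `Intertwines` produces. -/
lemma add_neg_smul_add {V : SuperVect.{u}} (P Q : OddOps h V) :
    P + (-(1 * 1) : ℂ) • Q + Q = P :=
  ext_lin fun a => by
    simp only [add_lin, smul_lin]
    module

lemma Intertwines.congr {V W : SuperVect.{u}} {f : V ⟶ W} {P P' : OddOps h V} {Q : OddOps h W}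
    (H : Intertwines f P Q) (e : P = P') : Intertwines f P' Q := e ▸ H

/-- Maps out of a free module `U(h) ⊗ X` are determined by their values on `1 ⊗ X`. -/
lemma env_tensor_ext {X Y : SuperVect.{u}} {f g : HRep.envSpace h ⊗ₛ X ⟶ Y} (T : OddOps h Y)
    (hf : Intertwines f ((HRep.leftMul h).onLeft X) T)
    (hg : Intertwines g ((HRep.leftMul h).onLeft X) T)
    (H : ∀ x, f.lin ((1 : ExteriorAlgebra ℂ h) ⊗ₜ[ℂ] x) =
      g.lin ((1 : ExteriorAlgebra ℂ h) ⊗ₜ[ℂ] x)) : f = g := by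
  refine SuperVect.Hom.ext (TensorProduct.ext ?_)
  refine OddMetric.env_ext (fun a => LinearMap.compRight ℂ (T.lin a)) (fun a u => ?_)
    (fun a u => ?_) (LinearMap.ext H)
  · exact LinearMap.ext fun x => hf.comm a (u ⊗ₜ[ℂ] x)
  · exact LinearMap.ext fun x => hg.comm a (u ⊗ₜ[ℂ] x)

/-- Intertwiners out of a tensor product `A ⊗ (U(h) ⊗ X)` are determined by their values on
`A ⊗ (1 ⊗ X)`. -/
lemma tensor_env_tensor_ext {A : HRep h} {X Y : SuperVect.{u}}
    {f g : A.space ⊗ₛ (HRep.envSpace h ⊗ₛ X) ⟶ Y} (T : OddOps h Y)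
    (hf : Intertwines f (A.act.onLeft _ + onRight A.space ((HRep.leftMul h).onLeft X)) T)
    (hg : Intertwines g (A.act.onLeft _ + onRight A.space ((HRep.leftMul h).onLeft X)) T)
    (H : ∀ a x, f.lin (a ⊗ₜ[ℂ] ((1 : ExteriorAlgebra ℂ h) ⊗ₜ[ℂ] x)) =
      g.lin (a ⊗ₜ[ℂ] ((1 : ExteriorAlgebra ℂ h) ⊗ₜ[ℂ] x))) : f = g := by
  have key : ∀ (f : A.space ⊗ₛ (HRep.envSpace h ⊗ₛ X) ⟶ Y),
      Intertwines f (A.act.onLeft _ + onRight A.space ((HRep.leftMul h).onLeft X)) T →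
      ∀ (v : h) (u : ExteriorAlgebra ℂ h) (a : A.space) (x : X),
        f.lin (a ⊗ₜ[ℂ] ((ExteriorAlgebra.ι ℂ v * u) ⊗ₜ[ℂ] x)) =
          T.lin v (f.lin (A.space.parity a ⊗ₜ[ℂ] (u ⊗ₜ[ℂ] x))) -
            f.lin (A.act.lin v (A.space.parity a) ⊗ₜ[ℂ] (u ⊗ₜ[ℂ] x)) := by
    intro f hf v u a x
    have e := hf.comm v (A.space.parity a ⊗ₜ[ℂ] (u ⊗ₜ[ℂ] x))
    rw [add_lin, LinearMap.add_apply, onLeft_tmul, onRight_tmul, map_add,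
      SuperVect.parity_parity] at e
    exact eq_sub_of_add_eq' e
  refine SuperVect.Hom.ext (TensorProduct.ext_threefold' fun a u x => ?_)
  revert a x
  induction (u : ExteriorAlgebra ℂ h) using CliffordAlgebra.left_induction with
  | algebraMap r =>
    intro a x
    have e : ((algebraMap ℂ (ExteriorAlgebra ℂ h) r) ⊗ₜ[ℂ] x : ExteriorAlgebra ℂ h ⊗[ℂ] X) =
        (1 : ExteriorAlgebra ℂ h) ⊗ₜ[ℂ] (r • x) := by
      rw [Algebra.algebraMap_eq_smul_one, smul_tmul]
    exact (congrArg (fun z => f.lin (a ⊗ₜ[ℂ] z)) e).trans ((H a (r • x)).trans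
      (congrArg (fun z => g.lin (a ⊗ₜ[ℂ] z)) e).symm)
  | add u w hu hw =>
    intro a x
    have e : ∀ f : A.space ⊗ₛ (HRep.envSpace h ⊗ₛ X) ⟶ Y, f.lin (a ⊗ₜ[ℂ] ((u + w) ⊗ₜ[ℂ] x)) =
        f.lin (a ⊗ₜ[ℂ] (u ⊗ₜ[ℂ] x)) + f.lin (a ⊗ₜ[ℂ] (w ⊗ₜ[ℂ] x)) := fun f => by
      rw [← map_add, ← tmul_add, ← add_tmul]
    exact (e f).trans ((congrArg₂ (· + ·) (hu a x) (hw a x)).trans (e g).symm)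
  | ι_mul u v hu =>
    intro a x
    refine (key f hf v u a x).trans (Eq.trans ?_ (key g hg v u a x).symm)
    rw [hu, hu]

end OddOps

namespace SuperVect

/-- The permutation `a ⊗ (u ⊗ (b ⊗ c)) ↦ ± u ⊗ ((a ⊗ b) ⊗ c)`. -/
def shuffle (A U B C : SuperVect.{u}) : A ⊗ₛ (U ⊗ₛ (B ⊗ₛ C)) ⟶ U ⊗ₛ ((A ⊗ₛ B) ⊗ₛ C) :=
  assocInv A U (B ⊗ₛ C) ≫ tensorHom (flip A U) (𝟙 (B ⊗ₛ C)) ≫ assoc U A (B ⊗ₛ C) ≫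
    tensorHom (𝟙 U) (assocInv A B C)

variable (A U B C : SuperVect.{u})

variable {A U} in
lemma shuffle_tmul_of_even (a : A) {u : U} (hu : u ∈ U.even) (x : B ⊗ₛ C) :
    (shuffle A U B C).lin (a ⊗ₜ[ℂ] (u ⊗ₜ[ℂ] x)) =
      u ⊗ₜ[ℂ] (assocInv A B C).lin (a ⊗ₜ[ℂ] x) := by
  change (assoc U A (B ⊗ₛ C) ≫ tensorHom (𝟙 U) (assocInv A B C)).lin
    ((flip A U).lin (a ⊗ₜ[ℂ] u) ⊗ₜ[ℂ] x) = _
  rw [flip_tmul_of_even_right a hu]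
  rfl

lemma shuffle_tmul (a : A) (u : U) (b : B) (c : C) :
    (shuffle A U B C).lin (a ⊗ₜ[ℂ] (u ⊗ₜ[ℂ] (b ⊗ₜ[ℂ] c))) =
      u ⊗ₜ[ℂ] ((A.evenPart a ⊗ₜ[ℂ] b) ⊗ₜ[ℂ] c) +
        U.parity u ⊗ₜ[ℂ] ((A.oddPart a ⊗ₜ[ℂ] b) ⊗ₜ[ℂ] c) := by
  change (assoc U A (B ⊗ₛ C) ≫ tensorHom (𝟙 U) (assocInv A B C)).lin
    ((flip A U).lin (a ⊗ₜ[ℂ] u) ⊗ₜ[ℂ] (b ⊗ₜ[ℂ] c)) = _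
  rw [flip_tmul, add_tmul, map_add]
  rfl

end SuperVect

namespace OddOps
open SuperVect
variable {h : Type u} [AddCommGroup h] [Module ℂ h] (A U B C : SuperVect.{u})

instance (P : OddOps h U) : Intertwines (shuffle A U B C) (onRight A (P.onLeft (B ⊗ₛ C)))
    (P.onLeft (no_index ((A ⊗ₛ B) ⊗ₛ C))) := by unfold shuffle; infer_instance

instance (P : OddOps h A) : Intertwines (shuffle A U B C) (P.onLeft _)
    (onRight U ((P.onLeft B).onLeft C)) := by unfold shuffle; infer_instance

instance (P : OddOps h B) : Intertwines (shuffle A U B C) (onRight A (onRight U (P.onLeft C)))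
    (onRight U ((onRight A P).onLeft C)) := by unfold shuffle; infer_instance

instance (P : OddOps h C) : Intertwines (shuffle A U B C) (onRight A (onRight U (onRight B P)))
    (onRight U (onRight (no_index (A ⊗ₛ B)) P)) := by unfold shuffle; infer_instance

end OddOps

namespace OddMetric

lemma one_mem_even {h : Type u} [AddCommGroup h] [Module ℂ h] :
    (1 : ExteriorAlgebra ℂ h) ∈ (HRep.envSpace h).even := by
  rw [SuperVect.mem_even_iff, HRep.parity_env, AlgHom.toLinearMap_apply, map_one]

open OddOps
variable {h : Type u} [AddCommGroup h] [Module ℂ h] [FiniteDimensional ℂ h] (S : OddMetric h)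

/-- Vectors which are killed by one of the legs of `Ω` are fixed by its exponentials. -/
lemma expOmega_apply_of_eq_zero {V : SuperVect.{u}} (c : ℂ) (P Q : OddOps h V)
    [SuperCommute P P] [H : SuperCommute P Q] [SuperCommute Q Q] {v : V}
    (hv : ∀ a, P.lin a v = 0) : (S.expOmega c P Q).lin v = v := by
  have h0 : (c • S.omegaOp P Q) v = 0 := by
    rw [omegaOp_symm, LinearMap.smul_apply, omegaOp, LinearMap.sum_apply, Finset.sum_eq_zero,
      smul_zero]
    intro i _
    rw [Module.End.mul_apply, hv, map_zero]
  obtain ⟨n, hn⟩ := S.isNilpotent_smul_omegaOp c P Q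
  have hn' := pow_eq_zero_of_le n.le_succ hn
  rw [expOmega_lin_apply, expNil_eq_sum hn', Finset.sum_range_succ', LinearMap.add_apply,
    LinearMap.sum_apply, Finset.sum_eq_zero]
  · simp
  · intro k _
    rw [LinearMap.smul_apply, pow_succ, Module.End.mul_apply, h0, map_zero, smul_zero]

section

variable (A : HRep h) (B C : SuperVect.{u})

/-- The underlying map of the associator `α_{A,B,C}` of `A ∈ C₀` and `B, C ∈ C₁`. -/
def assoc₀₁₁ : A.space ⊗ₛ (HRep.envSpace h ⊗ₛ (B ⊗ₛ C)) ⟶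
    HRep.envSpace h ⊗ₛ ((A.space ⊗ₛ B) ⊗ₛ C) :=
  (ULift.down (S.associator (Sum.inl A) (Sum.inr B) (Sum.inr C)) :
    A ⊗ᵣ (HRep.env h ⊗ᵣ HRep.triv h (B ⊗ₛ C)) ⟶
      HRep.env h ⊗ᵣ HRep.triv h ((A.space ⊗ₛ B) ⊗ₛ C)).hom

lemma assoc₀₁₁_apply_one (a : A.space) (x : B ⊗ₛ C) :
    (S.assoc₀₁₁ A B C).lin (a ⊗ₜ[ℂ] ((1 : ExteriorAlgebra ℂ h) ⊗ₜ[ℂ] x)) =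
      (1 : ExteriorAlgebra ℂ h) ⊗ₜ[ℂ] (SuperVect.assocInv A.space B C).lin (a ⊗ₜ[ℂ] x) := by
  change (SuperVect.assoc (HRep.envSpace h) A.space (B ⊗ₛ C) ≫
      SuperVect.tensorHom (𝟙 _) (SuperVect.assocInv A.space B C)).lin
    ((SuperVect.tensorHom (𝟙 (HRep.envSpace h)) (HRep.antipodeAct A).hom).lin
      ((SuperVect.assoc (HRep.envSpace h) (HRep.envSpace h) A.space).lin
        ((SuperVect.tensorHom (HRep.coprod h ≫ SuperVect.flip (HRep.envSpace h) (HRep.envSpace h))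
            (𝟙 A.space)).lin
          ((SuperVect.flip A.space (HRep.envSpace h)).lin
            (a ⊗ₜ[ℂ] (1 : ExteriorAlgebra ℂ h))))) ⊗ₜ[ℂ] x) = _
  rw [SuperVect.flip_tmul_of_even_right a one_mem_even, SuperVect.tensorHom_tmul,
    SuperVect.comp_lin_apply (HRep.coprod h), HRep.coprod_one,
    SuperVect.flip_tmul_of_even_right (V := HRep.envSpace h) _ one_mem_even]
  change (1 : ExteriorAlgebra ℂ h) ⊗ₜ[ℂ] (SuperVect.assocInv A.space B C).lin
    (A.envAct ((HRep.antipode h).symm 1) a ⊗ₜ[ℂ] x) = _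
  rw [map_one, map_one]
  rfl

/-- The `011` associator is the exponential of `-Ω`, one leg of which acts on `U(h)` by
derivations, followed by a permutation of the factors. -/
lemma assoc₀₁₁_eq : S.assoc₀₁₁ A B C =
    S.expOmega (-1) (onRight A.space (S.deriv.onLeft (B ⊗ₛ C))) (A.act.onLeft _) ≫
      SuperVect.shuffle A.space (HRep.envSpace h) B C := by
  -- Both sides are intertwiners of `h`, so they can be compared on `A ⊗ (1 ⊗ X)`.
  refine tensor_env_tensor_ext ((HRep.leftMul h).onLeft _) ?_ ?_ ?_
  · have H := Intertwines.mk (f := S.assoc₀₁₁ A B C)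
      (ULift.down (S.associator (Sum.inl A) (Sum.inr B) (Sum.inr C)) :
        A ⊗ᵣ (HRep.env h ⊗ᵣ HRep.triv h (B ⊗ₛ C)) ⟶
          HRep.env h ⊗ᵣ HRep.triv h ((A.space ⊗ₛ B) ⊗ₛ C)).comm
    rw [tensor_triv_act_eq, tensor_act_eq, tensor_triv_act_eq] at H
    exact H
  · have H : Intertwines (S.expOmega (-1) (onRight A.space (S.deriv.onLeft (B ⊗ₛ C)))
        (A.act.onLeft _) ≫ SuperVect.shuffle A.space (HRep.envSpace h) B C) _
        ((HRep.leftMul h).onLeft _) := inferInstance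
    exact H.congr (add_neg_neg_smul _ _)
  · intro a x
    rw [assoc₀₁₁_apply_one, SuperVect.comp_lin_apply, expOmega_apply_of_eq_zero,
      SuperVect.shuffle_tmul_of_even B C a one_mem_even]
    intro b
    rw [onRight_tmul, onLeft_tmul, deriv_one, zero_tmul, tmul_zero]

end

section

variable (A B : SuperVect.{u}) (C : HRep h)

/-- The underlying map of the associator `α_{A,B,C}` of `A, B ∈ C₁` and `C ∈ C₀`. -/
def assoc₁₁₀ : HRep.envSpace h ⊗ₛ (A ⊗ₛ (B ⊗ₛ C.space)) ⟶
    (HRep.envSpace h ⊗ₛ (A ⊗ₛ B)) ⊗ₛ C.space :=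
  (ULift.down (S.associator (Sum.inr A) (Sum.inr B) (Sum.inl C)) :
    HRep.env h ⊗ᵣ HRep.triv h (A ⊗ₛ (B ⊗ₛ C.space)) ⟶
      (HRep.env h ⊗ᵣ HRep.triv h (A ⊗ₛ B)) ⊗ᵣ C).hom

lemma assoc₁₁₀_apply_one (a : A) (b : B) (c : C.space) :
    (S.assoc₁₁₀ A B C).lin ((1 : ExteriorAlgebra ℂ h) ⊗ₜ[ℂ] (a ⊗ₜ[ℂ] (b ⊗ₜ[ℂ] c))) =
      ((1 : ExteriorAlgebra ℂ h) ⊗ₜ[ℂ] (a ⊗ₜ[ℂ] b)) ⊗ₜ[ℂ] c := by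
  have h1 : (S.assoc₁₁₀ A B C).lin ((1 : ExteriorAlgebra ℂ h) ⊗ₜ[ℂ] (a ⊗ₜ[ℂ] (b ⊗ₜ[ℂ] c))) =
    (SuperVect.assocInv (HRep.envSpace h) (A ⊗ₛ B) C.space).lin
      ((SuperVect.tensorHom (𝟙 (HRep.envSpace h))
        (SuperVect.tensorHom (𝟙 (HRep.envSpace h)) (𝟙 ((A ⊗ₛ B) ⊗ₛ C.space)) ≫
          SuperVect.assocInv (HRep.envSpace h) (A ⊗ₛ B) C.space ≫
          SuperVect.tensorHom (SuperVect.flip (HRep.envSpace h) (A ⊗ₛ B)) (𝟙 C.space) ≫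
          SuperVect.assoc (A ⊗ₛ B) (HRep.envSpace h) C.space ≫
          SuperVect.tensorHom (𝟙 (A ⊗ₛ B)) C.actHom)).lin
        ((SuperVect.assoc (HRep.envSpace h) (HRep.envSpace h) ((A ⊗ₛ B) ⊗ₛ C.space)).lin
          ((HRep.coprod h).lin (1 : ExteriorAlgebra ℂ h) ⊗ₜ[ℂ] ((a ⊗ₜ[ℂ] b) ⊗ₜ[ℂ] c)))) := rfl
  rw [h1, HRep.coprod_one]
  change (SuperVect.assocInv (HRep.envSpace h) (A ⊗ₛ B) C.space).lin
    ((1 : ExteriorAlgebra ℂ h) ⊗ₜ[ℂ] (SuperVect.assoc (A ⊗ₛ B) (HRep.envSpace h) C.space ≫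
          SuperVect.tensorHom (𝟙 (A ⊗ₛ B)) C.actHom).lin
      ((SuperVect.flip (HRep.envSpace h) (A ⊗ₛ B)).lin
        ((1 : ExteriorAlgebra ℂ h) ⊗ₜ[ℂ] (a ⊗ₜ[ℂ] b)) ⊗ₜ[ℂ] c)) = _
  rw [SuperVect.flip_tmul_of_even_left one_mem_even]
  change ((1 : ExteriorAlgebra ℂ h) ⊗ₜ[ℂ] (a ⊗ₜ[ℂ] b)) ⊗ₜ[ℂ] (C.envAct 1 c) = _
  rw [map_one]
  rfl

/-- The `110` associator is the exponential of `Ω`, one leg of which acts on `U(h)` by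
derivations, followed by a rebracketing. -/
lemma assoc₁₁₀_eq : S.assoc₁₁₀ A B C =
    S.expOmega 1 (S.deriv.onLeft _)
      (onRight (HRep.envSpace h) (onRight A (onRight B C.act))) ≫
      SuperVect.tensorHom (𝟙 _) (SuperVect.assocInv A B C.space) ≫
      SuperVect.assocInv (HRep.envSpace h) (A ⊗ₛ B) C.space := by
  refine env_tensor_ext (((HRep.leftMul h).onLeft (A ⊗ₛ B)).onLeft C.space +
    onRight _ C.act) ?_ ?_ ?_
  · have H := Intertwines.mk (f := S.assoc₁₁₀ A B C)
      (ULift.down (S.associator (Sum.inr A) (Sum.inr B) (Sum.inl C)) :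
        HRep.env h ⊗ᵣ HRep.triv h (A ⊗ₛ (B ⊗ₛ C.space)) ⟶
          (HRep.env h ⊗ᵣ HRep.triv h (A ⊗ₛ B)) ⊗ᵣ C).comm
    rw [tensor_triv_act_eq, tensor_act_eq, tensor_triv_act_eq] at H
    exact H
  · have H : Intertwines (S.expOmega 1 (S.deriv.onLeft _)
        (onRight (HRep.envSpace h) (onRight A (onRight B C.act))) ≫
      SuperVect.tensorHom (𝟙 _) (SuperVect.assocInv A B C.space) ≫
      SuperVect.assocInv (HRep.envSpace h) (A ⊗ₛ B) C.space) _
        (((HRep.leftMul h).onLeft (A ⊗ₛ B)).onLeft C.space + onRight _ C.act) := inferInstance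
    exact H.congr (add_neg_smul_add _ _)
  · intro x
    have key : (S.assoc₁₁₀ A B C).lin ∘ₗ TensorProduct.mk ℂ _ _ (1 : ExteriorAlgebra ℂ h) =
        (SuperVect.tensorHom (𝟙 (HRep.envSpace h)) (SuperVect.assocInv A B C.space) ≫
          SuperVect.assocInv (HRep.envSpace h) (A ⊗ₛ B) C.space).lin ∘ₗ
          TensorProduct.mk ℂ _ _ (1 : ExteriorAlgebra ℂ h) :=
      TensorProduct.ext_threefold' fun a b c => S.assoc₁₁₀_apply_one A B C a b c
    rw [SuperVect.comp_lin_apply, expOmega_apply_of_eq_zero]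
    · exact LinearMap.congr_fun key x
    · intro b
      rw [onLeft_tmul, deriv_one, zero_tmul]

end

section

variable (A B C : SuperVect.{u})

/-- The underlying map of the associator `α_{A,B,C}` of `A, B, C ∈ C₁`. -/
def assoc₁₁₁ : A ⊗ₛ (HRep.envSpace h ⊗ₛ (B ⊗ₛ C)) ⟶ (HRep.envSpace h ⊗ₛ (A ⊗ₛ B)) ⊗ₛ C :=
  ULift.down (S.associator (Sum.inr A) (Sum.inr B) (Sum.inr C))

/-- `φ` is even, so that it may be applied before the permutation of the factors. -/
lemma assoc₁₁₁_eq : S.assoc₁₁₁ A B C =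
    SuperVect.tensorHom (𝟙 A) (SuperVect.tensorHom S.phi (𝟙 (B ⊗ₛ C))) ≫
      SuperVect.shuffle A (HRep.envSpace h) B C ≫
      SuperVect.assocInv (HRep.envSpace h) (A ⊗ₛ B) C := by
  refine SuperVect.Hom.ext (TensorProduct.ext_threefold' fun a u x => ?_)
  change (SuperVect.assoc (HRep.envSpace h) A (B ⊗ₛ C) ≫
      SuperVect.tensorHom (𝟙 (HRep.envSpace h)) (SuperVect.assocInv A B C) ≫
      SuperVect.assocInv (HRep.envSpace h) (A ⊗ₛ B) C).lin
      ((SuperVect.flip A (HRep.envSpace h) ≫ SuperVect.tensorHom S.phi (𝟙 A)).lin (a ⊗ₜ[ℂ] u)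
        ⊗ₜ[ℂ] x) =
    (SuperVect.assoc (HRep.envSpace h) A (B ⊗ₛ C) ≫
      SuperVect.tensorHom (𝟙 (HRep.envSpace h)) (SuperVect.assocInv A B C) ≫
      SuperVect.assocInv (HRep.envSpace h) (A ⊗ₛ B) C).lin
      ((SuperVect.flip A (HRep.envSpace h)).lin (a ⊗ₜ[ℂ] S.phi.lin u) ⊗ₜ[ℂ] x)
  rw [SuperVect.comp_lin_apply (SuperVect.flip A _), SuperVect.flip_tmul, SuperVect.flip_tmul,
    map_add, SuperVect.tensorHom_tmul, SuperVect.tensorHom_tmul, SuperVect.Hom.map_parity]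
  rfl

end

end OddMetric

/-! ### Signs of permutations -/

namespace SuperVect

variable {V V' V'' W W' W'' X Y Z : SuperVect.{u}}

lemma tensorHom_id_comp (f : V ⟶ V') (g : V' ⟶ V'') :
    tensorHom (𝟙 W) (f ≫ g) = tensorHom (𝟙 W) f ≫ tensorHom (𝟙 W) g :=
  Hom.ext (TensorProduct.ext' fun _ _ => rfl)

lemma tensorHom_comp_id (f : V ⟶ V') (g : V' ⟶ V'') :
    tensorHom (f ≫ g) (𝟙 W) = tensorHom f (𝟙 W) ≫ tensorHom g (𝟙 W) :=
  Hom.ext (TensorProduct.ext' fun _ _ => rfl)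

lemma tensorHom_id_id : tensorHom (𝟙 V) (𝟙 W) = 𝟙 (V ⊗ₛ W) :=
  Hom.ext (TensorProduct.ext' fun _ _ => rfl)

lemma ext_fourfold {f g : V ⊗ₛ (W ⊗ₛ (X ⊗ₛ Y)) ⟶ Z}
    (H : ∀ v w x y, f.lin (v ⊗ₜ[ℂ] (w ⊗ₜ[ℂ] (x ⊗ₜ[ℂ] y))) =
      g.lin (v ⊗ₜ[ℂ] (w ⊗ₜ[ℂ] (x ⊗ₜ[ℂ] y)))) : f = g := by
  refine Hom.ext (TensorProduct.ext_threefold' fun v w z => ?_)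
  exact LinearMap.congr_fun (TensorProduct.ext' (H v w) :
    f.lin ∘ₗ TensorProduct.mk ℂ _ _ v ∘ₗ TensorProduct.mk ℂ _ _ w =
      g.lin ∘ₗ TensorProduct.mk ℂ _ _ v ∘ₗ TensorProduct.mk ℂ _ _ w) z

lemma ext_fivefold {T : SuperVect.{u}} {f g : V ⊗ₛ (W ⊗ₛ (X ⊗ₛ (Y ⊗ₛ T))) ⟶ Z}
    (H : ∀ v w x y t, f.lin (v ⊗ₜ[ℂ] (w ⊗ₜ[ℂ] (x ⊗ₜ[ℂ] (y ⊗ₜ[ℂ] t)))) =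
      g.lin (v ⊗ₜ[ℂ] (w ⊗ₜ[ℂ] (x ⊗ₜ[ℂ] (y ⊗ₜ[ℂ] t))))) : f = g := by
  refine ext_fourfold fun v w x z => ?_
  exact LinearMap.congr_fun (TensorProduct.ext' (H v w x) :
    f.lin ∘ₗ TensorProduct.mk ℂ _ _ v ∘ₗ TensorProduct.mk ℂ _ _ w ∘ₗ TensorProduct.mk ℂ _ _ x =
      g.lin ∘ₗ TensorProduct.mk ℂ _ _ v ∘ₗ TensorProduct.mk ℂ _ _ w ∘ₗ
        TensorProduct.mk ℂ _ _ x) z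

lemma assocInv_pentagon (A B C D : SuperVect.{u}) :
    tensorHom (𝟙 A) (assocInv B C D) ≫ assocInv A (B ⊗ₛ C) D ≫ tensorHom (assocInv A B C) (𝟙 D) =
      assocInv A B (C ⊗ₛ D) ≫ assocInv (A ⊗ₛ B) C D :=
  ext_fourfold fun _ _ _ _ => rfl

lemma flip_tmul_of_odd_left {A U : SuperVect.{u}} {a : A} (ha : a ∈ A.odd) (u : U) :
    (flip A U).lin (a ⊗ₜ[ℂ] u) = U.parity u ⊗ₜ[ℂ] a := by
  have h0 : A.evenPart a = 0 := LinearMap.ofIsCompl_apply_right A.isCompl (⟨a, ha⟩ : A.odd)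
  have h1 : A.oddPart a = a := LinearMap.ofIsCompl_apply_right A.isCompl (⟨a, ha⟩ : A.odd)
  rw [flip_tmul, h0, h1, tmul_zero, zero_add]

/-- `HasSign a σ` says that moving a vector `u` past the homogeneous vector `a` replaces it by
`σ u`; here `σ` is the identity if `a` is even, and the parity involution if `a` is odd. -/
structure HasSign {A : SuperVect.{u}} (a : A) (σ : ∀ U : SuperVect.{u}, U ⟶ U) : Prop where
  flip_tmul : ∀ (U : SuperVect.{u}) (u : U),
    (flip A U).lin (a ⊗ₜ[ℂ] u) = (σ U).lin u ⊗ₜ[ℂ] a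
  map : ∀ {U U' : SuperVect.{u}} (f : U ⟶ U') (u : U), f.lin ((σ U).lin u) = (σ U').lin (f.lin u)
  tmul : ∀ {U U' : SuperVect.{u}} (u : U) (u' : U'),
    (σ (U ⊗ₛ U')).lin (u ⊗ₜ[ℂ] u') = (σ U).lin u ⊗ₜ[ℂ] (σ U').lin u'
  invol : ∀ {U : SuperVect.{u}} (u : U), (σ U).lin ((σ U).lin u) = u

lemma hasSign_of_even {A : SuperVect.{u}} {a : A} (ha : a ∈ A.even) : HasSign a fun U => 𝟙 U where
  flip_tmul _ u := flip_tmul_of_even_left ha u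
  map _ _ := rfl
  tmul _ _ := rfl
  invol _ := rfl

lemma hasSign_of_odd {A : SuperVect.{u}} {a : A} (ha : a ∈ A.odd) :
    HasSign a fun U => U.parityHom where
  flip_tmul _ u := flip_tmul_of_odd_left ha u
  map f u := f.map_parity u
  tmul _ _ := parity_tmul _ _ _ _
  invol u := parity_parity _ u

lemma evenPart_tmul {A B : SuperVect.{u}} (a : A) (b : B) : (A ⊗ₛ B).evenPart (a ⊗ₜ[ℂ] b) =
    A.evenPart a ⊗ₜ[ℂ] B.evenPart b + A.oddPart a ⊗ₜ[ℂ] B.oddPart b := by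
  have key : ∀ {V W : Type u} [AddCommGroup V] [Module ℂ V] [AddCommGroup W] [Module ℂ W]
      (a a' : V) (b b' : W), (2⁻¹ : ℂ) • (a ⊗ₜ[ℂ] b + a' ⊗ₜ[ℂ] b') =
        ((2⁻¹ : ℂ) • (a + a')) ⊗ₜ[ℂ] ((2⁻¹ : ℂ) • (b + b')) +
          ((2⁻¹ : ℂ) • (a - a')) ⊗ₜ[ℂ] ((2⁻¹ : ℂ) • (b - b')) := by
    intros
    simp only [tmul_smul, ← smul_tmul', tmul_add, add_tmul, tmul_sub, sub_tmul]
    module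
  rw [evenPart_eq, evenPart_eq, evenPart_eq, oddPart_eq, oddPart_eq, LinearMap.smul_apply,
    LinearMap.add_apply, parity_tmul]
  exact key _ _ _ _

lemma oddPart_tmul {A B : SuperVect.{u}} (a : A) (b : B) : (A ⊗ₛ B).oddPart (a ⊗ₜ[ℂ] b) =
    A.evenPart a ⊗ₜ[ℂ] B.oddPart b + A.oddPart a ⊗ₜ[ℂ] B.evenPart b := by
  have key : ∀ {V W : Type u} [AddCommGroup V] [Module ℂ V] [AddCommGroup W] [Module ℂ W]
      (a a' : V) (b b' : W), (2⁻¹ : ℂ) • (a ⊗ₜ[ℂ] b - a' ⊗ₜ[ℂ] b') =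
        ((2⁻¹ : ℂ) • (a + a')) ⊗ₜ[ℂ] ((2⁻¹ : ℂ) • (b - b')) +
          ((2⁻¹ : ℂ) • (a - a')) ⊗ₜ[ℂ] ((2⁻¹ : ℂ) • (b + b')) := by
    intros
    simp only [tmul_smul, ← smul_tmul', tmul_add, add_tmul, tmul_sub, sub_tmul]
    module
  rw [evenPart_eq, evenPart_eq, oddPart_eq, oddPart_eq, oddPart_eq, LinearMap.smul_apply,
    LinearMap.sub_apply, parity_tmul]
  exact key _ _ _ _

/-- The hexagon identity of the super-flip, with a tensor product as the left factor. -/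
lemma flip_tensor_left (A B U : SuperVect.{u}) : flip (A ⊗ₛ B) U =
    assoc A B U ≫ tensorHom (𝟙 A) (flip B U) ≫ assocInv A U B ≫ tensorHom (flip A U) (𝟙 B) ≫
      assoc U A B := by
  refine Hom.ext (TensorProduct.ext_threefold fun a b u => ?_)
  change _ = (assocInv A U B ≫ tensorHom (flip A U) (𝟙 B) ≫ assoc U A B).lin
    (a ⊗ₜ[ℂ] (flip B U).lin (b ⊗ₜ[ℂ] u))
  rw [flip_tmul B U, tmul_add, map_add]
  change _ = (assoc U A B).lin ((flip A U).lin (a ⊗ₜ[ℂ] u) ⊗ₜ[ℂ] B.evenPart b) +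
    (assoc U A B).lin ((flip A U).lin (a ⊗ₜ[ℂ] U.parity u) ⊗ₜ[ℂ] B.oddPart b)
  rw [flip_tmul A U, flip_tmul A U, add_tmul, add_tmul, map_add, map_add, assoc_tmul, assoc_tmul,
    assoc_tmul, assoc_tmul, flip_tmul (A ⊗ₛ B) U, evenPart_tmul, oddPart_tmul, tmul_add, tmul_add,
    parity_parity]
  abel

lemma HasSign.tensor {A B : SuperVect.{u}} {a : A} {b : B} {σ τ : ∀ U : SuperVect.{u}, U ⟶ U}
    (ha : HasSign a σ) (hb : HasSign b τ) :
    HasSign (A := A ⊗ₛ B) (a ⊗ₜ[ℂ] b) fun U => τ U ≫ σ U where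
  flip_tmul U u := by
    rw [flip_tensor_left]
    change (assocInv A U B ≫ tensorHom (flip A U) (𝟙 B) ≫
        assoc U A B).lin (a ⊗ₜ[ℂ] (flip B U).lin (b ⊗ₜ[ℂ] u)) = _
    rw [hb.flip_tmul]
    change (assoc U A B).lin ((flip A U).lin (a ⊗ₜ[ℂ] (τ U).lin u) ⊗ₜ[ℂ] b) = _
    rw [ha.flip_tmul]
    rfl
  map {U U'} f u := by
    rw [comp_lin_apply, comp_lin_apply, ha.map, hb.map]
  tmul {U U'} u u' := by
    rw [comp_lin_apply, comp_lin_apply, comp_lin_apply, hb.tmul, ha.tmul]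
  invol {U} u := by
    rw [comp_lin_apply, comp_lin_apply, hb.map, ha.invol, hb.invol]

lemma flip_flip (A U : SuperVect.{u}) : flip A U ≫ flip U A = 𝟙 (A ⊗ₛ U) := by
  refine Hom.ext (TensorProduct.ext' fun a u => ?_)
  rw [comp_lin_apply, flip_tmul, map_add, flip_tmul, flip_tmul, evenPart_eq, oddPart_eq,
    evenPart_eq, oddPart_eq]
  simp only [LinearMap.smul_apply, LinearMap.add_apply, LinearMap.sub_apply, Module.End.one_apply,
    map_smul, map_add, map_sub, parity_parity]
  have key : ∀ {V W : Type u} [AddCommGroup V] [Module ℂ V] [AddCommGroup W] [Module ℂ W]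
      (a a' : V) (u u' : W),
      ((2⁻¹ : ℂ) • (a + a')) ⊗ₜ[ℂ] ((2⁻¹ : ℂ) • (u + u')) +
        ((2⁻¹ : ℂ) • (a' + a)) ⊗ₜ[ℂ] ((2⁻¹ : ℂ) • (u - u')) +
        (((2⁻¹ : ℂ) • (a - a')) ⊗ₜ[ℂ] ((2⁻¹ : ℂ) • (u' + u)) +
        ((2⁻¹ : ℂ) • (a' - a)) ⊗ₜ[ℂ] ((2⁻¹ : ℂ) • (u' - u))) = a ⊗ₜ[ℂ] u := by
    intros
    simp only [tmul_smul, ← smul_tmul', tmul_add, add_tmul, tmul_sub, sub_tmul]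
    module
  exact key a (A.parity a) u (U.parity u)

lemma HasSign.flip_tmul_right {A : SuperVect.{u}} {a : A} {σ : ∀ U : SuperVect.{u}, U ⟶ U}
    (ha : HasSign a σ) (U : SuperVect.{u}) (u : U) :
    (flip U A).lin (u ⊗ₜ[ℂ] a) = a ⊗ₜ[ℂ] (σ U).lin u := by
  have := congr_lin (flip_flip A U) (a ⊗ₜ[ℂ] (σ U).lin u)
  rwa [comp_lin_apply, ha.flip_tmul, ha.invol] at this

lemma tensorHom_flip {A A' U U' : SuperVect.{u}} (f : A ⟶ A') (g : U ⟶ U') :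
    tensorHom f g ≫ flip A' U' = flip A U ≫ tensorHom g f := by
  refine Hom.ext (TensorProduct.ext' fun a u => ?_)
  change (flip A' U').lin (f.lin a ⊗ₜ[ℂ] g.lin u) =
    (tensorHom g f).lin ((flip A U).lin (a ⊗ₜ[ℂ] u))
  rw [SuperVect.flip_tmul, SuperVect.flip_tmul, map_add, evenPart_eq, oddPart_eq, evenPart_eq,
    oddPart_eq, tensorHom_tmul, tensorHom_tmul]
  simp only [LinearMap.smul_apply, LinearMap.add_apply, LinearMap.sub_apply, Module.End.one_apply,
    map_smul, map_add, map_sub, Hom.map_parity]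

lemma HasSign.apply {A B : SuperVect.{u}} {a : A} {σ : ∀ U : SuperVect.{u}, U ⟶ U}
    (ha : HasSign a σ) (f : A ⟶ B) : HasSign (f.lin a) σ where
  flip_tmul U u := by
    refine (congr_lin (tensorHom_flip f (𝟙 U)) (a ⊗ₜ[ℂ] u)).trans ?_
    rw [comp_lin_apply, ha.flip_tmul]
    rfl
  map f u := ha.map f u
  tmul u u' := ha.tmul u u'
  invol u := ha.invol u

lemma HasSign.shuffle_tmul {A : SuperVect.{u}} {a : A} {σ : ∀ U : SuperVect.{u}, U ⟶ U}
    (ha : HasSign a σ) {U B C : SuperVect.{u}} (u : U) (x : B ⊗ₛ C) :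
    (shuffle A U B C).lin (a ⊗ₜ[ℂ] (u ⊗ₜ[ℂ] x)) =
      (σ U).lin u ⊗ₜ[ℂ] (assocInv A B C).lin (a ⊗ₜ[ℂ] x) := by
  change (assoc U A (B ⊗ₛ C) ≫ tensorHom (𝟙 U) (assocInv A B C)).lin
    ((flip A U).lin (a ⊗ₜ[ℂ] u) ⊗ₜ[ℂ] x) = _
  rw [ha.flip_tmul]
  rfl

/-- Maps out of a fivefold tensor product agree if they do so on pure tensors whose first factor
is homogeneous. -/
lemma ext_hasSign_left {A B U C D : SuperVect.{u}} {f g : A ⊗ₛ (U ⊗ₛ (B ⊗ₛ (C ⊗ₛ D))) ⟶ Y}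
    (H : ∀ (a : A) (σ : ∀ U : SuperVect.{u}, U ⟶ U), HasSign a σ → ∀ u b c d,
        f.lin (a ⊗ₜ[ℂ] (u ⊗ₜ[ℂ] (b ⊗ₜ[ℂ] (c ⊗ₜ[ℂ] d)))) =
          g.lin (a ⊗ₜ[ℂ] (u ⊗ₜ[ℂ] (b ⊗ₜ[ℂ] (c ⊗ₜ[ℂ] d))))) : f = g := by
  refine ext_fivefold fun a b u c d => ?_
  obtain ⟨a₀, ha₀, a₁, ha₁, rfl⟩ := A.exists_add a
  rw [add_tmul, map_add, map_add, H a₀ _ (hasSign_of_even ha₀), H a₁ _ (hasSign_of_odd ha₁)]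

/-- Maps out of a fivefold tensor product agree if they do so on pure tensors whose first two
factors are homogeneous. -/
lemma ext_hasSign_fivefold {A B U C D : SuperVect.{u}}
    {f g : A ⊗ₛ (B ⊗ₛ (U ⊗ₛ (C ⊗ₛ D))) ⟶ Y}
    (H : ∀ (a : A) (σ : ∀ U : SuperVect.{u}, U ⟶ U) (b : B) (τ : ∀ U : SuperVect.{u}, U ⟶ U),
      HasSign a σ → HasSign b τ → ∀ u c d,
        f.lin (a ⊗ₜ[ℂ] (b ⊗ₜ[ℂ] (u ⊗ₜ[ℂ] (c ⊗ₜ[ℂ] d)))) =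
          g.lin (a ⊗ₜ[ℂ] (b ⊗ₜ[ℂ] (u ⊗ₜ[ℂ] (c ⊗ₜ[ℂ] d))))) : f = g := by
  refine ext_hasSign_left fun a σ ha b u c d => ?_
  obtain ⟨b₀, hb₀, b₁, hb₁, rfl⟩ := B.exists_add b
  rw [add_tmul, tmul_add, map_add, map_add, H a σ b₀ _ ha (hasSign_of_even hb₀),
    H a σ b₁ _ ha (hasSign_of_odd hb₁)]

section coherence

variable (A B C D : SuperVect.{u}) {U U' : SuperVect.{u}} (f : U ⟶ U')

variable (U) in
/-- The permutations in the pentagon for the degrees `0011`. -/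
lemma coh₀₀₁₁ : tensorHom (𝟙 A) (shuffle B U C D) ≫ shuffle A U (B ⊗ₛ C) D ≫
    tensorHom (𝟙 U) (tensorHom (assocInv A B C) (𝟙 D)) =
      assocInv A B (U ⊗ₛ (C ⊗ₛ D)) ≫ shuffle (A ⊗ₛ B) U C D := by
  refine ext_hasSign_fivefold fun a σ b τ ha hb u c d => ?_
  change (tensorHom (𝟙 U) (tensorHom (assocInv A B C) (𝟙 D))).lin
    ((shuffle A U (B ⊗ₛ C) D).lin (a ⊗ₜ[ℂ] (shuffle B U C D).lin (b ⊗ₜ[ℂ] (u ⊗ₜ[ℂ] (c ⊗ₜ[ℂ] d))))) =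
    (shuffle (A ⊗ₛ B) U C D).lin ((a ⊗ₜ[ℂ] b) ⊗ₜ[ℂ] (u ⊗ₜ[ℂ] (c ⊗ₜ[ℂ] d)))
  rw [hb.shuffle_tmul, ha.shuffle_tmul, (ha.tensor hb).shuffle_tmul]
  rfl

/-- The permutations in the pentagon for the degrees `0111`. -/
lemma coh₀₁₁₁ : tensorHom (𝟙 A) (tensorHom (𝟙 B) (tensorHom f (𝟙 (C ⊗ₛ D)))) ≫
    tensorHom (𝟙 A) (shuffle B U' C D) ≫ tensorHom (𝟙 A) (assocInv U' (B ⊗ₛ C) D) ≫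
    assocInv A (U' ⊗ₛ (B ⊗ₛ C)) D ≫ tensorHom (shuffle A U' B C) (𝟙 D) =
    assocInv A B (U ⊗ₛ (C ⊗ₛ D)) ≫ tensorHom (𝟙 (A ⊗ₛ B)) (tensorHom f (𝟙 (C ⊗ₛ D))) ≫
    shuffle (A ⊗ₛ B) U' C D ≫ assocInv U' ((A ⊗ₛ B) ⊗ₛ C) D := by
  refine ext_hasSign_fivefold fun a σ b τ ha hb u c d => ?_
  change (assocInv A (U' ⊗ₛ (B ⊗ₛ C)) D ≫ tensorHom (shuffle A U' B C) (𝟙 D)).lin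
    (a ⊗ₜ[ℂ] (assocInv U' (B ⊗ₛ C) D).lin
      ((shuffle B U' C D).lin (b ⊗ₜ[ℂ] (f.lin u ⊗ₜ[ℂ] (c ⊗ₜ[ℂ] d))))) =
    (assocInv U' ((A ⊗ₛ B) ⊗ₛ C) D).lin
      ((shuffle (A ⊗ₛ B) U' C D).lin ((a ⊗ₜ[ℂ] b) ⊗ₜ[ℂ] (f.lin u ⊗ₜ[ℂ] (c ⊗ₜ[ℂ] d))))
  rw [hb.shuffle_tmul, (ha.tensor hb).shuffle_tmul]
  change (shuffle A U' B C).lin (a ⊗ₜ[ℂ] ((τ U').lin (f.lin u) ⊗ₜ[ℂ] (b ⊗ₜ[ℂ] c))) ⊗ₜ[ℂ] d = _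
  rw [ha.shuffle_tmul]
  rfl

/-- The permutations in the pentagon for the degrees `1011`. -/
lemma coh₁₀₁₁ : tensorHom (𝟙 A) (shuffle B U C D) ≫
    tensorHom (𝟙 A) (tensorHom f (𝟙 ((B ⊗ₛ C) ⊗ₛ D))) ≫ shuffle A U' (B ⊗ₛ C) D ≫
    assocInv U' (A ⊗ₛ (B ⊗ₛ C)) D ≫ tensorHom (tensorHom (𝟙 U') (assocInv A B C)) (𝟙 D) =
    assocInv A B (U ⊗ₛ (C ⊗ₛ D)) ≫ tensorHom (𝟙 (A ⊗ₛ B)) (tensorHom f (𝟙 (C ⊗ₛ D))) ≫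
    shuffle (A ⊗ₛ B) U' C D ≫ assocInv U' ((A ⊗ₛ B) ⊗ₛ C) D := by
  refine ext_hasSign_fivefold fun a σ b τ ha hb u c d => ?_
  change (shuffle A U' (B ⊗ₛ C) D ≫ assocInv U' (A ⊗ₛ (B ⊗ₛ C)) D ≫
      tensorHom (tensorHom (𝟙 U') (assocInv A B C)) (𝟙 D)).lin
    (a ⊗ₜ[ℂ] (tensorHom f (𝟙 ((B ⊗ₛ C) ⊗ₛ D))).lin
      ((shuffle B U C D).lin (b ⊗ₜ[ℂ] (u ⊗ₜ[ℂ] (c ⊗ₜ[ℂ] d))))) =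
    (assocInv U' ((A ⊗ₛ B) ⊗ₛ C) D).lin
      ((shuffle (A ⊗ₛ B) U' C D).lin ((a ⊗ₜ[ℂ] b) ⊗ₜ[ℂ] (f.lin u ⊗ₜ[ℂ] (c ⊗ₜ[ℂ] d))))
  rw [hb.shuffle_tmul, (ha.tensor hb).shuffle_tmul, tensorHom_tmul, hb.map, comp_lin_apply,
    ha.shuffle_tmul]
  rfl

variable (U) in
/-- The permutations in the pentagon for the degrees `0110`. -/
lemma coh₀₁₁₀ : tensorHom (𝟙 A) (tensorHom (𝟙 U) (assocInv B C D)) ≫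
    tensorHom (𝟙 A) (assocInv U (B ⊗ₛ C) D) ≫ assocInv A (U ⊗ₛ (B ⊗ₛ C)) D ≫
    tensorHom (shuffle A U B C) (𝟙 D) =
    shuffle A U B (C ⊗ₛ D) ≫ tensorHom (𝟙 U) (assocInv (A ⊗ₛ B) C D) ≫
      assocInv U ((A ⊗ₛ B) ⊗ₛ C) D := by
  refine ext_hasSign_left fun a σ ha u b c d => ?_
  change (shuffle A U B C).lin (a ⊗ₜ[ℂ] (u ⊗ₜ[ℂ] (b ⊗ₜ[ℂ] c))) ⊗ₜ[ℂ] d =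
    (tensorHom (𝟙 U) (assocInv (A ⊗ₛ B) C D) ≫ assocInv U ((A ⊗ₛ B) ⊗ₛ C) D).lin
      ((shuffle A U B (C ⊗ₛ D)).lin (a ⊗ₜ[ℂ] (u ⊗ₜ[ℂ] (b ⊗ₜ[ℂ] (c ⊗ₜ[ℂ] d)))))
  rw [ha.shuffle_tmul, ha.shuffle_tmul]
  rfl

variable (U) in
/-- The permutations in the pentagon for the degrees `0101`. -/
lemma coh₀₁₀₁ : tensorHom (𝟙 A) (tensorHom (𝟙 U) (assocInv B C D)) ≫
    shuffle A U (B ⊗ₛ C) D ≫ tensorHom (𝟙 U) (tensorHom (assocInv A B C) (𝟙 D)) =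
    shuffle A U B (C ⊗ₛ D) ≫ tensorHom (𝟙 U) (assocInv (A ⊗ₛ B) C D) := by
  refine ext_hasSign_left fun a σ ha u b c d => ?_
  change (tensorHom (𝟙 U) (tensorHom (assocInv A B C) (𝟙 D))).lin
      ((shuffle A U (B ⊗ₛ C) D).lin (a ⊗ₜ[ℂ] (u ⊗ₜ[ℂ] ((b ⊗ₜ[ℂ] c) ⊗ₜ[ℂ] d)))) =
    (tensorHom (𝟙 U) (assocInv (A ⊗ₛ B) C D)).lin
      ((shuffle A U B (C ⊗ₛ D)).lin (a ⊗ₜ[ℂ] (u ⊗ₜ[ℂ] (b ⊗ₜ[ℂ] (c ⊗ₜ[ℂ] d)))))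
  rw [ha.shuffle_tmul, ha.shuffle_tmul]
  rfl

/-- The permutations in the pentagon for the degrees `1110`. -/
lemma coh₁₁₁₀ : tensorHom (𝟙 A) (tensorHom (𝟙 U) (assocInv B C D)) ≫
    tensorHom (𝟙 A) (assocInv U (B ⊗ₛ C) D) ≫ assocInv A (U ⊗ₛ (B ⊗ₛ C)) D ≫
    tensorHom (tensorHom (𝟙 A) (tensorHom f (𝟙 (B ⊗ₛ C)))) (𝟙 D) ≫
    tensorHom (shuffle A U' B C) (𝟙 D) ≫ tensorHom (assocInv U' (A ⊗ₛ B) C) (𝟙 D) =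
    tensorHom (𝟙 A) (tensorHom f (𝟙 (B ⊗ₛ (C ⊗ₛ D)))) ≫ shuffle A U' B (C ⊗ₛ D) ≫
      assocInv U' (A ⊗ₛ B) (C ⊗ₛ D) ≫ assocInv (U' ⊗ₛ (A ⊗ₛ B)) C D := by
  refine ext_hasSign_left fun a σ ha u b c d => ?_
  change (assocInv U' (A ⊗ₛ B) C).lin
      ((shuffle A U' B C).lin (a ⊗ₜ[ℂ] (f.lin u ⊗ₜ[ℂ] (b ⊗ₜ[ℂ] c)))) ⊗ₜ[ℂ] d =
    (assocInv U' (A ⊗ₛ B) (C ⊗ₛ D) ≫ assocInv (U' ⊗ₛ (A ⊗ₛ B)) C D).lin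
      ((shuffle A U' B (C ⊗ₛ D)).lin (a ⊗ₜ[ℂ] (f.lin u ⊗ₜ[ℂ] (b ⊗ₜ[ℂ] (c ⊗ₜ[ℂ] d)))))
  rw [ha.shuffle_tmul, ha.shuffle_tmul]
  rfl

/-- The permutations in the pentagon for the degrees `1101`. -/
lemma coh₁₁₀₁ : tensorHom (𝟙 A) (tensorHom (𝟙 U) (assocInv B C D)) ≫
    tensorHom (𝟙 A) (tensorHom f (𝟙 ((B ⊗ₛ C) ⊗ₛ D))) ≫ shuffle A U' (B ⊗ₛ C) D ≫
    assocInv U' (A ⊗ₛ (B ⊗ₛ C)) D ≫ tensorHom (tensorHom (𝟙 U') (assocInv A B C)) (𝟙 D) ≫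
    tensorHom (assocInv U' (A ⊗ₛ B) C) (𝟙 D) =
    tensorHom (𝟙 A) (tensorHom f (𝟙 (B ⊗ₛ (C ⊗ₛ D)))) ≫ shuffle A U' B (C ⊗ₛ D) ≫
      assocInv U' (A ⊗ₛ B) (C ⊗ₛ D) ≫ assocInv (U' ⊗ₛ (A ⊗ₛ B)) C D := by
  refine ext_hasSign_left fun a σ ha u b c d => ?_
  change (assocInv U' (A ⊗ₛ (B ⊗ₛ C)) D ≫ tensorHom (tensorHom (𝟙 U') (assocInv A B C)) (𝟙 D) ≫
      tensorHom (assocInv U' (A ⊗ₛ B) C) (𝟙 D)).lin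
      ((shuffle A U' (B ⊗ₛ C) D).lin (a ⊗ₜ[ℂ] (f.lin u ⊗ₜ[ℂ] ((b ⊗ₜ[ℂ] c) ⊗ₜ[ℂ] d)))) =
    (assocInv U' (A ⊗ₛ B) (C ⊗ₛ D) ≫ assocInv (U' ⊗ₛ (A ⊗ₛ B)) C D).lin
      ((shuffle A U' B (C ⊗ₛ D)).lin (a ⊗ₜ[ℂ] (f.lin u ⊗ₜ[ℂ] (b ⊗ₜ[ℂ] (c ⊗ₜ[ℂ] d)))))
  rw [ha.shuffle_tmul, ha.shuffle_tmul]
  rfl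

end coherence

end SuperVect

/-! ### Pentagon identities -/

namespace OddOps
open SuperVect
variable {h : Type u} [AddCommGroup h] [Module ℂ h]

/-- Maps out of a tensor product with two factors `U(h)` are determined by the way they intertwine
left multiplication on these factors, and by their values for the entries `1` there. -/
lemma env_env_tensor_ext {A B C D Y : SuperVect.{u}}
    {f g : HRep.envSpace h ⊗ₛ (A ⊗ₛ (B ⊗ₛ (HRep.envSpace h ⊗ₛ (C ⊗ₛ D)))) ⟶ Y}
    (T₁ T₂ : OddOps h Y)
    (hf₁ : Intertwines f ((HRep.leftMul h).onLeft _) T₁)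
    (hg₁ : Intertwines g ((HRep.leftMul h).onLeft _) T₁)
    (hf₂ : Intertwines f (onRight _ (onRight A (onRight B ((HRep.leftMul h).onLeft _)))) T₂)
    (hg₂ : Intertwines g (onRight _ (onRight A (onRight B ((HRep.leftMul h).onLeft _)))) T₂)
    (H : ∀ a b c d, f.lin ((1 : ExteriorAlgebra ℂ h) ⊗ₜ[ℂ]
        (a ⊗ₜ[ℂ] (b ⊗ₜ[ℂ] ((1 : ExteriorAlgebra ℂ h) ⊗ₜ[ℂ] (c ⊗ₜ[ℂ] d))))) =
      g.lin ((1 : ExteriorAlgebra ℂ h) ⊗ₜ[ℂ]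
        (a ⊗ₜ[ℂ] (b ⊗ₜ[ℂ] ((1 : ExteriorAlgebra ℂ h) ⊗ₜ[ℂ] (c ⊗ₜ[ℂ] d)))))) : f = g := by
  have H : ∀ a b x, f.lin ((1 : ExteriorAlgebra ℂ h) ⊗ₜ[ℂ]
        (a ⊗ₜ[ℂ] (b ⊗ₜ[ℂ] ((1 : ExteriorAlgebra ℂ h) ⊗ₜ[ℂ] x)))) =
      g.lin ((1 : ExteriorAlgebra ℂ h) ⊗ₜ[ℂ]
        (a ⊗ₜ[ℂ] (b ⊗ₜ[ℂ] ((1 : ExteriorAlgebra ℂ h) ⊗ₜ[ℂ] x)))) := fun a b x => by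
    refine LinearMap.congr_fun (TensorProduct.ext' fun c d => H a b c d :
      f.lin ∘ₗ TensorProduct.mk ℂ (HRep.envSpace h) _ (1 : ExteriorAlgebra ℂ h) ∘ₗ
        TensorProduct.mk ℂ A _ a ∘ₗ TensorProduct.mk ℂ B _ b ∘ₗ
          TensorProduct.mk ℂ (HRep.envSpace h) (C ⊗ₛ D) (1 : ExteriorAlgebra ℂ h) =
      g.lin ∘ₗ TensorProduct.mk ℂ (HRep.envSpace h) _ (1 : ExteriorAlgebra ℂ h) ∘ₗ
        TensorProduct.mk ℂ A _ a ∘ₗ TensorProduct.mk ℂ B _ b ∘ₗ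
          TensorProduct.mk ℂ (HRep.envSpace h) (C ⊗ₛ D) (1 : ExteriorAlgebra ℂ h)) x
  have key : ∀ (f : HRep.envSpace h ⊗ₛ (A ⊗ₛ (B ⊗ₛ (HRep.envSpace h ⊗ₛ (C ⊗ₛ D)))) ⟶ Y),
      Intertwines f (onRight _ (onRight A (onRight B ((HRep.leftMul h).onLeft _)))) T₂ →
      ∀ (v : h) (u : ExteriorAlgebra ℂ h) (a : A) (b : B) (x : C ⊗ₛ D),
        f.lin ((1 : ExteriorAlgebra ℂ h) ⊗ₜ[ℂ]
            (a ⊗ₜ[ℂ] (b ⊗ₜ[ℂ] ((ExteriorAlgebra.ι ℂ v * u) ⊗ₜ[ℂ] x)))) =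
          T₂.lin v (f.lin ((1 : ExteriorAlgebra ℂ h) ⊗ₜ[ℂ]
            (A.parity a ⊗ₜ[ℂ] (B.parity b ⊗ₜ[ℂ] (u ⊗ₜ[ℂ] x))))) := by
    intro f hf v u a b x
    rw [← hf.comm, onRight_tmul, onRight_tmul, onRight_tmul, SuperVect.parity_parity,
      SuperVect.parity_parity, (HRep.envSpace h).parity_of_even OddMetric.one_mem_even]
    rfl
  have main : ∀ (u : ExteriorAlgebra ℂ h) (a : A) (b : B) (x : C ⊗ₛ D),
      f.lin ((1 : ExteriorAlgebra ℂ h) ⊗ₜ[ℂ] (a ⊗ₜ[ℂ] (b ⊗ₜ[ℂ] (u ⊗ₜ[ℂ] x)))) =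
        g.lin ((1 : ExteriorAlgebra ℂ h) ⊗ₜ[ℂ] (a ⊗ₜ[ℂ] (b ⊗ₜ[ℂ] (u ⊗ₜ[ℂ] x)))) := by
    intro u
    induction u using CliffordAlgebra.left_induction with
    | algebraMap r =>
      intro a b x
      have e : ((algebraMap ℂ (ExteriorAlgebra ℂ h) r) ⊗ₜ[ℂ] x :
            ExteriorAlgebra ℂ h ⊗[ℂ] (C ⊗[ℂ] D)) =
          (1 : ExteriorAlgebra ℂ h) ⊗ₜ[ℂ] (r • x) := by
        rw [Algebra.algebraMap_eq_smul_one, smul_tmul]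
      exact (congrArg (fun z => f.lin ((1 : ExteriorAlgebra ℂ h) ⊗ₜ[ℂ] (a ⊗ₜ[ℂ] (b ⊗ₜ[ℂ] z))))
        e).trans ((H a b (r • x)).trans (congrArg (fun z =>
          g.lin ((1 : ExteriorAlgebra ℂ h) ⊗ₜ[ℂ] (a ⊗ₜ[ℂ] (b ⊗ₜ[ℂ] z)))) e).symm)
    | add u w hu hw =>
      intro a b x
      have e : ∀ f : HRep.envSpace h ⊗ₛ (A ⊗ₛ (B ⊗ₛ (HRep.envSpace h ⊗ₛ (C ⊗ₛ D)))) ⟶ Y,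
          f.lin ((1 : ExteriorAlgebra ℂ h) ⊗ₜ[ℂ] (a ⊗ₜ[ℂ] (b ⊗ₜ[ℂ] ((u + w) ⊗ₜ[ℂ] x)))) =
            f.lin ((1 : ExteriorAlgebra ℂ h) ⊗ₜ[ℂ] (a ⊗ₜ[ℂ] (b ⊗ₜ[ℂ] (u ⊗ₜ[ℂ] x)))) +
            f.lin ((1 : ExteriorAlgebra ℂ h) ⊗ₜ[ℂ] (a ⊗ₜ[ℂ] (b ⊗ₜ[ℂ] (w ⊗ₜ[ℂ] x)))) := fun f => by
        rw [← map_add, ← tmul_add, ← tmul_add, ← tmul_add, ← add_tmul]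
      exact (e f).trans ((congrArg₂ (· + ·) (hu a b x) (hw a b x)).trans (e g).symm)
    | ι_mul u v hu =>
      intro a b x
      refine (key f hf₂ v u a b x).trans (Eq.trans ?_ (key g hg₂ v u a b x).symm)
      rw [hu]
  refine env_tensor_ext T₁ hf₁ hg₁ fun y => ?_
  refine LinearMap.congr_fun (TensorProduct.ext_threefold'
    (g := f.lin ∘ₗ TensorProduct.mk ℂ (HRep.envSpace h) _ (1 : ExteriorAlgebra ℂ h))
    (h := g.lin ∘ₗ TensorProduct.mk ℂ (HRep.envSpace h) _ (1 : ExteriorAlgebra ℂ h))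
    fun a b z => ?_) y
  exact LinearMap.congr_fun (TensorProduct.ext' fun u x => main u a b x :
    f.lin ∘ₗ TensorProduct.mk ℂ (HRep.envSpace h) _ (1 : ExteriorAlgebra ℂ h) ∘ₗ
        TensorProduct.mk ℂ A _ a ∘ₗ TensorProduct.mk ℂ B (HRep.envSpace h ⊗ₛ (C ⊗ₛ D)) b =
      g.lin ∘ₗ TensorProduct.mk ℂ (HRep.envSpace h) _ (1 : ExteriorAlgebra ℂ h) ∘ₗ
        TensorProduct.mk ℂ A _ a ∘ₗ TensorProduct.mk ℂ B (HRep.envSpace h ⊗ₛ (C ⊗ₛ D)) b) z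

end OddOps

namespace OddMetric
open OddOps SuperVect
variable {h : Type u} [AddCommGroup h] [Module ℂ h] [FiniteDimensional ℂ h] (S : OddMetric h)

section
variable {V V' W W' X Y Z : SuperVect.{u}} (c : ℂ)

lemma assocInv_expOmega (P Q : OddOps h ((V ⊗ₛ W) ⊗ₛ X)) {P₀ Q₀ : OddOps h (V ⊗ₛ (W ⊗ₛ X))}
    [Intertwines (assocInv V W X) P₀ P] [Intertwines (assocInv V W X) Q₀ Q] [SuperCommute P₀ P₀]
    [SuperCommute P₀ Q₀] [SuperCommute Q₀ Q₀] [SuperCommute P P] [SuperCommute P Q]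
    [SuperCommute Q Q] (g : _ ⟶ Z) :
    assocInv V W X ≫ S.expOmega c P Q ≫ g = S.expOmega c P₀ Q₀ ≫ assocInv V W X ≫ g :=
  S.comp_expOmega_assoc _ c P Q g

lemma tensorHom_expOmega {f : V ⟶ V'} {k : W ⟶ W'} (P Q : OddOps h (V' ⊗ₛ W'))
    {P₀ Q₀ : OddOps h (V ⊗ₛ W)}
    [Intertwines (tensorHom f k) P₀ P] [Intertwines (tensorHom f k) Q₀ Q] [SuperCommute P₀ P₀]
    [SuperCommute P₀ Q₀] [SuperCommute Q₀ Q₀] [SuperCommute P P] [SuperCommute P Q]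
    [SuperCommute Q Q] (g : _ ⟶ Z) :
    tensorHom f k ≫ S.expOmega c P Q ≫ g = S.expOmega c P₀ Q₀ ≫ tensorHom f k ≫ g :=
  S.comp_expOmega_assoc _ c P Q g

lemma shuffle_expOmega (P Q : OddOps h (W ⊗ₛ ((V ⊗ₛ X) ⊗ₛ Y)))
    {P₀ Q₀ : OddOps h (V ⊗ₛ (W ⊗ₛ (X ⊗ₛ Y)))}
    [Intertwines (shuffle V W X Y) P₀ P] [Intertwines (shuffle V W X Y) Q₀ Q] [SuperCommute P₀ P₀]
    [SuperCommute P₀ Q₀] [SuperCommute Q₀ Q₀] [SuperCommute P P] [SuperCommute P Q]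
    [SuperCommute Q Q] (g : _ ⟶ Z) :
    shuffle V W X Y ≫ S.expOmega c P Q ≫ g = S.expOmega c P₀ Q₀ ≫ shuffle V W X Y ≫ g :=
  S.comp_expOmega_assoc _ c P Q g

lemma expOmega_commute_assoc (d : ℂ) (P Q R T : OddOps h V) [SuperCommute P P] [SuperCommute P Q]
    [SuperCommute Q Q] [SuperCommute P R] [SuperCommute P T] [SuperCommute Q R] [SuperCommute Q T]
    [SuperCommute R R] [SuperCommute R T] [SuperCommute T T] (g : V ⟶ Z) :
    S.expOmega c P Q ≫ S.expOmega d R T ≫ g = S.expOmega d R T ≫ S.expOmega c P Q ≫ g := by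
  rw [← Category.assoc, expOmega_commute, Category.assoc]

end

section
variable {X Z : SuperVect.{u}} (P : OddOps h X) (Q : OddOps h Z) (B C : SuperVect.{u})

/-- The underlying map of the associator `α_{A,B,C}` of `A, C ∈ C₀` and `B ∈ C₁`; like the other
maps below, it depends on objects of `C₀` only through the families of operators on them. -/
def alpha₀₁₀ : X ⊗ₛ (B ⊗ₛ Z) ⟶ (X ⊗ₛ B) ⊗ₛ Z :=
  S.expOmega (Real.pi * Complex.I) (P.onLeft _) (onRight X (onRight B Q)) ≫ assocInv X B Z

/-- The underlying map of the associator `α_{A,B,C}` of `A, C ∈ C₁` and `B ∈ C₀`. -/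
def alpha₁₀₁ : HRep.envSpace h ⊗ₛ (B ⊗ₛ (X ⊗ₛ C)) ⟶ HRep.envSpace h ⊗ₛ ((B ⊗ₛ X) ⊗ₛ C) :=
  S.expOmega (Real.pi * Complex.I) ((HRep.leftMul h).onLeft _)
    (onRight (HRep.envSpace h) (onRight B (P.onLeft C))) ≫
    tensorHom (𝟙 (HRep.envSpace h)) (assocInv B X C)

/-- The underlying map of the associator `α_{A,B,C}` of `A ∈ C₀` and `B, C ∈ C₁`. -/
def alpha₀₁₁ : X ⊗ₛ (HRep.envSpace h ⊗ₛ (B ⊗ₛ C)) ⟶ HRep.envSpace h ⊗ₛ ((X ⊗ₛ B) ⊗ₛ C) :=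
  S.expOmega (-1) (onRight X (S.deriv.onLeft (B ⊗ₛ C))) (P.onLeft _) ≫
    shuffle X (HRep.envSpace h) B C

/-- The underlying map of the associator `α_{A,B,C}` of `A, B ∈ C₁` and `C ∈ C₀`. -/
def alpha₁₁₀ : HRep.envSpace h ⊗ₛ (B ⊗ₛ (C ⊗ₛ X)) ⟶ (HRep.envSpace h ⊗ₛ (B ⊗ₛ C)) ⊗ₛ X :=
  S.expOmega 1 (S.deriv.onLeft _) (onRight (HRep.envSpace h) (onRight B (onRight C P))) ≫
    tensorHom (𝟙 _) (assocInv B C X) ≫ assocInv (HRep.envSpace h) (B ⊗ₛ C) X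

/-- The underlying map of the associator `α_{A,B,C}` of `A, B, C ∈ C₁`. -/
def alpha₁₁₁ (A : SuperVect.{u}) :
    A ⊗ₛ (HRep.envSpace h ⊗ₛ (B ⊗ₛ C)) ⟶ (HRep.envSpace h ⊗ₛ (A ⊗ₛ B)) ⊗ₛ C :=
  tensorHom (𝟙 A) (tensorHom S.phi (𝟙 (B ⊗ₛ C))) ≫ shuffle A (HRep.envSpace h) B C ≫
    assocInv (HRep.envSpace h) (A ⊗ₛ B) C

end

section pentagon

variable {A B C D : SuperVect.{u}} (P : OddOps h A) (Q : OddOps h B) (R : OddOps h C)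
  (T : OddOps h D) [SuperCommute P P] [SuperCommute Q Q] [SuperCommute R R] [SuperCommute T T]

lemma pentagon₀₀₁₀ : tensorHom (𝟙 A) (S.alpha₀₁₀ Q T C) ≫ S.alpha₀₁₀ P T (B ⊗ₛ C) ≫
    tensorHom (assocInv A B C) (𝟙 D) =
      assocInv A B (C ⊗ₛ D) ≫ S.alpha₀₁₀ (P.onLeft B + onRight A Q) T C := by
  simp only [alpha₀₁₀, tensorHom_id_comp, tensorHom_id_expOmega, Category.assoc, assocInv_expOmega,
    tensorHom_expOmega, onLeft_add, expOmega_add_left, assocInv_pentagon]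
  rw [expOmega_commute_assoc]

lemma pentagon₀₁₀₀ : tensorHom (𝟙 A) (assocInv B C D) ≫ S.alpha₀₁₀ P T (B ⊗ₛ C) ≫
    tensorHom (S.alpha₀₁₀ P R B) (𝟙 D) =
      S.alpha₀₁₀ P (R.onLeft D + onRight C T) B ≫ assocInv (A ⊗ₛ B) C D := by
  simp only [alpha₀₁₀, tensorHom_comp_id, tensorHom_expOmega_id, Category.assoc, assocInv_expOmega,
    tensorHom_expOmega, onRight_add, expOmega_add_right, assocInv_pentagon]
  rw [expOmega_commute_assoc]

lemma pentagon₁₀₀₁ : tensorHom (𝟙 _) (tensorHom (𝟙 A) (assocInv B C D)) ≫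
    S.alpha₁₀₁ (Q.onLeft C + onRight B R) A D ≫
    tensorHom (𝟙 _) (tensorHom (assocInv A B C) (𝟙 D)) =
      S.alpha₁₀₁ Q A (C ⊗ₛ D) ≫ S.alpha₁₀₁ R (A ⊗ₛ B) D := by
  simp only [alpha₁₀₁, Category.assoc, onLeft_add, tensorHom_expOmega, onRight_add,
    expOmega_add_right, ← tensorHom_id_comp, assocInv_pentagon]

lemma pentagon₀₀₁₁ : tensorHom (𝟙 A) (S.alpha₀₁₁ Q C D) ≫ S.alpha₀₁₁ P (B ⊗ₛ C) D ≫
    tensorHom (𝟙 _) (tensorHom (assocInv A B C) (𝟙 D)) =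
      assocInv A B (_ ⊗ₛ (C ⊗ₛ D)) ≫ S.alpha₀₁₁ (P.onLeft B + onRight A Q) C D := by
  simp only [alpha₀₁₁, tensorHom_id_comp, tensorHom_id_expOmega, Category.assoc, assocInv_expOmega,
    tensorHom_expOmega, onLeft_add, expOmega_add_right, coh₀₀₁₁]
  rw [expOmega_commute_assoc]

lemma pentagon₁₁₀₀ : tensorHom (𝟙 _) (tensorHom (𝟙 A) (assocInv B C D)) ≫
    S.alpha₁₁₀ T A (B ⊗ₛ C) ≫ tensorHom (S.alpha₁₁₀ R A B) (𝟙 D) =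
      S.alpha₁₁₀ (R.onLeft D + onRight C T) A B ≫ assocInv (_ ⊗ₛ (A ⊗ₛ B)) C D := by
  simp only [alpha₁₁₀, tensorHom_comp_id, tensorHom_expOmega_id, Category.assoc, assocInv_expOmega,
    tensorHom_expOmega, onRight_add, expOmega_add_right]
  rw [expOmega_commute_assoc]
  congr 2
  exact ext_fivefold fun _ _ _ _ _ => rfl

lemma pentagon₀₁₁₀ : tensorHom (𝟙 A) (S.alpha₁₁₀ T B C) ≫ assocInv A (_ ⊗ₛ (B ⊗ₛ C)) D ≫
    tensorHom (S.alpha₀₁₁ P B C) (𝟙 D) = S.alpha₀₁₁ P B (C ⊗ₛ D) ≫ S.alpha₁₁₀ T (A ⊗ₛ B) C := by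
  simp only [alpha₁₁₀, alpha₀₁₁, tensorHom_id_comp, tensorHom_id_expOmega, tensorHom_comp_id,
    tensorHom_expOmega_id, Category.assoc, assocInv_expOmega, tensorHom_expOmega, shuffle_expOmega]
  rw [expOmega_commute_assoc, coh₀₁₁₀]

lemma pentagon₁₀₁₀ : tensorHom (𝟙 _) (tensorHom (𝟙 A) (S.alpha₀₁₀ Q T C)) ≫
    S.alpha₁₁₀ T A (B ⊗ₛ C) ≫ tensorHom (S.alpha₁₀₁ Q A C) (𝟙 D) =
      S.alpha₁₀₁ Q A (C ⊗ₛ D) ≫ S.alpha₁₁₀ T (A ⊗ₛ B) C := by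
  simp only [alpha₁₁₀, alpha₁₀₁, alpha₀₁₀, tensorHom_id_comp, tensorHom_id_expOmega,
    tensorHom_comp_id, tensorHom_expOmega_id, Category.assoc, assocInv_expOmega, tensorHom_expOmega]
  -- Conjugation with the exponential of the `110` associator shifts left multiplication by the
  -- action on `D`; this produces the exponential of the `010` associator.
  rw [S.comp_expOmega_assoc (S.expOmega 1 _ _) _ ((HRep.leftMul h).onLeft _),
    expOmega_add_left, expOmega_smul_left, Category.assoc,
    S.expOmega_symm _ (onRight _ (onRight A (onRight B (onRight C T)))),
    expOmega_commute_assoc _ _ _ ((HRep.leftMul h).onLeft _), expOmega_comp_assoc,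
    mul_one, mul_neg_one, add_neg_cancel, expOmega_zero, Category.id_comp]
  exact congrArg (_ ≫ ·) (congrArg (_ ≫ ·) (ext_fivefold fun _ _ _ _ _ => rfl))

lemma pentagon₀₁₀₁ : tensorHom (𝟙 A) (S.alpha₁₀₁ R B D) ≫
    S.alpha₀₁₁ P (B ⊗ₛ C) D ≫ tensorHom (𝟙 _) (tensorHom (S.alpha₀₁₀ P R B) (𝟙 D)) =
      S.alpha₀₁₁ P B (C ⊗ₛ D) ≫ S.alpha₁₀₁ R (A ⊗ₛ B) D := by
  simp only [alpha₀₁₁, alpha₁₀₁, alpha₀₁₀, tensorHom_id_comp, tensorHom_id_expOmega,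
    tensorHom_comp_id, tensorHom_expOmega_id, Category.assoc, tensorHom_expOmega, shuffle_expOmega]
  -- Conjugation with the exponential of the `011` associator shifts left multiplication by the
  -- action on `A`; this produces the exponential of the `010` associator.
  rw [S.comp_expOmega_assoc (S.expOmega (-1) _ _) _ (onRight A ((HRep.leftMul h).onLeft _)),
    expOmega_add_left, expOmega_smul_left, coh₀₁₀₁, Category.assoc, mul_one, neg_neg, mul_one,
    expOmega_commute_assoc _ (-1)]

/-- `φ` exchanges the derivations in the `011` associator with the multiplications in the `010`
associator. -/
lemma pentagon₀₁₁₁ : tensorHom (𝟙 A) (S.alpha₁₁₁ C D B) ≫ assocInv A (_ ⊗ₛ (B ⊗ₛ C)) D ≫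
    tensorHom (S.alpha₀₁₁ P B C) (𝟙 D) =
      S.alpha₀₁₀ P ((HRep.leftMul h).onLeft (C ⊗ₛ D)) B ≫ S.alpha₁₁₁ C D (A ⊗ₛ B) := by
  simp only [alpha₀₁₁, alpha₁₁₁, alpha₀₁₀, tensorHom_id_comp, tensorHom_comp_id,
    tensorHom_expOmega_id, Category.assoc, assocInv_expOmega, tensorHom_expOmega, onLeft_smul,
    onRight_smul, expOmega_smul_left, coh₀₁₁₁]
  rw [expOmega_symm, neg_mul_neg, one_mul]

lemma pentagon₁₁₁₀ : tensorHom (𝟙 A) (S.alpha₁₁₀ T B C) ≫ assocInv A (_ ⊗ₛ (B ⊗ₛ C)) D ≫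
    tensorHom (S.alpha₁₁₁ B C A) (𝟙 D) =
      S.alpha₁₁₁ B (C ⊗ₛ D) A ≫ S.alpha₀₁₀ ((HRep.leftMul h).onLeft (A ⊗ₛ B)) T C := by
  simp only [alpha₁₁₀, alpha₁₁₁, alpha₀₁₀, tensorHom_id_comp, tensorHom_id_expOmega,
    tensorHom_comp_id, Category.assoc, assocInv_expOmega, tensorHom_expOmega, shuffle_expOmega,
    onLeft_smul, onRight_smul, expOmega_smul_left, coh₁₁₁₀]
  rw [mul_inv_cancel₀ pi_mul_I_ne_zero]

lemma pentagon₁₀₁₁ : tensorHom (𝟙 A) (S.alpha₀₁₁ Q C D) ≫ S.alpha₁₁₁ (B ⊗ₛ C) D A ≫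
    tensorHom (S.alpha₁₀₁ Q A C) (𝟙 D) =
      assocInv A B (_ ⊗ₛ (C ⊗ₛ D)) ≫ S.alpha₁₁₁ C D (A ⊗ₛ B) := by
  simp only [alpha₀₁₁, alpha₁₁₁, alpha₁₀₁, tensorHom_id_comp, tensorHom_id_expOmega,
    tensorHom_comp_id, tensorHom_expOmega_id, Category.assoc, assocInv_expOmega, tensorHom_expOmega,
    shuffle_expOmega, onLeft_smul, onRight_smul, expOmega_smul_left, coh₁₀₁₁]
  rw [mul_inv_cancel₀ pi_mul_I_ne_zero, expOmega_comp_assoc, neg_add_cancel, expOmega_zero,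
    Category.id_comp]

lemma pentagon₁₁₀₁ : tensorHom (𝟙 A) (S.alpha₁₀₁ R B D) ≫ S.alpha₁₁₁ (B ⊗ₛ C) D A ≫
    tensorHom (S.alpha₁₁₀ R A B) (𝟙 D) =
      S.alpha₁₁₁ B (C ⊗ₛ D) A ≫ assocInv (_ ⊗ₛ (A ⊗ₛ B)) C D := by
  simp only [alpha₁₁₀, alpha₁₁₁, alpha₁₀₁, tensorHom_id_comp, tensorHom_id_expOmega,
    tensorHom_comp_id, tensorHom_expOmega_id, Category.assoc, assocInv_expOmega, tensorHom_expOmega,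
    shuffle_expOmega, onLeft_smul, onRight_smul, expOmega_smul_left, coh₁₁₀₁]
  rw [one_mul, expOmega_comp_assoc, add_neg_cancel, expOmega_zero, Category.id_comp]

/-- The Fourier transform of a constant is a multiple of the volume form. -/
lemma leftMul_phi_one (a : h) :
    (HRep.leftMul h).lin a (S.phi.lin (1 : ExteriorAlgebra ℂ h)) = 0 := by
  rw [← S.intertwines_phi_leftMul.comm, smul_lin, LinearMap.smul_apply, deriv_one, smul_zero,
    map_zero]

lemma phi_one_mem_even : S.phi.lin (1 : ExteriorAlgebra ℂ h) ∈ (HRep.envSpace h).even :=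
  S.phi.map_even _ one_mem_even

lemma alpha₁₁₁_tmul (a : A) {u : HRep.envSpace h} (hu : u ∈ (HRep.envSpace h).even) (b : B)
    (c : C) : (S.alpha₁₁₁ B C A).lin (a ⊗ₜ[ℂ] (u ⊗ₜ[ℂ] (b ⊗ₜ[ℂ] c))) =
      (S.phi.lin u ⊗ₜ[ℂ] (a ⊗ₜ[ℂ] b)) ⊗ₜ[ℂ] c := by
  change (assocInv (HRep.envSpace h) (A ⊗ₛ B) C).lin
    ((shuffle A (HRep.envSpace h) B C).lin (a ⊗ₜ[ℂ] (S.phi.lin u ⊗ₜ[ℂ] (b ⊗ₜ[ℂ] c)))) = _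
  rw [shuffle_tmul_of_even _ _ _ (S.phi.map_even _ hu)]
  rfl

/-- Here the exponentials on the two sides involve the canonically conjugate operators on both
factors `U(h)`, and `φ` occurs twice on one side only. Both sides transform in the same way under
left multiplication on either factor `U(h)` of the source, so they are compared at `1` in these
factors, where all exponentials act trivially and `φ² 1 = 1`. -/
lemma pentagon₁₁₁₁ : tensorHom (𝟙 _) (tensorHom (𝟙 A) (S.alpha₁₁₁ C D B)) ≫
    S.alpha₁₀₁ ((HRep.leftMul h).onLeft (B ⊗ₛ C)) A D ≫
    tensorHom (𝟙 _) (tensorHom (S.alpha₁₁₁ B C A) (𝟙 D)) =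
      S.alpha₁₁₀ ((HRep.leftMul h).onLeft (C ⊗ₛ D)) A B ≫
        S.alpha₀₁₁ ((HRep.leftMul h).onLeft (A ⊗ₛ B)) C D := by
  -- The identities between the operators that generate the source.
  have e₁ : ∀ {V : SuperVect.{u}} (X Y : OddOps h V) (s t : ℂ), s = 1 → t = -1 →
      X + (s • Y + t • X) = Y := fun X Y s t hs ht => ext_lin fun v => by
    simp only [add_lin, smul_lin, hs, ht]
    module
  have e₂ : ∀ {V : SuperVect.{u}} (X Y : OddOps h V) (s t s' t' : ℂ), s = -s' → t = -t' →
      X + (s • Y + t • X) + (s' • Y + t' • X) = X := fun X Y s t s' t' hs ht =>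
    ext_lin fun v => by
      simp only [add_lin, smul_lin, hs, ht]
      module
  have e₃ : ∀ {V : SuperVect.{u}} (X Y : OddOps h V) (r s t z : ℂ), r * (s * t) = 1 → z = -1 →
      Y + (r • s • t • X + z • Y) = X := fun X Y r s t z hr hz => ext_lin fun v => by
    simp only [add_lin, smul_lin, smul_smul, hr, hz]
    module
  refine env_env_tensor_ext ((HRep.leftMul h).onLeft _) ((HRep.leftMul h).onLeft _ +
    (-1 : ℂ) • onRight _ ((((HRep.leftMul h).onLeft _).onLeft C).onLeft D)) ?_ ?_ ?_ ?_ ?_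
  · unfold alpha₁₁₁ alpha₁₀₁
    infer_instance
  · unfold alpha₁₁₀ alpha₀₁₁
    refine Intertwines.congr inferInstance ?_
    exact e₁ _ _ _ _ (by norm_num) (by norm_num)
  · unfold alpha₁₁₁ alpha₁₀₁
    rw [S.expOmega_symm]
    refine Intertwines.congr inferInstance ?_
    simp only [onLeft_smul, onRight_smul]
    have hz : (Real.pi * Complex.I : ℂ) ≠ 0 := pi_mul_I_ne_zero
    exact e₃ _ _ _ _ _ _ (by field_simp) (by field_simp)
  · unfold alpha₁₁₀ alpha₀₁₁
    refine Intertwines.congr inferInstance ?_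
    exact e₂ _ _ _ _ _ _ (by norm_num) (by norm_num)
  · intro a b c d
    change (tensorHom (𝟙 (HRep.envSpace h)) (tensorHom (S.alpha₁₁₁ B C A) (𝟙 D))).lin
      ((S.alpha₁₀₁ ((HRep.leftMul h).onLeft (B ⊗ₛ C)) A D).lin ((1 : ExteriorAlgebra ℂ h) ⊗ₜ[ℂ]
        (a ⊗ₜ[ℂ] ((S.alpha₁₁₁ C D B).lin
          (b ⊗ₜ[ℂ] ((1 : ExteriorAlgebra ℂ h) ⊗ₜ[ℂ] (c ⊗ₜ[ℂ] d))))))) =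
      (S.alpha₀₁₁ ((HRep.leftMul h).onLeft (A ⊗ₛ B)) C D).lin
        ((S.alpha₁₁₀ ((HRep.leftMul h).onLeft (C ⊗ₛ D)) A B).lin
          ((1 : ExteriorAlgebra ℂ h) ⊗ₜ[ℂ] (a ⊗ₜ[ℂ]
            (b ⊗ₜ[ℂ] ((1 : ExteriorAlgebra ℂ h) ⊗ₜ[ℂ] (c ⊗ₜ[ℂ] d))))))
    have h1 : (S.alpha₁₀₁ ((HRep.leftMul h).onLeft (B ⊗ₛ C)) A D).lin
        ((1 : ExteriorAlgebra ℂ h) ⊗ₜ[ℂ] (a ⊗ₜ[ℂ]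
          ((S.phi.lin (1 : ExteriorAlgebra ℂ h) ⊗ₜ[ℂ] (b ⊗ₜ[ℂ] c)) ⊗ₜ[ℂ] d))) =
        (1 : ExteriorAlgebra ℂ h) ⊗ₜ[ℂ] ((a ⊗ₜ[ℂ]
          (S.phi.lin (1 : ExteriorAlgebra ℂ h) ⊗ₜ[ℂ] (b ⊗ₜ[ℂ] c))) ⊗ₜ[ℂ] d) := by
      rw [alpha₁₀₁, comp_lin_apply, expOmega_symm, expOmega_apply_of_eq_zero]
      · rfl
      · intro v
        rw [onRight_tmul, onRight_tmul, onLeft_tmul, onLeft_tmul, leftMul_phi_one, zero_tmul,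
          zero_tmul, tmul_zero, tmul_zero]
    have h2 : (S.alpha₁₁₀ ((HRep.leftMul h).onLeft (C ⊗ₛ D)) A B).lin
        ((1 : ExteriorAlgebra ℂ h) ⊗ₜ[ℂ] (a ⊗ₜ[ℂ]
          (b ⊗ₜ[ℂ] ((1 : ExteriorAlgebra ℂ h) ⊗ₜ[ℂ] (c ⊗ₜ[ℂ] d))))) =
        ((1 : ExteriorAlgebra ℂ h) ⊗ₜ[ℂ] (a ⊗ₜ[ℂ] b)) ⊗ₜ[ℂ]
          ((1 : ExteriorAlgebra ℂ h) ⊗ₜ[ℂ] (c ⊗ₜ[ℂ] d)) := by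
      rw [alpha₁₁₀, comp_lin_apply, expOmega_apply_of_eq_zero]
      · rfl
      · intro v
        rw [onLeft_tmul, deriv_one, zero_tmul]
    rw [alpha₁₁₁_tmul _ _ one_mem_even, h1, h2, alpha₀₁₁, comp_lin_apply, expOmega_apply_of_eq_zero,
      shuffle_tmul_of_even _ _ _ one_mem_even]
    · change (1 : ExteriorAlgebra ℂ h) ⊗ₜ[ℂ] ((S.alpha₁₁₁ B C A).lin
        (a ⊗ₜ[ℂ] (S.phi.lin (1 : ExteriorAlgebra ℂ h) ⊗ₜ[ℂ] (b ⊗ₜ[ℂ] c))) ⊗ₜ[ℂ] d) = _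
      rw [alpha₁₁₁_tmul _ _ S.phi_one_mem_even, phi_phi_one]
      rfl
    · intro v
      rw [onRight_tmul, onLeft_tmul, deriv_one, zero_tmul, tmul_zero]

end pentagon
end OddMetric

/-! ### Permutations in the hexagons, inverse associators and braidings -/

namespace SuperVect

/-- The inverse of the permutation `shuffle`. -/
def shuffleInv (A U B C : SuperVect.{u}) : U ⊗ₛ ((A ⊗ₛ B) ⊗ₛ C) ⟶ A ⊗ₛ (U ⊗ₛ (B ⊗ₛ C)) :=
  tensorHom (𝟙 U) (assoc A B C) ≫ assocInv U A (B ⊗ₛ C) ≫ tensorHom (flip U A) (𝟙 (B ⊗ₛ C)) ≫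
    assoc A U (B ⊗ₛ C)

end SuperVect

namespace OddOps
open SuperVect
variable {h : Type u} [AddCommGroup h] [Module ℂ h] (A U B C : SuperVect.{u})

instance (P : OddOps h U) : Intertwines (shuffleInv A U B C)
    (P.onLeft ((A ⊗ₛ B) ⊗ₛ C)) (onRight A (P.onLeft (no_index (B ⊗ₛ C)))) := by
  unfold shuffleInv; infer_instance

instance (P : OddOps h A) : Intertwines (shuffleInv A U B C)
    (onRight U ((P.onLeft B).onLeft C)) (P.onLeft (no_index (U ⊗ₛ (B ⊗ₛ C)))) := by
  unfold shuffleInv; infer_instance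

instance (V : SuperVect.{u}) (z : ℂ) (P : OddOps h V) : Intertwines (scale z V) P P :=
  ⟨fun a v => ((P.lin a).map_smul z v).symm⟩

end OddOps

namespace SuperVect

section

variable {V W X Y : SuperVect.{u}} (z : ℂ)

lemma parityHom_tensor (V W : SuperVect.{u}) :
    (V ⊗ₛ W).parityHom = tensorHom V.parityHom W.parityHom :=
  Hom.ext (parity_tensor V W)

lemma tensorHom_id_scale : tensorHom (𝟙 V) (scale z W) = scale z (V ⊗ₛ W) :=
  Hom.ext (TensorProduct.ext' fun v w => tmul_smul z v w)

lemma tensorHom_scale_id : tensorHom (scale z V) (𝟙 W) = scale z (V ⊗ₛ W) :=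
  Hom.ext (TensorProduct.ext' fun v w => (smul_tmul' z v w).symm)

lemma scale_comp (f : V ⟶ W) : scale z V ≫ f = f ≫ scale z W :=
  Hom.ext (LinearMap.ext fun v => f.lin.map_smul z v)

lemma HasSign.induction {p : V → Prop} (H : ∀ (a : V) (σ : ∀ U : SuperVect.{u}, U ⟶ U),
    HasSign a σ → p a) (hadd : ∀ a b, p a → p b → p (a + b)) (v : V) : p v := by
  obtain ⟨a, ha, b, hb, rfl⟩ := V.exists_add v
  exact hadd a b (H a _ (hasSign_of_even ha)) (H b _ (hasSign_of_odd hb))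

/-- Maps out of a threefold tensor product agree if they do so on pure tensors with homogeneous
outer factors. -/
lemma ext_hasSign_threefold {f g : V ⊗ₛ (W ⊗ₛ X) ⟶ Y}
    (H : ∀ (v : V) (σ : ∀ U : SuperVect.{u}, U ⟶ U) (x : X) (τ : ∀ U : SuperVect.{u}, U ⟶ U),
      HasSign v σ → HasSign x τ → ∀ w,
        f.lin (v ⊗ₜ[ℂ] (w ⊗ₜ[ℂ] x)) = g.lin (v ⊗ₜ[ℂ] (w ⊗ₜ[ℂ] x))) : f = g := by
  refine Hom.ext (TensorProduct.ext_threefold' fun v w x => ?_)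
  refine HasSign.induction
    (p := fun v => f.lin (v ⊗ₜ[ℂ] (w ⊗ₜ[ℂ] x)) = g.lin (v ⊗ₜ[ℂ] (w ⊗ₜ[ℂ] x)))
    (fun v σ hv => ?_) (fun v v' hv hv' => ?_) v
  · refine HasSign.induction
      (p := fun x => f.lin (v ⊗ₜ[ℂ] (w ⊗ₜ[ℂ] x)) = g.lin (v ⊗ₜ[ℂ] (w ⊗ₜ[ℂ] x)))
      (fun x τ hx => H v σ x τ hv hx w) (fun x y hx hy => ?_) x
    rw [tmul_add, tmul_add, map_add, map_add, hx, hy]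
  · rw [add_tmul, map_add, map_add, hv, hv']

/-- Maps out of a fourfold tensor product agree if they do so on pure tensors of homogeneous
vectors. -/
lemma ext_hasSign_fourfold {Z : SuperVect.{u}} {f g : V ⊗ₛ (W ⊗ₛ (X ⊗ₛ Y)) ⟶ Z}
    (H : ∀ (v : V) (υ : ∀ U : SuperVect.{u}, U ⟶ U) (w : W) (σ : ∀ U : SuperVect.{u}, U ⟶ U)
      (x : X) (τ : ∀ U : SuperVect.{u}, U ⟶ U) (y : Y) (ρ : ∀ U : SuperVect.{u}, U ⟶ U),
      HasSign v υ → HasSign w σ → HasSign x τ → HasSign y ρ →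
        f.lin (v ⊗ₜ[ℂ] (w ⊗ₜ[ℂ] (x ⊗ₜ[ℂ] y))) = g.lin (v ⊗ₜ[ℂ] (w ⊗ₜ[ℂ] (x ⊗ₜ[ℂ] y)))) :
    f = g := by
  refine ext_fourfold fun v w x y => ?_
  refine HasSign.induction
    (p := fun v => f.lin (v ⊗ₜ[ℂ] (w ⊗ₜ[ℂ] (x ⊗ₜ[ℂ] y))) =
        g.lin (v ⊗ₜ[ℂ] (w ⊗ₜ[ℂ] (x ⊗ₜ[ℂ] y))))
    (fun v υ hv => ?_) (fun a b ha hb => by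
      rw [add_tmul, map_add, map_add, ha, hb]) v
  refine HasSign.induction
    (p := fun w => f.lin (v ⊗ₜ[ℂ] (w ⊗ₜ[ℂ] (x ⊗ₜ[ℂ] y))) =
        g.lin (v ⊗ₜ[ℂ] (w ⊗ₜ[ℂ] (x ⊗ₜ[ℂ] y))))
    (fun w σ hw => ?_) (fun a b ha hb => by
      rw [add_tmul, tmul_add, map_add, map_add, ha, hb]) w
  refine HasSign.induction
    (p := fun x => f.lin (v ⊗ₜ[ℂ] (w ⊗ₜ[ℂ] (x ⊗ₜ[ℂ] y))) =
        g.lin (v ⊗ₜ[ℂ] (w ⊗ₜ[ℂ] (x ⊗ₜ[ℂ] y))))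
    (fun x τ hx => ?_) (fun a b ha hb => by
      rw [add_tmul, tmul_add, tmul_add, map_add, map_add, ha, hb]) x
  refine HasSign.induction
    (p := fun y => f.lin (v ⊗ₜ[ℂ] (w ⊗ₜ[ℂ] (x ⊗ₜ[ℂ] y))) =
        g.lin (v ⊗ₜ[ℂ] (w ⊗ₜ[ℂ] (x ⊗ₜ[ℂ] y))))
    (fun y ρ hy => H v υ w σ x τ y ρ hv hw hx hy) (fun a b ha hb => by
      rw [tmul_add, tmul_add, tmul_add, map_add, map_add, ha, hb]) y

lemma assoc_comp_assocInv (V W X : SuperVect.{u}) : assoc V W X ≫ assocInv V W X = 𝟙 _ :=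
  Hom.ext (TensorProduct.ext_threefold fun _ _ _ => rfl)

lemma assocInv_comp_assoc (V W X : SuperVect.{u}) : assocInv V W X ≫ assoc V W X = 𝟙 _ :=
  Hom.ext (TensorProduct.ext_threefold' fun _ _ _ => rfl)

lemma assocInv_comp_assoc_assoc (V W X : SuperVect.{u}) (f : V ⊗ₛ (W ⊗ₛ X) ⟶ Y) :
    assocInv V W X ≫ assoc V W X ≫ f = f :=
  Hom.ext (TensorProduct.ext_threefold' fun _ _ _ => rfl)

lemma HasSign.shuffleInv_tmul {A : SuperVect.{u}} {a : A} {σ : ∀ U : SuperVect.{u}, U ⟶ U}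
    (ha : HasSign a σ) {U B C : SuperVect.{u}} (u : U) (b : B) (c : C) :
    (shuffleInv A U B C).lin (u ⊗ₜ[ℂ] ((a ⊗ₜ[ℂ] b) ⊗ₜ[ℂ] c)) =
      a ⊗ₜ[ℂ] ((σ U).lin u ⊗ₜ[ℂ] (b ⊗ₜ[ℂ] c)) := by
  change (assoc A U (B ⊗ₛ C)).lin ((flip U A).lin (u ⊗ₜ[ℂ] a) ⊗ₜ[ℂ] (b ⊗ₜ[ℂ] c)) = _
  rw [ha.flip_tmul_right]
  rfl

end

section coherence

variable (A B C U : SuperVect.{u})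

/-- The hexagon identity of the super-flip, with a tensor product as the right factor. -/
lemma flip_tensor_right : assocInv A B C ≫ tensorHom (flip A B) (𝟙 C) ≫ assoc B A C ≫
    tensorHom (𝟙 B) (flip A C) ≫ assocInv B C A = flip A (B ⊗ₛ C) := by
  refine ext_hasSign_threefold fun a σ c τ ha hc b => ?_
  change (assoc B A C ≫ tensorHom (𝟙 B) (flip A C) ≫ assocInv B C A).lin
    ((flip A B).lin (a ⊗ₜ[ℂ] b) ⊗ₜ[ℂ] c) = (flip A (B ⊗ₛ C)).lin (a ⊗ₜ[ℂ] (b ⊗ₜ[ℂ] c))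
  rw [ha.flip_tmul, ha.flip_tmul, ha.tmul]
  change (assocInv B C A).lin ((σ B).lin b ⊗ₜ[ℂ] (flip A C).lin (a ⊗ₜ[ℂ] c)) = _
  rw [ha.flip_tmul]
  rfl

/-- The permutations in the first hexagon for the degrees `100`. -/
lemma coh₁₀₀ : assocInv A B C ≫ tensorHom (tensorHom (𝟙 A) B.parityHom) (𝟙 C) ≫
    tensorHom (flip A B) (𝟙 C) ≫ assoc B A C ≫ tensorHom (𝟙 B) (tensorHom (𝟙 A) C.parityHom) ≫
    tensorHom (𝟙 B) (flip A C) ≫ assocInv B C A =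
      tensorHom (𝟙 A) (tensorHom B.parityHom C.parityHom) ≫ flip A (B ⊗ₛ C) := by
  rw [← flip_tensor_right]
  exact ext_hasSign_threefold fun a σ c τ ha hc b => by
    change (assoc B A C ≫ tensorHom (𝟙 B) (tensorHom (𝟙 A) C.parityHom) ≫
      tensorHom (𝟙 B) (flip A C) ≫ assocInv B C A).lin
        ((flip A B).lin (a ⊗ₜ[ℂ] B.parity b) ⊗ₜ[ℂ] c) =
      (assoc B A C ≫ tensorHom (𝟙 B) (flip A C) ≫ assocInv B C A).lin
        ((flip A B).lin (a ⊗ₜ[ℂ] B.parity b) ⊗ₜ[ℂ] C.parity c)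
    rw [ha.flip_tmul]
    rfl

/-- The permutations in the first hexagon for the degrees `011`. -/
lemma coh₀₁₁ : shuffle A U B C ≫ tensorHom (𝟙 U) (tensorHom (flip A B) (𝟙 C)) ≫
    tensorHom (𝟙 U) (assoc B A C) ≫ tensorHom (𝟙 U) (tensorHom (𝟙 B) (flip A C)) ≫
    tensorHom (𝟙 U) (assocInv B C A) ≫ assocInv U (B ⊗ₛ C) A = flip A (U ⊗ₛ (B ⊗ₛ C)) := by
  rw [← flip_tensor_right]
  simp only [← flip_tensor_right A B C, tensorHom_id_comp]
  exact ext_fourfold fun a u b c => rfl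

/-- The permutations in the first hexagon for the degrees `101`. -/
lemma coh₁₀₁ : tensorHom (𝟙 U) (assocInv A B C) ≫
    tensorHom (𝟙 U) (tensorHom (tensorHom (𝟙 A) B.parityHom) (𝟙 C)) ≫
    tensorHom (𝟙 U) (tensorHom (flip A B) (𝟙 C)) ≫ shuffleInv B U A C ≫
    tensorHom (𝟙 B) (tensorHom (𝟙 U) (tensorHom (𝟙 A) C.parityHom)) ≫
    tensorHom (𝟙 B) (tensorHom (𝟙 U) (flip A C)) ≫ shuffle B U C A =
      tensorHom (𝟙 U) (tensorHom (𝟙 A) (tensorHom B.parityHom C.parityHom)) ≫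
        tensorHom (𝟙 U) (flip A (B ⊗ₛ C)) := by
  refine ext_hasSign_fourfold fun u _ a σ b τ c ρ _ ha hb hc => ?_
  have hb' : HasSign ((σ B).lin (B.parity b)) τ := (hb.apply B.parityHom).apply (σ B)
  change (shuffleInv B U A C ≫
    tensorHom (𝟙 B) (tensorHom (𝟙 U) (tensorHom (𝟙 A) C.parityHom)) ≫
    tensorHom (𝟙 B) (tensorHom (𝟙 U) (flip A C)) ≫ shuffle B U C A).lin
      (u ⊗ₜ[ℂ] ((flip A B).lin (a ⊗ₜ[ℂ] B.parity b) ⊗ₜ[ℂ] c)) =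
    u ⊗ₜ[ℂ] (flip A (B ⊗ₛ C)).lin (a ⊗ₜ[ℂ] (B.parity b ⊗ₜ[ℂ] C.parity c))
  rw [ha.flip_tmul, ha.flip_tmul, ha.tmul, comp_lin_apply, hb'.shuffleInv_tmul]
  change (shuffle B U C A).lin ((σ B).lin (B.parity b) ⊗ₜ[ℂ]
    ((τ U).lin u ⊗ₜ[ℂ] (flip A C).lin (a ⊗ₜ[ℂ] C.parity c))) = _
  rw [ha.flip_tmul, hb'.shuffle_tmul, hb.invol]
  rfl

/-- The permutations in the first hexagon for the degrees `110`. -/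
lemma coh₁₁₀ : tensorHom (𝟙 U) (assocInv A B C) ≫ assocInv U (A ⊗ₛ B) C ≫
    tensorHom (tensorHom (𝟙 U) (tensorHom (𝟙 A) B.parityHom)) (𝟙 C) ≫
    tensorHom (tensorHom (𝟙 U) (flip A B)) (𝟙 C) ≫ assoc U (B ⊗ₛ A) C ≫
    tensorHom (𝟙 U) (assoc B A C) ≫
    tensorHom (𝟙 U) (tensorHom (𝟙 B) (tensorHom (𝟙 A) C.parityHom)) ≫
    tensorHom (𝟙 U) (tensorHom (𝟙 B) (flip A C)) ≫ tensorHom (𝟙 U) (assocInv B C A) =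
      tensorHom (𝟙 U) (tensorHom (𝟙 A) (tensorHom B.parityHom C.parityHom)) ≫
        tensorHom (𝟙 U) (flip A (B ⊗ₛ C)) := by
  have := congrArg (tensorHom (𝟙 U)) (coh₁₀₀ A B C)
  simp only [tensorHom_id_comp] at this
  rw [← this]
  exact ext_fourfold fun u a b c => rfl

/-- The permutations in the second hexagon for the degrees `000`. -/
lemma coh_reverse₀₀₀ : assocInv A B C ≫ flip (A ⊗ₛ B) C ≫ assocInv C A B =
    tensorHom (𝟙 A) (flip B C) ≫ assocInv A C B ≫ tensorHom (flip A C) (𝟙 B) := by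
  simp only [flip_tensor_left, Category.assoc, assocInv_comp_assoc_assoc, assoc_comp_assocInv,
    Category.comp_id]

/-- The permutations in the second hexagon for the degrees `010`. -/
lemma coh_reverse₀₁₀ : assocInv A B C ≫ tensorHom (𝟙 (A ⊗ₛ B)) C.parityHom ≫
    flip (A ⊗ₛ B) C ≫ assocInv C A B =
      tensorHom (𝟙 A) (tensorHom (𝟙 B) C.parityHom) ≫ tensorHom (𝟙 A) (flip B C) ≫
        assocInv A C B ≫ tensorHom (flip A C) (𝟙 B) := by
  rw [← coh_reverse₀₀₀]
  exact Hom.ext (TensorProduct.ext_threefold' fun a b c => rfl)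

/-- The permutations in the second hexagon for the degrees `100`. -/
lemma coh_reverse₁₀₀ : assocInv A B C ≫ tensorHom (𝟙 (A ⊗ₛ B)) C.parityHom ≫
    flip (A ⊗ₛ B) C ≫ assocInv C A B =
      tensorHom (𝟙 A) (flip B C) ≫ assocInv A C B ≫
        tensorHom (tensorHom (𝟙 A) C.parityHom) (𝟙 B) ≫ tensorHom (flip A C) (𝟙 B) := by
  rw [coh_reverse₀₁₀, ← Category.assoc, ← tensorHom_id_comp, tensorHom_flip, tensorHom_id_comp,
    Category.assoc]
  exact congrArg (_ ≫ ·) (Hom.ext (TensorProduct.ext_threefold' fun a b c => rfl))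

/-- The permutations in the second hexagon for the degrees `011`. -/
lemma coh_reverse₀₁₁ : shuffle A U B C ≫ tensorHom (𝟙 U) (tensorHom (𝟙 (A ⊗ₛ B)) C.parityHom) ≫
    tensorHom (𝟙 U) (flip (A ⊗ₛ B) C) ≫ tensorHom (𝟙 U) (assocInv C A B) =
      tensorHom (𝟙 A) (tensorHom (𝟙 U) (tensorHom (𝟙 B) C.parityHom)) ≫
        tensorHom (𝟙 A) (tensorHom (𝟙 U) (flip B C)) ≫ shuffle A U C B ≫
        tensorHom (𝟙 U) (tensorHom (flip A C) (𝟙 B)) := by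
  refine ext_hasSign_fourfold fun a σ u _ b _ c _ ha _ _ _ => ?_
  change (tensorHom (𝟙 U) (tensorHom (𝟙 (A ⊗ₛ B)) C.parityHom) ≫
      tensorHom (𝟙 U) (flip (A ⊗ₛ B) C) ≫ tensorHom (𝟙 U) (assocInv C A B)).lin
      ((shuffle A U B C).lin (a ⊗ₜ[ℂ] (u ⊗ₜ[ℂ] (b ⊗ₜ[ℂ] c)))) =
    (tensorHom (𝟙 U) (tensorHom (flip A C) (𝟙 B))).lin
      ((shuffle A U C B).lin (a ⊗ₜ[ℂ] (u ⊗ₜ[ℂ] (flip B C).lin (b ⊗ₜ[ℂ] C.parity c))))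
  rw [ha.shuffle_tmul, ha.shuffle_tmul]
  exact congrArg (fun z => (σ U).lin u ⊗ₜ[ℂ] z)
    (congr_lin (coh_reverse₀₁₀ A B C) (a ⊗ₜ[ℂ] (b ⊗ₜ[ℂ] c)))

/-- The permutations in the second hexagon for the degrees `101`. -/
lemma coh_reverse₁₀₁ : tensorHom (𝟙 U) (assocInv A B C) ≫
    tensorHom (𝟙 U) (tensorHom (𝟙 (A ⊗ₛ B)) C.parityHom) ≫ tensorHom (𝟙 U) (flip (A ⊗ₛ B) C) ≫
    tensorHom (𝟙 U) (assocInv C A B) ≫ assocInv U (C ⊗ₛ A) B =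
      tensorHom (𝟙 U) (tensorHom (𝟙 A) (flip B C)) ≫ tensorHom (𝟙 U) (assocInv A C B) ≫
        assocInv U (A ⊗ₛ C) B ≫ tensorHom (tensorHom (𝟙 U) (tensorHom (𝟙 A) C.parityHom)) (𝟙 B) ≫
        tensorHom (tensorHom (𝟙 U) (flip A C)) (𝟙 B) := by
  have := congrArg (fun f => tensorHom (𝟙 U) f ≫ assocInv U (C ⊗ₛ A) B) (coh_reverse₁₀₀ A B C)
  simp only [tensorHom_id_comp, Category.assoc] at this
  rw [this]
  exact congrArg (_ ≫ ·) (ext_fourfold fun a u b c => rfl)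

/-- The permutations in the second hexagon for the degrees `110`. -/
lemma coh_reverse₁₁₀ : tensorHom (𝟙 U) (assocInv A B C) ≫ assocInv U (A ⊗ₛ B) C ≫
    flip (U ⊗ₛ (A ⊗ₛ B)) C ≫ shuffle C U A B =
      tensorHom (𝟙 U) (tensorHom (𝟙 A) (tensorHom (𝟙 B) C.parityHom)) ≫
        tensorHom (𝟙 U) (tensorHom (𝟙 A) (flip B C)) ≫ tensorHom (𝟙 U) (assocInv A C B) ≫
        tensorHom (𝟙 U) (tensorHom (tensorHom (𝟙 A) C.parityHom) (𝟙 B)) ≫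
        tensorHom (𝟙 U) (tensorHom (flip A C) (𝟙 B)) := by
  refine ext_hasSign_fourfold fun u _ a σ b τ c ρ _ ha hb hc => ?_
  have hc' : HasSign (C.parity c) ρ := hc.apply C.parityHom
  change (shuffle C U A B).lin
    ((flip (U ⊗ₛ (A ⊗ₛ B)) C).lin ((u ⊗ₜ[ℂ] (a ⊗ₜ[ℂ] b)) ⊗ₜ[ℂ] c)) =
    (tensorHom (𝟙 U) (assocInv A C B) ≫
        tensorHom (𝟙 U) (tensorHom (tensorHom (𝟙 A) C.parityHom) (𝟙 B)) ≫
        tensorHom (𝟙 U) (tensorHom (flip A C) (𝟙 B))).lin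
      (u ⊗ₜ[ℂ] (a ⊗ₜ[ℂ] (flip B C).lin (b ⊗ₜ[ℂ] C.parity c)))
  rw [hc.flip_tmul_right, hc.tmul, hc.tmul, hc.shuffle_tmul, hc.invol,
    hc'.flip_tmul_right]
  change _ = u ⊗ₜ[ℂ] ((flip A C).lin (a ⊗ₜ[ℂ] C.parity (C.parity c)) ⊗ₜ[ℂ] (ρ B).lin b)
  rw [parity_parity, hc.flip_tmul_right]
  rfl

end coherence
end SuperVect

namespace OddMetric
open OddOps SuperVect
variable {h : Type u} [AddCommGroup h] [Module ℂ h] [FiniteDimensional ℂ h] (S : OddMetric h)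

section
variable {V V' W W' X Y Z : SuperVect.{u}} (c : ℂ)

lemma assoc_expOmega (P Q : OddOps h (V ⊗ₛ (W ⊗ₛ X))) {P₀ Q₀ : OddOps h ((V ⊗ₛ W) ⊗ₛ X)}
    [Intertwines (assoc V W X) P₀ P] [Intertwines (assoc V W X) Q₀ Q] [SuperCommute P₀ P₀]
    [SuperCommute P₀ Q₀] [SuperCommute Q₀ Q₀] [SuperCommute P P] [SuperCommute P Q]
    [SuperCommute Q Q] (g : _ ⟶ Z) :
    assoc V W X ≫ S.expOmega c P Q ≫ g = S.expOmega c P₀ Q₀ ≫ assoc V W X ≫ g :=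
  S.comp_expOmega_assoc _ c P Q g

lemma flip_expOmega (P Q : OddOps h (W ⊗ₛ V)) {P₀ Q₀ : OddOps h (V ⊗ₛ W)}
    [Intertwines (flip V W) P₀ P] [Intertwines (flip V W) Q₀ Q] [SuperCommute P₀ P₀]
    [SuperCommute P₀ Q₀] [SuperCommute Q₀ Q₀] [SuperCommute P P] [SuperCommute P Q]
    [SuperCommute Q Q] (g : _ ⟶ Z) :
    flip V W ≫ S.expOmega c P Q ≫ g = S.expOmega c P₀ Q₀ ≫ flip V W ≫ g :=
  S.comp_expOmega_assoc _ c P Q g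

lemma shuffleInv_expOmega (P Q : OddOps h (V ⊗ₛ (W ⊗ₛ (X ⊗ₛ Y))))
    {P₀ Q₀ : OddOps h (W ⊗ₛ ((V ⊗ₛ X) ⊗ₛ Y))}
    [Intertwines (shuffleInv V W X Y) P₀ P] [Intertwines (shuffleInv V W X Y) Q₀ Q]
    [SuperCommute P₀ P₀] [SuperCommute P₀ Q₀] [SuperCommute Q₀ Q₀] [SuperCommute P P]
    [SuperCommute P Q] [SuperCommute Q Q] (g : _ ⟶ Z) :
    shuffleInv V W X Y ≫ S.expOmega c P Q ≫ g = S.expOmega c P₀ Q₀ ≫ shuffleInv V W X Y ≫ g :=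
  S.comp_expOmega_assoc _ c P Q g

end

section
variable {X Z : SuperVect.{u}} (P : OddOps h X) (Q : OddOps h Z) (B C : SuperVect.{u})

/-- The inverse of `alpha₀₁₀`. -/
def alphaInv₀₁₀ : (X ⊗ₛ B) ⊗ₛ Z ⟶ X ⊗ₛ (B ⊗ₛ Z) :=
  assoc X B Z ≫ S.expOmega (-(Real.pi * Complex.I)) (P.onLeft _) (onRight X (onRight B Q))

/-- The inverse of `alpha₁₀₁`. -/
def alphaInv₁₀₁ : HRep.envSpace h ⊗ₛ ((B ⊗ₛ X) ⊗ₛ C) ⟶ HRep.envSpace h ⊗ₛ (B ⊗ₛ (X ⊗ₛ C)) :=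
  tensorHom (𝟙 (HRep.envSpace h)) (assoc B X C) ≫
    S.expOmega (-(Real.pi * Complex.I)) ((HRep.leftMul h).onLeft _)
      (onRight (HRep.envSpace h) (onRight B (P.onLeft C)))

/-- The inverse of `alpha₀₁₁`. -/
def alphaInv₀₁₁ : HRep.envSpace h ⊗ₛ ((X ⊗ₛ B) ⊗ₛ C) ⟶ X ⊗ₛ (HRep.envSpace h ⊗ₛ (B ⊗ₛ C)) :=
  shuffleInv X (HRep.envSpace h) B C ≫
    S.expOmega 1 (onRight X (S.deriv.onLeft (B ⊗ₛ C))) (P.onLeft _)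

/-- The inverse of `alpha₁₁₀`. -/
def alphaInv₁₁₀ : (HRep.envSpace h ⊗ₛ (B ⊗ₛ C)) ⊗ₛ X ⟶ HRep.envSpace h ⊗ₛ (B ⊗ₛ (C ⊗ₛ X)) :=
  assoc (HRep.envSpace h) (B ⊗ₛ C) X ≫ tensorHom (𝟙 _) (assoc B C X) ≫
    S.expOmega (-1) (S.deriv.onLeft _) (onRight (HRep.envSpace h) (onRight B (onRight C P)))

/-- The inverse of `alpha₁₁₁`; as `φ² = ω`, the inverse of `φ` is `ω φ`. -/
def alphaInv₁₁₁ (A : SuperVect.{u}) :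
    (HRep.envSpace h ⊗ₛ (A ⊗ₛ B)) ⊗ₛ C ⟶ A ⊗ₛ (HRep.envSpace h ⊗ₛ (B ⊗ₛ C)) :=
  assoc (HRep.envSpace h) (A ⊗ₛ B) C ≫ shuffleInv A (HRep.envSpace h) B C ≫
    tensorHom (𝟙 A) (tensorHom ((HRep.envSpace h).parityHom ≫ S.phi) (𝟙 (B ⊗ₛ C)))

/-- The underlying map of the braiding `c_{A,B}` of `A, B ∈ C₀`. -/
def beta₀₀ : X ⊗ₛ Z ⟶ Z ⊗ₛ X :=
  S.expOmega (-(Real.pi * Complex.I)) (P.onLeft Z) (onRight X Q) ≫ flip X Z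

/-- The underlying map of the braiding `c_{A,B}` of `A ∈ C₀` and `B ∈ C₁`. -/
def beta₀₁ : X ⊗ₛ B ⟶ B ⊗ₛ X :=
  S.expOmega (Real.pi * Complex.I / 2) (P.onLeft B) (P.onLeft B) ≫ flip X B

/-- The underlying map of the braiding `c_{A,B}` of `A ∈ C₁` and `B ∈ C₀`. -/
def beta₁₀ : B ⊗ₛ X ⟶ X ⊗ₛ B :=
  tensorHom (𝟙 B) X.parityHom ≫
    S.expOmega (Real.pi * Complex.I / 2) (onRight B P) (onRight B P) ≫ flip B X

/-- The underlying map of the braiding `c_{A,B}` of `A, B ∈ C₁`. -/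
def beta₁₁ : HRep.envSpace h ⊗ₛ (B ⊗ₛ C) ⟶ HRep.envSpace h ⊗ₛ (C ⊗ₛ B) :=
  tensorHom (𝟙 (HRep.envSpace h)) (tensorHom (𝟙 B) C.parityHom) ≫
    S.expOmega (-(Real.pi * Complex.I / 2)) ((HRep.leftMul h).onLeft (B ⊗ₛ C))
      ((HRep.leftMul h).onLeft (B ⊗ₛ C)) ≫
    tensorHom (𝟙 (HRep.envSpace h)) (flip B C ≫
      scale (Complex.exp (-(Real.pi * Complex.I * S.pairs / 4))) (C ⊗ₛ B))

end

end OddMetric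

/-! ### Hexagon identities with an object of `C₀` -/

namespace OddMetric
open OddOps SuperVect
variable {h : Type u} [AddCommGroup h] [Module ℂ h] [FiniteDimensional ℂ h] (S : OddMetric h)

/-! In this section `D` is a derivation of a factor `U(h)`, `M` the left multiplication on it, and
`X` the action on a representation; `c` stands for `i π`. -/

section conjugation

variable {V Z : SuperVect.{u}} (c : ℂ) (D M X : OddOps h V) [SuperCommute D D] [SuperCommute D X]
  [SuperCommute M M] [SuperCommute M X] [SuperCommute X M] [SuperCommute X X]
  [S.CanonicalPair D M 1]

/-- Conjugation of a Gaussian with `exp(d Ω(D, X))`. -/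
lemma expOmega_conj_gaussian (d : ℂ) (g : V ⟶ Z) :
    S.expOmega d D X ≫ S.expOmega c M M ≫ g =
      S.expOmega c M M ≫ S.expOmega (-(2 * c * d)) M X ≫ S.expOmega (c * d ^ 2) X X ≫
        S.expOmega d D X ≫ g := by
  have e₁ : 2 * c * -(d * 1) = -(2 * c * d) := by ring
  have e₂ : c * -(d * 1) * -(d * 1) = c * d ^ 2 := by ring
  rw [S.comp_expOmega_assoc (S.expOmega d D X) _ M, expOmega_square, expOmega_smul_right,
    expOmega_smul_right, expOmega_smul_left, Category.assoc, Category.assoc, e₁, e₂]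

/-- The exponentials in the second hexagon for the degrees `101`. -/
lemma expOmega_hexagon_reverse₁₀₁ (g : V ⟶ Z) :
    S.expOmega c M X ≫ S.expOmega (-(c / 2)) M M ≫ S.expOmega 1 D X ≫ g =
      S.expOmega (c / 2) X X ≫ S.expOmega 1 D X ≫ S.expOmega (-(c / 2)) M M ≫ g := by
  have e₁ : -(2 * -(c / 2) * 1) = c := by ring
  have e₂ : c / 2 + -(c / 2) * 1 ^ 2 = 0 := by ring
  rw [S.expOmega_conj_gaussian _ D M X, expOmega_commute_assoc _ (c / 2) _ X X M M,
    expOmega_commute_assoc _ (c / 2) _ X X M X, expOmega_comp_assoc _ (c / 2), e₁, e₂,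
    expOmega_zero, Category.id_comp, expOmega_commute_assoc]

variable [SuperCommute X D]

/-- Conjugation with `exp(d Ω(D, X))` replaces `M` by `M - d X`. -/
lemma expOmega_conj (d : ℂ) (g : V ⟶ Z) :
    S.expOmega d D X ≫ S.expOmega c M X ≫ g =
      S.expOmega c M X ≫ S.expOmega (-(c * d)) X X ≫ S.expOmega d D X ≫ g := by
  rw [S.comp_expOmega_assoc (S.expOmega d D X) _ M, expOmega_add_left, expOmega_smul_left,
    Category.assoc, mul_one, mul_neg]

/-- The exponentials in the first hexagon for the degrees `011`. -/
lemma expOmega_hexagon₀₁₁ (g : V ⟶ Z) :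
    S.expOmega (-1) D X ≫ S.expOmega (c / 2) X X ≫ S.expOmega (-c) M X ≫ S.expOmega (c / 2) X X ≫
      S.expOmega 1 D X ≫ g = S.expOmega (-c) X M ≫ g := by
  have e : -(-c * -1) + (c / 2 + c / 2) = 0 := by ring
  rw [expOmega_commute_assoc _ (c / 2) (-c), expOmega_comp_assoc,
    S.expOmega_conj _ D M X, expOmega_commute_assoc _ (-1), expOmega_comp_assoc, e,
    expOmega_comp_assoc, neg_add_cancel, expOmega_zero, expOmega_zero, Category.id_comp,
    Category.id_comp, expOmega_symm]

/-- The exponentials in the first hexagon for the degrees `101`. -/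
lemma expOmega_hexagon₁₀₁ (g : V ⟶ Z) :
    S.expOmega c M X ≫ S.expOmega (c / 2) X X ≫ S.expOmega (-1) D X ≫ S.expOmega (-(c / 2)) M M ≫
      S.expOmega 1 D X ≫ g = S.expOmega (-(c / 2)) M M ≫ g := by
  have e₁ : c + -(2 * -(c / 2) * -1) = 0 := by ring
  have e₂ : c / 2 + -(c / 2) * (-1) ^ 2 = 0 := by ring
  rw [S.expOmega_conj_gaussian _ D M X, expOmega_comp_assoc _ (-1), neg_add_cancel, expOmega_zero,
    Category.id_comp, expOmega_commute_assoc _ (c / 2) _ X X M M,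
    expOmega_commute_assoc _ (c / 2) _ X X M X, expOmega_comp_assoc, e₂,
    expOmega_commute_assoc _ c _ M X M M, expOmega_comp_assoc, e₁, expOmega_zero, expOmega_zero,
    Category.id_comp, Category.id_comp]

/-- The exponentials in the first hexagon for the degrees `110`. -/
lemma expOmega_hexagon₁₁₀ (g : V ⟶ Z) :
    S.expOmega 1 D X ≫ S.expOmega (-(c / 2)) M M ≫ S.expOmega (-1) D X ≫ S.expOmega (c / 2) X X ≫
      S.expOmega (-c) M X ≫ g = S.expOmega (-(c / 2)) M M ≫ g := by
  have e₁ : -(2 * -(c / 2) * 1) + -c = 0 := by ring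
  have e₂ : -(c / 2) * 1 ^ 2 + c / 2 = 0 := by ring
  rw [S.expOmega_conj_gaussian _ D M X, expOmega_comp_assoc _ 1, add_neg_cancel, expOmega_zero,
    Category.id_comp, expOmega_comp_assoc, e₂, expOmega_zero, Category.id_comp,
    expOmega_comp_assoc, e₁, expOmega_zero, Category.id_comp]

/-- The exponentials in the second hexagon for the degrees `011`. -/
lemma expOmega_hexagon_reverse₀₁₁ (g : V ⟶ Z) :
    S.expOmega (-1) D X ≫ S.expOmega (-(c / 2)) M M ≫ S.expOmega c M X ≫ g =
      S.expOmega (-(c / 2)) M M ≫ S.expOmega (-1) D X ≫ S.expOmega (c / 2) X X ≫ g := by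
  have e₁ : c + -(2 * -(c / 2) * -1) = 0 := by ring
  have e₂ : -(c / 2) * (-1) ^ 2 + -(c * -1) = c / 2 := by ring
  rw [S.expOmega_conj_gaussian _ D M X, S.expOmega_conj _ D M X,
    expOmega_commute_assoc _ _ c _ _ M X, expOmega_comp_assoc _ _ M X, add_comm, e₁,
    expOmega_zero, Category.id_comp,
    expOmega_comp_assoc, e₂, expOmega_commute_assoc _ _ _ X X D X]

/-- The exponentials in the second hexagon for the degrees `110`. -/
lemma expOmega_hexagon_reverse₁₁₀ (g : V ⟶ Z) :
    S.expOmega 1 D X ≫ S.expOmega (-c) M X ≫ S.expOmega (-1) D X ≫ g =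
      S.expOmega (c / 2) X X ≫ S.expOmega (-c) M X ≫ S.expOmega (c / 2) X X ≫ g := by
  have e : -(-c * 1) = c / 2 + c / 2 := by ring
  rw [S.expOmega_conj _ D M X, expOmega_comp_assoc _ 1, add_neg_cancel, expOmega_zero,
    Category.id_comp, e, expOmega_commute_assoc _ (c / 2) _ X X M X, expOmega_comp_assoc]

end conjugation

section hexagon

variable {A B C : SuperVect.{u}} (P : OddOps h A) (Q : OddOps h B) (R : OddOps h C)
  [SuperCommute P P] [SuperCommute Q Q] [SuperCommute R R]

lemma hexagon_forward₀₀₀ : assocInv A B C ≫ tensorHom (S.beta₀₀ P Q) (𝟙 C) ≫ assoc B A C ≫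
    tensorHom (𝟙 B) (S.beta₀₀ P R) ≫ assocInv B C A =
      S.beta₀₀ P (Q.onLeft C + onRight B R) := by
  simp only [beta₀₀, Category.assoc, tensorHom_id_comp, tensorHom_comp_id, tensorHom_id_expOmega,
    tensorHom_expOmega_id, assocInv_expOmega, assoc_expOmega, tensorHom_expOmega, onRight_add]
  rw [expOmega_add_right, flip_tensor_right, Category.assoc]

lemma hexagon_forward₀₀₁ : assocInv A B C ≫ tensorHom (S.beta₀₀ P Q) (𝟙 C) ≫ assoc B A C ≫
    tensorHom (𝟙 B) (S.beta₀₁ P C) ≫ S.alpha₀₁₀ Q P C = S.beta₀₁ P (B ⊗ₛ C) := by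
  simp only [alpha₀₁₀, beta₀₀, beta₀₁, Category.assoc, tensorHom_id_comp, tensorHom_comp_id,
    tensorHom_id_expOmega, tensorHom_expOmega_id, assocInv_expOmega, assoc_expOmega,
    tensorHom_expOmega]
  rw [expOmega_commute_assoc, S.expOmega_symm _ (onRight A (Q.onLeft C)), expOmega_comp_assoc,
    neg_add_cancel, expOmega_zero, Category.id_comp, flip_tensor_right]

lemma hexagon_forward₀₁₀ : S.alpha₀₁₀ P R B ≫ tensorHom (S.beta₀₁ P B) (𝟙 C) ≫ assoc B A C ≫
    tensorHom (𝟙 B) (S.beta₀₀ P R) ≫ assocInv B C A = S.beta₀₁ P (B ⊗ₛ C) := by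
  simp only [alpha₀₁₀, beta₀₀, beta₀₁, Category.assoc, tensorHom_id_comp, tensorHom_comp_id,
    tensorHom_id_expOmega, tensorHom_expOmega_id, assocInv_expOmega, assoc_expOmega,
    tensorHom_expOmega]
  rw [expOmega_commute_assoc, expOmega_comp_assoc, add_neg_cancel, expOmega_zero,
    Category.id_comp, flip_tensor_right]

lemma hexagon_forward₁₀₀ : assocInv A B C ≫ tensorHom (S.beta₁₀ Q A) (𝟙 C) ≫ S.alphaInv₀₁₀ Q R A ≫
    tensorHom (𝟙 B) (S.beta₁₀ R A) ≫ assocInv B C A =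
      S.beta₁₀ (Q.onLeft C + onRight B R) A := by
  simp only [alphaInv₀₁₀, beta₁₀, Category.assoc, tensorHom_id_comp, tensorHom_comp_id,
    tensorHom_id_expOmega, tensorHom_expOmega_id, assocInv_expOmega, assoc_expOmega,
    tensorHom_expOmega, onLeft_smul, onRight_smul, onRight_add, expOmega_smul_left,
    expOmega_smul_right, mul_neg_one, neg_neg, parityHom_tensor]
  rw [expOmega_square]
  simp only [expOmega_smul_left, expOmega_smul_right, mul_neg_one, neg_neg, Category.assoc,
    mul_div_cancel₀ (Real.pi * Complex.I) two_ne_zero]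
  rw [coh₁₀₀]

lemma hexagon_forward₀₁₁ : S.alpha₀₁₁ P B C ≫ tensorHom (𝟙 _) (tensorHom (S.beta₀₁ P B) (𝟙 C)) ≫
    S.alphaInv₁₀₁ P B C ≫ tensorHom (𝟙 _) (tensorHom (𝟙 B) (S.beta₀₁ P C)) ≫
    S.alpha₁₁₀ P B C = S.beta₀₀ P ((HRep.leftMul h).onLeft (B ⊗ₛ C)) := by
  simp only [alpha₀₁₁, alphaInv₁₀₁, alpha₁₁₀, beta₀₀, beta₀₁, Category.assoc, tensorHom_id_comp,
    tensorHom_comp_id, tensorHom_id_expOmega, tensorHom_expOmega_id, tensorHom_expOmega,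
    shuffle_expOmega]
  rw [expOmega_hexagon₀₁₁, coh₀₁₁]

lemma hexagon_forward₁₀₁ : S.alpha₁₀₁ Q A C ≫ tensorHom (𝟙 _) (tensorHom (S.beta₁₀ Q A) (𝟙 C)) ≫
    S.alphaInv₀₁₁ Q A C ≫ tensorHom (𝟙 B) (S.beta₁₁ A C) ≫ S.alpha₀₁₁ Q C A =
      S.beta₁₁ A (B ⊗ₛ C) := by
  simp only [alpha₁₀₁, alphaInv₀₁₁, alpha₀₁₁, beta₁₀, beta₁₁, Category.assoc, tensorHom_id_comp,
    tensorHom_comp_id, tensorHom_id_expOmega, tensorHom_expOmega_id, tensorHom_expOmega,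
    shuffleInv_expOmega, onLeft_smul, onRight_smul, expOmega_smul_left, expOmega_smul_right,
    mul_neg_one, neg_neg, parityHom_tensor, tensorHom_id_scale, scale_comp]
  rw [expOmega_hexagon₁₀₁, reassoc_of% (coh₁₀₁ A B C (HRep.envSpace h))]

lemma hexagon_forward₁₁₀ : S.alpha₁₁₀ R A B ≫ tensorHom (S.beta₁₁ A B) (𝟙 C) ≫ S.alphaInv₁₁₀ R B A ≫
    tensorHom (𝟙 _) (tensorHom (𝟙 B) (S.beta₁₀ R A)) ≫ S.alpha₁₀₁ R B A =
      S.beta₁₁ A (B ⊗ₛ C) := by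
  simp only [alpha₁₁₀, alphaInv₁₁₀, alpha₁₀₁, beta₁₀, beta₁₁, Category.assoc, tensorHom_id_comp,
    tensorHom_comp_id, tensorHom_id_expOmega, tensorHom_expOmega_id, assocInv_expOmega,
    assoc_expOmega, tensorHom_expOmega, onRight_smul, expOmega_smul_left, expOmega_smul_right,
    mul_neg_one, neg_neg, parityHom_tensor, tensorHom_id_scale, tensorHom_scale_id, scale_comp]
  rw [expOmega_hexagon₁₁₀, reassoc_of% (coh₁₁₀ A B C (HRep.envSpace h))]

lemma hexagon_reverse₀₀₀ : assocInv A B C ≫ S.beta₀₀ (P.onLeft B + onRight A Q) R ≫ assocInv C A B =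
    tensorHom (𝟙 A) (S.beta₀₀ Q R) ≫ assocInv A C B ≫ tensorHom (S.beta₀₀ P R) (𝟙 B) := by
  simp only [beta₀₀, Category.assoc, tensorHom_id_comp, tensorHom_comp_id, tensorHom_id_expOmega,
    tensorHom_expOmega_id, assocInv_expOmega, tensorHom_expOmega, onLeft_add]
  rw [expOmega_add_left, Category.assoc, expOmega_commute_assoc, coh_reverse₀₀₀]

lemma hexagon_reverse₀₀₁ : assocInv A B C ≫ S.beta₀₁ (P.onLeft B + onRight A Q) C ≫ assocInv C A B =
    tensorHom (𝟙 A) (S.beta₀₁ Q C) ≫ S.alpha₀₁₀ P Q C ≫ tensorHom (S.beta₀₁ P C) (𝟙 B) := by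
  simp only [alpha₀₁₀, beta₀₁, Category.assoc, tensorHom_id_comp, tensorHom_comp_id,
    tensorHom_id_expOmega, tensorHom_expOmega_id, assocInv_expOmega, tensorHom_expOmega, onLeft_add]
  rw [expOmega_square, mul_div_cancel₀ _ two_ne_zero, Category.assoc, Category.assoc,
    coh_reverse₀₀₀, expOmega_commute_assoc _ _ _ (P.onLeft _) (P.onLeft _) (P.onLeft _),
    expOmega_commute_assoc _ _ _ (P.onLeft _) (P.onLeft _) (onRight A _),
    expOmega_commute_assoc _ _ _ (P.onLeft _) (onRight A _) (onRight A _)]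

lemma hexagon_reverse₀₁₀ : S.alpha₀₁₀ P R B ≫ S.beta₁₀ R (A ⊗ₛ B) ≫ assocInv C A B =
    tensorHom (𝟙 A) (S.beta₁₀ R B) ≫ assocInv A C B ≫ tensorHom (S.beta₀₀ P R) (𝟙 B) := by
  simp only [alpha₀₁₀, beta₀₀, beta₁₀, Category.assoc, tensorHom_id_comp, tensorHom_comp_id,
    tensorHom_id_expOmega, tensorHom_expOmega_id, assocInv_expOmega, tensorHom_expOmega,
    onRight_smul, expOmega_smul_left, expOmega_smul_right, mul_neg_one, neg_neg]
  rw [expOmega_commute_assoc, coh_reverse₀₁₀]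

lemma hexagon_reverse₁₀₀ : assocInv A B C ≫ S.beta₁₀ R (A ⊗ₛ B) ≫ S.alpha₀₁₀ R Q A =
    tensorHom (𝟙 A) (S.beta₀₀ Q R) ≫ assocInv A C B ≫ tensorHom (S.beta₁₀ R A) (𝟙 B) := by
  simp only [alpha₀₁₀, beta₀₀, beta₁₀, Category.assoc, tensorHom_id_comp, tensorHom_comp_id,
    tensorHom_id_expOmega, tensorHom_expOmega_id, assocInv_expOmega, tensorHom_expOmega,
    flip_expOmega, onRight_smul, expOmega_smul_left, expOmega_smul_right, mul_neg_one, neg_neg]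
  rw [expOmega_commute_assoc, coh_reverse₁₀₀,
    S.expOmega_symm _ (onRight A (onRight B R)) (onRight A (Q.onLeft C))]

lemma hexagon_reverse₀₁₁ : S.alpha₀₁₁ P B C ≫ S.beta₁₁ (A ⊗ₛ B) C ≫ S.alpha₁₀₁ P C B =
    tensorHom (𝟙 A) (S.beta₁₁ B C) ≫ S.alpha₀₁₁ P C B ≫
      tensorHom (𝟙 _) (tensorHom (S.beta₀₁ P C) (𝟙 B)) := by
  simp only [alpha₀₁₁, alpha₁₀₁, beta₀₁, beta₁₁, Category.assoc, tensorHom_id_comp,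
    tensorHom_comp_id, tensorHom_id_expOmega, tensorHom_expOmega_id, tensorHom_expOmega,
    shuffle_expOmega, tensorHom_id_scale, scale_comp]
  rw [expOmega_hexagon_reverse₀₁₁, reassoc_of% (coh_reverse₀₁₁ A B C (HRep.envSpace h))]

lemma hexagon_reverse₁₀₁ : S.alpha₁₀₁ Q A C ≫ S.beta₁₁ (A ⊗ₛ B) C ≫ S.alpha₁₁₀ Q C A =
    tensorHom (𝟙 _) (tensorHom (𝟙 A) (S.beta₀₁ Q C)) ≫ S.alpha₁₁₀ Q A C ≫
      tensorHom (S.beta₁₁ A C) (𝟙 B) := by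
  simp only [alpha₁₀₁, alpha₁₁₀, beta₀₁, beta₁₁, Category.assoc, tensorHom_id_comp,
    tensorHom_comp_id, tensorHom_id_expOmega, tensorHom_expOmega_id, assocInv_expOmega,
    tensorHom_expOmega, tensorHom_id_scale, tensorHom_scale_id, scale_comp]
  rw [expOmega_hexagon_reverse₁₀₁, reassoc_of% (coh_reverse₁₀₁ A B C (HRep.envSpace h))]

lemma hexagon_reverse₁₁₀ : S.alpha₁₁₀ R A B ≫ S.beta₀₀ ((HRep.leftMul h).onLeft (A ⊗ₛ B)) R ≫
    S.alpha₀₁₁ R A B = tensorHom (𝟙 _) (tensorHom (𝟙 A) (S.beta₁₀ R B)) ≫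
      S.alpha₁₀₁ R A B ≫ tensorHom (𝟙 _) (tensorHom (S.beta₁₀ R A) (𝟙 B)) := by
  simp only [alpha₀₁₁, alpha₁₀₁, alpha₁₁₀, beta₀₀, beta₁₀, Category.assoc, tensorHom_id_comp,
    tensorHom_comp_id, tensorHom_id_expOmega, tensorHom_expOmega_id, assocInv_expOmega,
    tensorHom_expOmega, flip_expOmega, onRight_smul, expOmega_smul_left, expOmega_smul_right,
    mul_neg_one, neg_neg]
  rw [expOmega_hexagon_reverse₁₁₀, coh_reverse₁₁₀]

end hexagon
end OddMetric

/-! ### Hexagon identities for three objects of `C₁` -/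

namespace SuperVect

section

variable {A B C U : SuperVect.{u}} {a : A} {σ : ∀ U : SuperVect.{u}, U ⟶ U} (f : U ⟶ U)

lemma HasSign.shuffle_assocInv_tmul (ha : HasSign a σ) (u : U) (b : B) (c : C) :
    (tensorHom (𝟙 A) (tensorHom f (𝟙 (B ⊗ₛ C))) ≫ shuffle A U B C ≫ assocInv U (A ⊗ₛ B) C).lin
      (a ⊗ₜ[ℂ] (u ⊗ₜ[ℂ] (b ⊗ₜ[ℂ] c))) = ((σ U).lin (f.lin u) ⊗ₜ[ℂ] (a ⊗ₜ[ℂ] b)) ⊗ₜ[ℂ] c := by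
  rw [comp_lin_apply, comp_lin_apply]
  change (assocInv U (A ⊗ₛ B) C).lin
    ((shuffle A U B C).lin (a ⊗ₜ[ℂ] (f.lin u ⊗ₜ[ℂ] (b ⊗ₜ[ℂ] c)))) = _
  rw [ha.shuffle_tmul]
  rfl

lemma HasSign.assoc_shuffleInv_tmul (ha : HasSign a σ) (u : U) (b : B) (c : C) :
    (assoc U (A ⊗ₛ B) C ≫ shuffleInv A U B C ≫ tensorHom (𝟙 A) (tensorHom f (𝟙 (B ⊗ₛ C)))).lin
      ((u ⊗ₜ[ℂ] (a ⊗ₜ[ℂ] b)) ⊗ₜ[ℂ] c) = a ⊗ₜ[ℂ] (f.lin ((σ U).lin u) ⊗ₜ[ℂ] (b ⊗ₜ[ℂ] c)) := by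
  rw [comp_lin_apply, comp_lin_apply, assoc_tmul, ha.shuffleInv_tmul]
  rfl

end

/-- The permutations in the first hexagon for the degrees `111`, in the presence of maps of the
factor `U`. -/
lemma coh₁₁₁ (A B C : SuperVect.{u}) {U : SuperVect.{u}} (f e g k : U ⟶ U)
    (H : f ≫ e ≫ g ≫ e ≫ f = k) :
    (tensorHom (𝟙 A) (tensorHom f (𝟙 (B ⊗ₛ C))) ≫ shuffle A U B C ≫ assocInv U (A ⊗ₛ B) C) ≫
      tensorHom (tensorHom e (tensorHom (𝟙 A) B.parityHom ≫ flip A B)) (𝟙 C) ≫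
      (assoc U (B ⊗ₛ A) C ≫ shuffleInv B U A C ≫ tensorHom (𝟙 B) (tensorHom g (𝟙 (A ⊗ₛ C)))) ≫
      tensorHom (𝟙 B) (tensorHom e (tensorHom (𝟙 A) C.parityHom ≫ flip A C)) ≫
      tensorHom (𝟙 B) (tensorHom f (𝟙 (C ⊗ₛ A))) ≫ shuffle B U C A ≫ assocInv U (B ⊗ₛ C) A =
    tensorHom (𝟙 A) (tensorHom k (tensorHom B.parityHom C.parityHom)) ≫
      flip A (U ⊗ₛ (B ⊗ₛ C)) := by
  refine ext_hasSign_fourfold fun a σ u _ b τ c _ ha _ hb _ => ?_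
  have hb' : HasSign ((σ B).lin (B.parity b)) τ := (hb.apply B.parityHom).apply (σ B)
  have e₁ : ∀ x, (tensorHom (tensorHom e (tensorHom (𝟙 A) B.parityHom ≫ flip A B)) (𝟙 C)).lin
      ((x ⊗ₜ[ℂ] (a ⊗ₜ[ℂ] b)) ⊗ₜ[ℂ] c) =
      (e.lin x ⊗ₜ[ℂ] ((σ B).lin (B.parity b) ⊗ₜ[ℂ] a)) ⊗ₜ[ℂ] c := fun x => by
    rw [← ha.flip_tmul]
    rfl
  have e₂ : ∀ x, (tensorHom (𝟙 B) (tensorHom e (tensorHom (𝟙 A) C.parityHom ≫ flip A C))).lin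
      ((σ B).lin (B.parity b) ⊗ₜ[ℂ] (x ⊗ₜ[ℂ] (a ⊗ₜ[ℂ] c))) =
      (σ B).lin (B.parity b) ⊗ₜ[ℂ] (e.lin x ⊗ₜ[ℂ] ((σ C).lin (C.parity c) ⊗ₜ[ℂ] a)) :=
    fun x => by
      rw [← ha.flip_tmul]
      rfl
  have e₃ : (tensorHom (𝟙 A) (tensorHom k (tensorHom B.parityHom C.parityHom))).lin
      (a ⊗ₜ[ℂ] (u ⊗ₜ[ℂ] (b ⊗ₜ[ℂ] c))) =
      a ⊗ₜ[ℂ] (k.lin u ⊗ₜ[ℂ] (B.parity b ⊗ₜ[ℂ] C.parity c)) := rfl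
  rw [comp_lin_apply, comp_lin_apply, comp_lin_apply, comp_lin_apply, ha.shuffle_assocInv_tmul, e₁,
    hb'.assoc_shuffleInv_tmul, e₂, hb'.shuffle_assocInv_tmul, comp_lin_apply, e₃, ha.flip_tmul,
    ha.tmul, ha.tmul, ← congr_lin H u]
  simp only [comp_lin_apply]
  rw [hb.map, hb.map, hb.map, hb.invol, ha.map, ha.map, ha.map, ha.map]

/-- The permutations in the second hexagon for the degrees `111`, in the presence of maps of the
factor `U`. -/
lemma coh_reverse₁₁₁ (A B C : SuperVect.{u}) {U : SuperVect.{u}} (f g e : U ⟶ U)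
    (H : f ≫ g ≫ f = e ≫ f ≫ e) :
    (tensorHom (𝟙 A) (tensorHom f (𝟙 (B ⊗ₛ C))) ≫ shuffle A U B C ≫ assocInv U (A ⊗ₛ B) C) ≫
      (tensorHom (tensorHom g (𝟙 (A ⊗ₛ B))) (𝟙 C) ≫ flip (U ⊗ₛ (A ⊗ₛ B)) C) ≫
      tensorHom (𝟙 C) (tensorHom f (𝟙 (A ⊗ₛ B))) ≫ shuffle C U A B ≫ assocInv U (C ⊗ₛ A) B =
    tensorHom (𝟙 A) (tensorHom e (tensorHom (𝟙 B) C.parityHom ≫ flip B C)) ≫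
      (tensorHom (𝟙 A) (tensorHom f (𝟙 (C ⊗ₛ B))) ≫ shuffle A U C B ≫ assocInv U (A ⊗ₛ C) B) ≫
      tensorHom (tensorHom e (tensorHom (𝟙 A) C.parityHom ≫ flip A C)) (𝟙 B) := by
  refine ext_hasSign_fourfold fun a σ u _ b _ c ρ ha _ _ hc => ?_
  have hc' : HasSign (C.parity c) ρ := hc.apply C.parityHom
  have e₁ : ∀ x, (tensorHom (tensorHom g (𝟙 (A ⊗ₛ B))) (𝟙 C)).lin
      ((x ⊗ₜ[ℂ] (a ⊗ₜ[ℂ] b)) ⊗ₜ[ℂ] c) = (g.lin x ⊗ₜ[ℂ] (a ⊗ₜ[ℂ] b)) ⊗ₜ[ℂ] c := fun _ => rfl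
  have e₂ : (tensorHom (𝟙 A) (tensorHom e (tensorHom (𝟙 B) C.parityHom ≫ flip B C))).lin
      (a ⊗ₜ[ℂ] (u ⊗ₜ[ℂ] (b ⊗ₜ[ℂ] c))) =
      a ⊗ₜ[ℂ] (e.lin u ⊗ₜ[ℂ] (C.parity c ⊗ₜ[ℂ] (ρ B).lin b)) := by
    rw [← hc'.flip_tmul_right]
    rfl
  have e₃ : ∀ x y, (tensorHom (tensorHom e (tensorHom (𝟙 A) C.parityHom ≫ flip A C)) (𝟙 B)).lin
      ((x ⊗ₜ[ℂ] (a ⊗ₜ[ℂ] C.parity c)) ⊗ₜ[ℂ] y) =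
      (e.lin x ⊗ₜ[ℂ] (c ⊗ₜ[ℂ] (ρ A).lin a)) ⊗ₜ[ℂ] y := fun x y => by
    refine Eq.trans (b := (e.lin x ⊗ₜ[ℂ]
      (flip A C).lin (a ⊗ₜ[ℂ] C.parity (C.parity c))) ⊗ₜ[ℂ] y) rfl ?_
    rw [parity_parity, hc.flip_tmul_right]
  have := congr_lin H ((σ U).lin u)
  simp only [comp_lin_apply] at this
  rw [comp_lin_apply, comp_lin_apply, ha.shuffle_assocInv_tmul,
    comp_lin_apply (tensorHom (tensorHom g _) _), e₁, hc.flip_tmul_right, hc.tmul, hc.tmul,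
    hc.shuffle_assocInv_tmul, comp_lin_apply, comp_lin_apply,
    e₂, ha.shuffle_assocInv_tmul, e₃, hc.map, hc.invol, ← ha.map, this, ← ha.map, ← ha.map]

end SuperVect

namespace OddMetric
open OddOps SuperVect
variable {h : Type u} [AddCommGroup h] [Module ℂ h] (S : OddMetric h)

/-- The square of the scalar in the braiding of objects of `C₁` is `(-i)^N`. -/
lemma exp_mul_exp_eq : Complex.exp (-(Real.pi * Complex.I * S.pairs / 4)) *
    Complex.exp (-(Real.pi * Complex.I * S.pairs / 4)) = (-Complex.I) ^ S.pairs := by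
  rw [← Complex.exp_add, ← Complex.exp_neg_pi_div_two_mul_I, ← Complex.exp_nat_mul]
  congr 1
  ring

variable [FiniteDimensional ℂ h]

/-- The relation between `φ` and the Gaussians that underlies the hexagon identities for three
objects of `C₁`. -/
lemma phi_gaussian_phi (s : ℂ) (hs : s * s = (-Complex.I) ^ S.pairs) :
    S.phi ≫ S.expOmega (Real.pi * Complex.I / 2) (HRep.leftMul h) (HRep.leftMul h) ≫ S.phi =
    (S.expOmega (-(Real.pi * Complex.I / 2)) (HRep.leftMul h) (HRep.leftMul h) ≫ scale s _) ≫
      S.phi ≫ S.expOmega (-(Real.pi * Complex.I / 2)) (HRep.leftMul h) (HRep.leftMul h) ≫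
      scale s _ := by
  have i₁ := S.intertwines_expOmega_self (Real.pi * Complex.I / 2) (HRep.leftMul h) S.deriv (-1)
  have i₂ := S.intertwines_expOmega_self (-(Real.pi * Complex.I / 2)) (HRep.leftMul h) S.deriv (-1)
  have hz : (Real.pi * Complex.I : ℂ) ≠ 0 := pi_mul_I_ne_zero
  have e₁ : ∀ {V : SuperVect.{u}} (D M : OddOps h V) (p q : ℂ), p * q = 1 →
      (-1 : ℂ) • q • (-p • M + (-(2 * (p / 2) * -1)) • q • D) + (-q) • (-p) • q • D = M :=
    fun D M p q hpq => ext_lin fun v => LinearMap.ext fun x => by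
      simp only [add_lin, smul_lin, LinearMap.add_apply, LinearMap.smul_apply]
      linear_combination (norm := module) hpq • M.lin v x
  have e₂ : ∀ {V : SuperVect.{u}} (D M : OddOps h V) (p q : ℂ), p * q = 1 →
      (-1 : ℂ) • q • (D + (-(2 * -(p / 2) * -1)) • M) +
        (-q) • (-p • M + (-(2 * -(p / 2) * -1)) • q • (D + (-(2 * -(p / 2) * -1)) • M)) = M :=
    fun D M p q hpq => ext_lin fun v => LinearMap.ext fun x => by
      simp only [add_lin, smul_lin, LinearMap.add_apply, LinearMap.smul_apply]
      linear_combination (norm := module) (q * hpq) • D.lin v x + ((1 - p * q) * hpq) • M.lin v x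
  -- Both sides turn left multiplication into the same operators, so they are compared at `1`.
  have h₁ : Intertwines (S.phi ≫
      S.expOmega (Real.pi * Complex.I / 2) (HRep.leftMul h) (HRep.leftMul h) ≫ S.phi)
      (HRep.leftMul h) ((-1 : ℂ) • HRep.leftMul h + (-(Real.pi * Complex.I)⁻¹ : ℂ) • S.deriv) := by
    refine Intertwines.congr inferInstance ?_
    exact e₁ _ _ _ _ (mul_inv_cancel₀ hz)
  have h₂ : Intertwines
      ((S.expOmega (-(Real.pi * Complex.I / 2)) (HRep.leftMul h) (HRep.leftMul h) ≫ scale s _) ≫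
        S.phi ≫ S.expOmega (-(Real.pi * Complex.I / 2)) (HRep.leftMul h) (HRep.leftMul h) ≫
        scale s _)
      (HRep.leftMul h) ((-1 : ℂ) • HRep.leftMul h + (-(Real.pi * Complex.I)⁻¹ : ℂ) • S.deriv) := by
    refine Intertwines.congr inferInstance ?_
    exact e₂ _ _ _ _ (mul_inv_cancel₀ hz)
  refine SuperVect.Hom.ext (env_ext (fun a => OddOps.lin _ a) h₁.comm h₂.comm ?_)
  have h1 : (Real.pi : ℂ) ≠ 0 := by exact_mod_cast Real.pi_ne_zero
  have f₁ : -(Real.pi * Complex.I / 2) * (-2 / (Real.pi : ℂ)) = Complex.I := by field_simp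
  have f₂ : (Real.pi : ℂ) ^ 2 / (4 * -(Real.pi * Complex.I / 2)) = Real.pi * Complex.I / 2 := by
    have := Complex.I_ne_zero
    field_simp
    linear_combination -4 * Complex.I_sq
  -- The Gaussian `exp(-(i π / 2) Ω)` is mapped to a multiple of its inverse.
  have f₃ : S.phi.lin ((S.expOmega (-(Real.pi * Complex.I / 2)) (HRep.leftMul h)
      (HRep.leftMul h)).lin (1 : ExteriorAlgebra ℂ h)) =
      Complex.I ^ S.pairs • (S.expOmega (Real.pi * Complex.I / 2) (HRep.leftMul h)
        (HRep.leftMul h)).lin (1 : ExteriorAlgebra ℂ h) := by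
    refine (S.phi_gaussian (by simp [h1])).trans ?_
    rw [f₁, f₂]
    rfl
  have f₄ : (S.expOmega (-(Real.pi * Complex.I / 2)) (HRep.leftMul h) (HRep.leftMul h)).lin
      ((S.expOmega (Real.pi * Complex.I / 2) (HRep.leftMul h) (HRep.leftMul h)).lin
        (1 : ExteriorAlgebra ℂ h)) = (1 : ExteriorAlgebra ℂ h) :=
    congr_lin (S.expOmega_comp_neg _ _ _) _
  change S.phi.lin ((S.expOmega (Real.pi * Complex.I / 2) (HRep.leftMul h) (HRep.leftMul h)).lin
    (S.phi.lin (1 : ExteriorAlgebra ℂ h))) =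
      s • (S.expOmega (-(Real.pi * Complex.I / 2)) (HRep.leftMul h) (HRep.leftMul h)).lin
        (S.phi.lin (s • (S.expOmega (-(Real.pi * Complex.I / 2)) (HRep.leftMul h)
          (HRep.leftMul h)).lin (1 : ExteriorAlgebra ℂ h)))
  rw [S.expOmega_apply_of_eq_zero _ _ _ S.leftMul_phi_one, phi_phi_one, map_smul, f₃, map_smul,
    map_smul, f₄, smul_smul, smul_smul, hs, ← mul_pow, neg_mul, Complex.I_mul_I,
    neg_neg, one_pow, one_smul]

/-- The braiding of objects of `C₁` as a tensor product of a map of `U(h)` and a map of the other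
factors. -/
lemma beta₁₁_eq (B C : SuperVect.{u}) : S.beta₁₁ B C =
    tensorHom (S.expOmega (-(Real.pi * Complex.I / 2)) (HRep.leftMul h) (HRep.leftMul h) ≫
      scale (Complex.exp (-(Real.pi * Complex.I * S.pairs / 4))) _)
      (tensorHom (𝟙 B) C.parityHom ≫ flip B C) := by
  rw [beta₁₁, ← tensorHom_expOmega_id, tensorHom_id_comp, tensorHom_id_scale]
  refine Hom.ext (TensorProduct.ext' fun x y => ?_)
  change Complex.exp (-(Real.pi * Complex.I * S.pairs / 4)) •
    ((S.expOmega (-(Real.pi * Complex.I / 2)) (HRep.leftMul h) (HRep.leftMul h)).lin x ⊗ₜ[ℂ]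
      (flip B C).lin ((tensorHom (𝟙 B) C.parityHom).lin y)) = _
  rw [TensorProduct.smul_tmul']
  rfl

section

variable (A B C : SuperVect.{u})

lemma hexagon_forward₁₁₁ : S.alpha₁₁₁ B C A ≫ tensorHom (S.beta₁₁ A B) (𝟙 C) ≫
    S.alphaInv₁₁₁ A C B ≫ tensorHom (𝟙 B) (S.beta₁₁ A C) ≫ S.alpha₁₁₁ C A B =
      S.beta₁₀ ((HRep.leftMul h).onLeft (B ⊗ₛ C)) A := by
  rw [beta₁₁_eq, beta₁₁_eq, beta₁₀, ← tensorHom_id_expOmega, ← tensorHom_expOmega_id]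
  refine (coh₁₁₁ A B C _ _ _ ((HRep.envSpace h).parityHom ≫
    S.expOmega (Real.pi * Complex.I / 2) (HRep.leftMul h) (HRep.leftMul h)) ?_).trans ?_
  · have H := S.phi_gaussian_phi _ S.exp_mul_exp_eq
    have hω : ∀ f : HRep.envSpace h ⟶ HRep.envSpace h,
        f ≫ (HRep.envSpace h).parityHom = (HRep.envSpace h).parityHom ≫ f := fun f =>
      hom_ext fun v => (f.map_parity v).symm
    have hωω : (HRep.envSpace h).parityHom ≫ (HRep.envSpace h).parityHom = 𝟙 _ :=
      hom_ext fun v => parity_parity _ v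
    simp only [Category.assoc]
    rw [reassoc_of% (hω (scale _ _)), reassoc_of% (hω (S.expOmega _ _ _)), reassoc_of% (hω S.phi),
      ← reassoc_of% H, reassoc_of% S.phi_phi, S.phi_phi, hω, reassoc_of% hωω]
  · rw [parityHom_tensor, parityHom_tensor, ← Category.assoc (tensorHom (𝟙 A) _),
      ← tensorHom_id_comp]
    exact congrArg (fun f => tensorHom (𝟙 A) f ≫ flip A _)
      (Hom.ext (TensorProduct.ext' fun _ _ => rfl))

lemma hexagon_reverse₁₁₁ : S.alpha₁₁₁ B C A ≫ S.beta₀₁ ((HRep.leftMul h).onLeft (A ⊗ₛ B)) C ≫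
    S.alpha₁₁₁ A B C = tensorHom (𝟙 A) (S.beta₁₁ B C) ≫ S.alpha₁₁₁ C B A ≫
      tensorHom (S.beta₁₁ A C) (𝟙 B) := by
  rw [beta₁₁_eq, beta₁₁_eq, beta₀₁, ← tensorHom_expOmega_id, ← tensorHom_expOmega_id]
  refine coh_reverse₁₁₁ A B C _ _ _ ?_
  rw [S.phi_gaussian_phi _ S.exp_mul_exp_eq, Category.assoc]

end

end OddMetric

/-! ### Naturality, invertibility and units -/

namespace SuperVect

section naturality

variable {A A' B B' C C' V W : SuperVect.{u}} (f : A ⟶ A') (g : B ⟶ B') (k : C ⟶ C')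

lemma tensorHom_assocInv : tensorHom f (tensorHom g k) ≫ assocInv A' B' C' =
    assocInv A B C ≫ tensorHom (tensorHom f g) k :=
  Hom.ext (TensorProduct.ext_threefold' fun _ _ _ => rfl)

lemma Hom.map_evenPart (v : A) : f.lin (A.evenPart v) = A'.evenPart (f.lin v) := by
  simp [evenPart_eq, Hom.map_parity]

lemma Hom.map_oddPart (v : A) : f.lin (A.oddPart v) = A'.oddPart (f.lin v) := by
  simp [oddPart_eq, Hom.map_parity]

lemma tensorHom_shuffle (U : SuperVect.{u}) :
    tensorHom f (tensorHom (𝟙 U) (tensorHom g k)) ≫ shuffle A' U B' C' =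
      shuffle A U B C ≫ tensorHom (𝟙 U) (tensorHom (tensorHom f g) k) :=
  ext_fourfold fun a u b c => by
    rw [comp_lin_apply, comp_lin_apply, tensorHom_tmul, tensorHom_tmul, tensorHom_tmul,
      shuffle_tmul, shuffle_tmul, map_add, tensorHom_tmul, tensorHom_tmul, tensorHom_tmul,
      tensorHom_tmul, tensorHom_tmul, tensorHom_tmul, Hom.map_evenPart, Hom.map_oddPart,
      id_lin_apply, id_lin_apply]

lemma tensorHom_comp_tensorHom {A'' B'' : SuperVect.{u}} (f' : A' ⟶ A'') (g' : B' ⟶ B'') :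
    tensorHom f g ≫ tensorHom f' g' = tensorHom (f ≫ f') (g ≫ g') :=
  Hom.ext (TensorProduct.ext' fun _ _ => rfl)

lemma comp_parityHom (f : V ⟶ W) : f ≫ W.parityHom = V.parityHom ≫ f :=
  hom_ext fun v => (f.map_parity v).symm

lemma parityHom_comp_parityHom (V : SuperVect.{u}) : V.parityHom ≫ V.parityHom = 𝟙 V :=
  hom_ext V.parity_parity

lemma shuffle_comp_shuffleInv (A U B C : SuperVect.{u}) :
    shuffle A U B C ≫ shuffleInv A U B C = 𝟙 _ := by
  rw [shuffle, shuffleInv, Category.assoc, Category.assoc, Category.assoc,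
    reassoc_of% (tensorHom_comp_tensorHom (𝟙 U) (assocInv A B C) (𝟙 U)), assocInv_comp_assoc,
    tensorHom_id_id, Category.id_comp,
    reassoc_of% (assoc_comp_assocInv U A (B ⊗ₛ C)),
    reassoc_of% (tensorHom_comp_tensorHom (flip A U) (𝟙 (B ⊗ₛ C)) (flip U A)), flip_flip,
    tensorHom_id_id, Category.id_comp, assocInv_comp_assoc]

lemma scale_comp_scale (z w : ℂ) (V : SuperVect.{u}) :
    scale z V ≫ scale w V = scale (w * z) V :=
  hom_ext fun v => smul_smul w z v

lemma scale_one (V : SuperVect.{u}) : scale 1 V = 𝟙 V :=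
  hom_ext fun v => one_smul ℂ v

instance isIso_tensorHom (f : A ⟶ A') (g : B ⟶ B') [IsIso f] [IsIso g] : IsIso (tensorHom f g) :=
  ⟨tensorHom (inv f) (inv g), by
    rw [tensorHom_comp_tensorHom, IsIso.hom_inv_id, IsIso.hom_inv_id, tensorHom_id_id], by
    rw [tensorHom_comp_tensorHom, IsIso.inv_hom_id, IsIso.inv_hom_id, tensorHom_id_id]⟩

instance (A B C : SuperVect.{u}) : IsIso (assocInv A B C) :=
  ⟨assoc A B C, assocInv_comp_assoc A B C, assoc_comp_assocInv A B C⟩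

instance (A B C : SuperVect.{u}) : IsIso (assoc A B C) :=
  ⟨assocInv A B C, assoc_comp_assocInv A B C, assocInv_comp_assoc A B C⟩

instance (A B : SuperVect.{u}) : IsIso (flip A B) := ⟨flip B A, flip_flip A B, flip_flip B A⟩

instance (V : SuperVect.{u}) : IsIso V.parityHom :=
  ⟨V.parityHom, V.parityHom_comp_parityHom, V.parityHom_comp_parityHom⟩

lemma isIso_scale {z : ℂ} (hz : z ≠ 0) (V : SuperVect.{u}) : IsIso (scale z V) :=
  ⟨scale z⁻¹ V, by rw [scale_comp_scale, inv_mul_cancel₀ hz, scale_one],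
    by rw [scale_comp_scale, mul_inv_cancel₀ hz, scale_one]⟩

instance (A U B C : SuperVect.{u}) : IsIso (shuffle A U B C) := by
  unfold shuffle; infer_instance

end naturality

section unit

variable {V W : SuperVect.{u}}

lemma leftUnit_tmul (z : ULift.{u} ℂ) (v : V) : (leftUnit V).lin (z ⊗ₜ[ℂ] v) = z.down • v := rfl

lemma rightUnit_tmul (v : V) (z : ULift.{u} ℂ) : (rightUnit V).lin (v ⊗ₜ[ℂ] z) = z.down • v := by
  have hz : (z : unit.{u}) ∈ unit.{u}.even := Submodule.mem_top
  rw [rightUnit, comp_lin_apply, flip_tmul_of_even_right (W := unit) v hz, leftUnit_tmul]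

lemma leftUnit_natural (f : V ⟶ W) :
    tensorHom (𝟙 unit) f ≫ leftUnit W = leftUnit V ≫ f :=
  Hom.ext (TensorProduct.ext' fun z v => (f.lin.map_smul z.down v).symm)

lemma rightUnit_natural (f : V ⟶ W) :
    tensorHom f (𝟙 unit) ≫ rightUnit W = rightUnit V ≫ f := by
  rw [rightUnit, rightUnit, Category.assoc, ← leftUnit_natural, ← Category.assoc, tensorHom_flip,
    Category.assoc]

instance (V : SuperVect.{u}) : IsIso (leftUnit V) :=
  ⟨Hom.ofCommute (TensorProduct.mk ℂ unit.{u} V (ULift.up 1)) (LinearMap.ext fun v => by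
      rw [LinearMap.comp_apply, LinearMap.comp_apply, TensorProduct.mk_apply,
        TensorProduct.mk_apply, parity_tmul, parity_unit]
      rfl),
    Hom.ext (TensorProduct.ext' fun z v => by
      change (ULift.up (1 : ℂ) : ULift.{u} ℂ) ⊗ₜ[ℂ] (z.down • v) = z ⊗ₜ[ℂ] v
      rw [← smul_tmul]
      congr 1
      exact ULift.ext _ _ (mul_one z.down)),
    hom_ext fun v => one_smul ℂ v⟩

instance (V : SuperVect.{u}) : IsIso (rightUnit V) := by unfold rightUnit; infer_instance

lemma triangle (V W : SuperVect.{u}) :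
    assocInv V unit W ≫ tensorHom (rightUnit V) (𝟙 W) = tensorHom (𝟙 V) (leftUnit W) :=
  Hom.ext (TensorProduct.ext_threefold' fun v z w => by
    change (rightUnit V).lin (v ⊗ₜ[ℂ] z) ⊗ₜ[ℂ] w = v ⊗ₜ[ℂ] (z.down • w)
    rw [rightUnit_tmul, smul_tmul])

end unit

end SuperVect

namespace OddMetric
open OddOps SuperVect
variable {h : Type u} [AddCommGroup h] [Module ℂ h] [FiniteDimensional ℂ h] (S : OddMetric h)

section
variable {X X' Z Z' : SuperVect.{u}} (P : OddOps h X) (P' : OddOps h X') (Q : OddOps h Z)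
  (Q' : OddOps h Z') {A A' B B' C C' : SuperVect.{u}} [SuperCommute P P] [SuperCommute P' P']
  [SuperCommute Q Q] [SuperCommute Q' Q']

instance (c : ℂ) (P Q : OddOps h X) [SuperCommute P P] [SuperCommute P Q] [SuperCommute Q Q] :
    IsIso (S.expOmega c P Q) :=
  haveI := SuperCommute.symm P Q
  ⟨S.expOmega (-c) P Q, S.expOmega_comp_neg c P Q, S.expOmega_neg_comp c P Q⟩

instance : IsIso S.phi :=
  ⟨(HRep.envSpace h).parityHom ≫ S.phi, by
    rw [← Category.assoc, comp_parityHom, Category.assoc, phi_phi, parityHom_comp_parityHom], by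
    rw [Category.assoc, phi_phi, parityHom_comp_parityHom]⟩

instance : IsIso (S.alpha₀₁₀ P Q B) := by unfold alpha₀₁₀; infer_instance

instance : IsIso (S.alpha₁₀₁ P B C) := by unfold alpha₁₀₁; infer_instance

instance : IsIso (S.alpha₀₁₁ P B C) := by unfold alpha₀₁₁; infer_instance

instance : IsIso (S.alpha₁₁₀ P B C) := by unfold alpha₁₁₀; infer_instance

instance : IsIso (S.alpha₁₁₁ B C A) := by unfold alpha₁₁₁; infer_instance

instance : IsIso (S.beta₀₀ P Q) := by unfold beta₀₀; infer_instance

instance : IsIso (S.beta₀₁ P B) := by unfold beta₀₁; infer_instance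

instance : IsIso (S.beta₁₀ P B) := by unfold beta₁₀; infer_instance

instance : IsIso (S.beta₁₁ B C) := by
  have := isIso_scale (Complex.exp_ne_zero (-(Real.pi * Complex.I * S.pairs / 4))) (C ⊗ₛ B)
  unfold beta₁₁; infer_instance

lemma alpha₀₁₀_comp_alphaInv₀₁₀ : S.alpha₀₁₀ P Q B ≫ S.alphaInv₀₁₀ P Q B = 𝟙 _ := by
  rw [alpha₀₁₀, alphaInv₀₁₀, Category.assoc, assocInv_comp_assoc_assoc, expOmega_comp_neg]

lemma alpha₁₀₁_comp_alphaInv₁₀₁ : S.alpha₁₀₁ P B C ≫ S.alphaInv₁₀₁ P B C = 𝟙 _ := by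
  rw [alpha₁₀₁, alphaInv₁₀₁, Category.assoc,
    reassoc_of% (tensorHom_comp_tensorHom (𝟙 (HRep.envSpace h)) (assocInv B X C) (𝟙 _)),
    assocInv_comp_assoc, tensorHom_id_id, Category.id_comp, expOmega_comp_neg]

lemma alpha₀₁₁_comp_alphaInv₀₁₁ : S.alpha₀₁₁ P B C ≫ S.alphaInv₀₁₁ P B C = 𝟙 _ := by
  rw [alpha₀₁₁, alphaInv₀₁₁, Category.assoc,
    reassoc_of% (shuffle_comp_shuffleInv X (HRep.envSpace h) B C), expOmega_neg_comp]

lemma alpha₁₁₀_comp_alphaInv₁₁₀ : S.alpha₁₁₀ P B C ≫ S.alphaInv₁₁₀ P B C = 𝟙 _ := by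
  rw [alpha₁₁₀, alphaInv₁₁₀, Category.assoc, Category.assoc, assocInv_comp_assoc_assoc,
    reassoc_of% (tensorHom_comp_tensorHom (𝟙 (HRep.envSpace h)) (assocInv B C X) (𝟙 _)),
    assocInv_comp_assoc, tensorHom_id_id, Category.id_comp, expOmega_comp_neg]

lemma alpha₁₁₁_comp_alphaInv₁₁₁ : S.alpha₁₁₁ B C A ≫ S.alphaInv₁₁₁ B C A = 𝟙 _ := by
  rw [alpha₁₁₁, alphaInv₁₁₁, Category.assoc, Category.assoc, assocInv_comp_assoc_assoc,
    reassoc_of% (shuffle_comp_shuffleInv A (HRep.envSpace h) B C), tensorHom_comp_tensorHom,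
    tensorHom_comp_tensorHom, ← Category.assoc S.phi, comp_parityHom, Category.assoc, phi_phi,
    parityHom_comp_parityHom, Category.comp_id, Category.comp_id, tensorHom_id_id,
    tensorHom_id_id]

variable (f : X ⟶ X') (k : Z ⟶ Z') [Intertwines f P P'] [Intertwines k Q Q'] (a : A ⟶ A')
  (b : B ⟶ B') (c : C ⟶ C')

lemma alpha₀₁₀_natural : tensorHom f (tensorHom b k) ≫ S.alpha₀₁₀ P' Q' B' =
    S.alpha₀₁₀ P Q B ≫ tensorHom (tensorHom f b) k := by
  rw [alpha₀₁₀, tensorHom_expOmega, tensorHom_assocInv, alpha₀₁₀, Category.assoc]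

lemma alpha₁₀₁_natural : tensorHom (𝟙 _) (tensorHom b (tensorHom f c)) ≫ S.alpha₁₀₁ P' B' C' =
    S.alpha₁₀₁ P B C ≫ tensorHom (𝟙 _) (tensorHom (tensorHom b f) c) := by
  rw [alpha₁₀₁, tensorHom_expOmega, ← tensorHom_id_comp, tensorHom_assocInv, alpha₁₀₁,
    Category.assoc, ← tensorHom_id_comp]

lemma alpha₀₁₁_natural : tensorHom f (tensorHom (𝟙 _) (tensorHom b c)) ≫ S.alpha₀₁₁ P' B' C' =
    S.alpha₀₁₁ P B C ≫ tensorHom (𝟙 _) (tensorHom (tensorHom f b) c) := by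
  rw [alpha₀₁₁, tensorHom_expOmega, tensorHom_shuffle, alpha₀₁₁, Category.assoc]

lemma alpha₁₁₀_natural : tensorHom (𝟙 _) (tensorHom b (tensorHom c f)) ≫ S.alpha₁₁₀ P' B' C' =
    S.alpha₁₁₀ P B C ≫ tensorHom (tensorHom (𝟙 _) (tensorHom b c)) f := by
  rw [alpha₁₁₀, tensorHom_expOmega,
    reassoc_of% (tensorHom_comp_tensorHom (𝟙 (HRep.envSpace h)) (tensorHom b (tensorHom c f))
      (𝟙 _) (assocInv B' C' X')), tensorHom_assocInv, tensorHom_id_comp,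
    Category.assoc, tensorHom_assocInv, alpha₁₁₀, Category.assoc,
    Category.assoc]

lemma alpha₁₁₁_natural : tensorHom a (tensorHom (𝟙 _) (tensorHom b c)) ≫ S.alpha₁₁₁ B' C' A' =
    S.alpha₁₁₁ B C A ≫ tensorHom (tensorHom (𝟙 _) (tensorHom a b)) c := by
  rw [alpha₁₁₁, reassoc_of% (tensorHom_comp_tensorHom a
      (tensorHom (𝟙 (HRep.envSpace h)) (tensorHom b c)) (𝟙 _) (tensorHom S.phi (𝟙 _))),
    tensorHom_comp_tensorHom, Category.comp_id, Category.id_comp, alpha₁₁₁,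
    Category.assoc, Category.assoc, ← tensorHom_assocInv, ← reassoc_of% (tensorHom_shuffle a b c),
    reassoc_of% (tensorHom_comp_tensorHom (𝟙 A) (tensorHom S.phi (𝟙 _)) a),
    tensorHom_comp_tensorHom, Category.comp_id, Category.id_comp]

lemma beta₀₀_natural : tensorHom f k ≫ S.beta₀₀ P' Q' = S.beta₀₀ P Q ≫ tensorHom k f := by
  rw [beta₀₀, tensorHom_expOmega, tensorHom_flip, beta₀₀, Category.assoc]

lemma beta₀₁_natural : tensorHom f b ≫ S.beta₀₁ P' B' = S.beta₀₁ P B ≫ tensorHom b f := by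
  rw [beta₀₁, tensorHom_expOmega, tensorHom_flip, beta₀₁, Category.assoc]

lemma beta₁₀_natural : tensorHom b f ≫ S.beta₁₀ P' B' = S.beta₁₀ P B ≫ tensorHom f b := by
  rw [beta₁₀, reassoc_of% (tensorHom_comp_tensorHom b f (𝟙 B') X'.parityHom), comp_parityHom,
    ← reassoc_of% (tensorHom_comp_tensorHom (𝟙 B)
      X.parityHom b f), tensorHom_expOmega, tensorHom_flip, beta₁₀, Category.assoc, Category.assoc]

lemma beta₁₁_natural : tensorHom (𝟙 _) (tensorHom b c) ≫ S.beta₁₁ B' C' =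
    S.beta₁₁ B C ≫ tensorHom (𝟙 _) (tensorHom c b) := by
  rw [beta₁₁, reassoc_of% (tensorHom_comp_tensorHom (𝟙 (HRep.envSpace h)) (tensorHom b c)
      (𝟙 (HRep.envSpace h))), tensorHom_comp_tensorHom, Category.comp_id,
    comp_parityHom, ← Category.id_comp b, ← tensorHom_comp_tensorHom, tensorHom_id_comp,
    Category.assoc, tensorHom_expOmega, ← tensorHom_id_comp, ← Category.assoc (tensorHom b c),
    tensorHom_flip, beta₁₁, Category.assoc, Category.assoc, Category.id_comp, Category.assoc,
    ← scale_comp, ← tensorHom_id_comp, Category.assoc]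

/-- On the trivial representation all exponentials are trivial. -/
lemma alpha₁₀₁_zero : S.alpha₁₀₁ (0 : OddOps h X) B C =
    tensorHom (𝟙 (HRep.envSpace h)) (assocInv B X C) := by
  rw [alpha₁₀₁, onLeft_zero, onRight_zero, onRight_zero, expOmega_zero_right, Category.id_comp]

end

end OddMetric

/-! ### The monoidal category -/

namespace GradedCat
open SuperVect
variable {h : Type u} [AddCommGroup h] [Module ℂ h]

/-- The faithful functor which sends an object of either component to the underlying super-vector
space. Equations and invertibility in `C` are checked after applying it. -/
def space (h : Type u) [AddCommGroup h] [Module ℂ h] : GradedCat h ⥤ SuperVect.{u} where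
  obj
    | Sum.inl A => A.space
    | Sum.inr A => A
  map := fun {A B} f => match A, B, f with
    | Sum.inl _, Sum.inl _, f => f.down.hom
    | Sum.inr _, Sum.inr _, f => f.down
  map_id := by rintro (A | A) <;> rfl
  map_comp := by
    rintro (A | A) (B | B) (C | C) f g <;>
      first
      | exact PEmpty.elim f
      | exact PEmpty.elim g
      | rfl

instance : (space h).Faithful where
  map_injective := by
    rintro (A | A) (B | B) f g H
    · exact congrArg ULift.up (HRep.Hom.ext H)
    · exact PEmpty.elim f
    · exact PEmpty.elim f
    · exact congrArg ULift.up H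

instance : (space h).ReflectsIsomorphisms where
  reflects := by
    rintro (A | A) (B | B) f ⟨g, h₁, h₂⟩
    · have e₁ : ∀ v, g.lin (f.down.hom.lin v) = v := congr_lin h₁
      have e₂ : ∀ v, f.down.hom.lin (g.lin v) = v := congr_lin h₂
      exact ⟨hom₀ (HRep.Hom.mk g fun a v => by
        conv_lhs => rw [← e₂ v]
        exact (congrArg g.lin (f.down.comm a (g.lin v)).symm).trans (e₁ _)),
        congrArg ULift.up (HRep.Hom.ext h₁), congrArg ULift.up (HRep.Hom.ext h₂)⟩
    · exact PEmpty.elim f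
    · exact PEmpty.elim f
    · exact ⟨hom₁ g, congrArg ULift.up h₁, congrArg ULift.up h₂⟩

lemma hom_ext {A B : GradedCat h} {f g : A ⟶ B} (H : (space h).map f = (space h).map g) : f = g :=
  (space h).map_injective H

lemma isIso_of_space {A B : GradedCat h} {f : A ⟶ B} (H : IsIso ((space h).map f)) : IsIso f :=
  isIso_of_reflects_iso f (space h)

/-- An equation in `C` which contains the inverse of a morphism can be checked on underlying
super-vector spaces, with any one-sided inverse there. -/
lemma comp_inv_comp_eq_of_space {X₁ X₂ X₃ X₄ X₅ X₆ : GradedCat h} {a : X₁ ⟶ X₂} {b : X₂ ⟶ X₃}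
    {i : X₄ ⟶ X₃} [IsIso i] {c : X₄ ⟶ X₅} {d : X₅ ⟶ X₆} {e : X₁ ⟶ X₆}
    (g : (space h).obj X₃ ⟶ (space h).obj X₄) (hg : (space h).map i ≫ g = 𝟙 _)
    (H : (space h).map a ≫ (space h).map b ≫ g ≫ (space h).map c ≫ (space h).map d =
      (space h).map e) : a ≫ b ≫ inv i ≫ c ≫ d = e := by
  refine hom_ext ?_
  have hi : (space h).map (inv i) = g := by
    rw [← cancel_epi ((space h).map i), hg, ← Functor.map_comp, IsIso.hom_inv_id,
      CategoryTheory.Functor.map_id]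
  rw [Functor.map_comp, Functor.map_comp, Functor.map_comp, Functor.map_comp, hi, H]

lemma ast_id (A B : GradedCat h) : astHom (𝟙 A) (𝟙 B) = 𝟙 (ast A B) := by
  refine hom_ext ?_
  rcases A with A | A <;> rcases B with B | B
  · exact tensorHom_id_id (V := A.space) (W := B.space)
  · exact tensorHom_id_id (V := A.space) (W := B)
  · exact tensorHom_id_id (V := A) (W := B.space)
  · exact (congrArg (tensorHom (𝟙 (HRep.envSpace h))) tensorHom_id_id).trans
      tensorHom_id_id

lemma ast_comp {A A' A'' B B' B'' : GradedCat h} (f : A ⟶ A') (f' : A' ⟶ A'') (g : B ⟶ B')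
    (g' : B' ⟶ B'') : astHom (f ≫ f') (g ≫ g') = astHom f g ≫ astHom f' g' := by
  refine hom_ext ?_
  rcases A with A | A <;> rcases A' with A' | A' <;> rcases A'' with A'' | A'' <;>
    first
    | exact PEmpty.elim f
    | exact PEmpty.elim f'
    | skip
  all_goals
    rcases B with B | B <;> rcases B' with B' | B' <;> rcases B'' with B'' | B'' <;>
      first
      | exact PEmpty.elim g
      | exact PEmpty.elim g'
      | skip
  · exact (tensorHom_comp_tensorHom f.down.hom g.down.hom f'.down.hom g'.down.hom).symm
  · exact (tensorHom_comp_tensorHom f.down.hom g.down f'.down.hom g'.down).symm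
  · exact (tensorHom_comp_tensorHom f.down g.down.hom f'.down g'.down.hom).symm
  · exact (congrArg (tensorHom (𝟙 (HRep.envSpace h)))
      (tensorHom_comp_tensorHom f.down g.down f'.down g'.down).symm).trans (tensorHom_id_comp _ _)

lemma leftUnit_isIso (A : GradedCat h) : IsIso (leftUnit A) := by
  refine isIso_of_space ?_
  rcases A with A | A
  · exact (inferInstance : IsIso (SuperVect.leftUnit A.space))
  · exact (inferInstance : IsIso (SuperVect.leftUnit A))

lemma rightUnit_isIso (A : GradedCat h) : IsIso (rightUnit A) := by
  refine isIso_of_space ?_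
  rcases A with A | A
  · exact (inferInstance : IsIso (SuperVect.rightUnit A.space))
  · exact (inferInstance : IsIso (SuperVect.rightUnit A))

lemma leftUnit_natural {A B : GradedCat h} (f : A ⟶ B) :
    astHom (𝟙 (one h)) f ≫ leftUnit B = leftUnit A ≫ f := by
  refine hom_ext ?_
  rcases A with A | A <;> rcases B with B | B
  · exact SuperVect.leftUnit_natural f.down.hom
  · exact PEmpty.elim f
  · exact PEmpty.elim f
  · exact SuperVect.leftUnit_natural f.down

lemma rightUnit_natural {A B : GradedCat h} (f : A ⟶ B) :
    astHom f (𝟙 (one h)) ≫ rightUnit B = rightUnit A ≫ f := by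
  refine hom_ext ?_
  rcases A with A | A <;> rcases B with B | B
  · exact SuperVect.rightUnit_natural f.down.hom
  · exact PEmpty.elim f
  · exact PEmpty.elim f
  · exact SuperVect.rightUnit_natural f.down

end GradedCat

namespace OddMetric
open OddOps SuperVect GradedCat
variable {h : Type u} [AddCommGroup h] [Module ℂ h] [FiniteDimensional ℂ h] (S : OddMetric h)

lemma associator_isIso (A B C : GradedCat h) : IsIso (S.associator A B C) := by
  refine isIso_of_space ?_
  rcases A with A | A <;> rcases B with B | B <;> rcases C with C | C
  · exact (inferInstance : IsIso (assocInv A.space B.space C.space))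
  · exact (inferInstance : IsIso (assocInv A.space B.space C))
  · exact (inferInstance : IsIso (S.alpha₀₁₀ A.act C.act B))
  · change IsIso (S.assoc₀₁₁ A B C)
    rw [assoc₀₁₁_eq]
    exact (inferInstance : IsIso (S.alpha₀₁₁ A.act B C))
  · exact (inferInstance : IsIso (assocInv A B.space C.space))
  · exact (inferInstance : IsIso (S.alpha₁₀₁ B.act A C))
  · change IsIso (S.assoc₁₁₀ A B C)
    rw [assoc₁₁₀_eq]
    exact (inferInstance : IsIso (S.alpha₁₁₀ C.act A B))
  · change IsIso (S.assoc₁₁₁ A B C)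
    rw [assoc₁₁₁_eq]
    exact (inferInstance : IsIso (S.alpha₁₁₁ B C A))

lemma associator_natural {A A' B B' C C' : GradedCat h} (f : A ⟶ A') (g : B ⟶ B')
    (k : C ⟶ C') : astHom f (astHom g k) ≫ S.associator A' B' C' =
      S.associator A B C ≫ astHom (astHom f g) k := by
  refine hom_ext ?_
  rcases A with A | A <;> rcases A' with A' | A' <;>
    first
    | exact PEmpty.elim f
    | skip
  all_goals
    rcases B with B | B <;> rcases B' with B' | B' <;>
      first
      | exact PEmpty.elim g
      | skip
  all_goals
    rcases C with C | C <;> rcases C' with C' | C' <;>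
      first
      | exact PEmpty.elim k
      | skip
  · exact tensorHom_assocInv f.down.hom g.down.hom k.down.hom
  · exact tensorHom_assocInv f.down.hom g.down.hom k.down
  · exact S.alpha₀₁₀_natural A.act A'.act C.act C'.act f.down.hom k.down.hom g.down
  · change tensorHom f.down.hom (tensorHom (𝟙 _) (tensorHom g.down k.down)) ≫ S.assoc₀₁₁ A' B' C' =
      S.assoc₀₁₁ A B C ≫ tensorHom (𝟙 _) (tensorHom (tensorHom f.down.hom g.down) k.down)
    rw [assoc₀₁₁_eq, assoc₀₁₁_eq]
    exact S.alpha₀₁₁_natural A.act A'.act f.down.hom g.down k.down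
  · exact tensorHom_assocInv f.down g.down.hom k.down.hom
  · exact S.alpha₁₀₁_natural B.act B'.act g.down.hom f.down k.down
  · change tensorHom (𝟙 _) (tensorHom f.down (tensorHom g.down k.down.hom)) ≫
        S.assoc₁₁₀ A' B' C' =
      S.assoc₁₁₀ A B C ≫ tensorHom (tensorHom (𝟙 _) (tensorHom f.down g.down)) k.down.hom
    rw [assoc₁₁₀_eq, assoc₁₁₀_eq]
    exact S.alpha₁₁₀_natural C.act C'.act k.down.hom f.down g.down
  · change tensorHom f.down (tensorHom (𝟙 _) (tensorHom g.down k.down)) ≫ S.assoc₁₁₁ A' B' C' =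
      S.assoc₁₁₁ A B C ≫ tensorHom (tensorHom (𝟙 _) (tensorHom f.down g.down)) k.down
    rw [assoc₁₁₁_eq, assoc₁₁₁_eq]
    exact S.alpha₁₁₁_natural f.down g.down k.down

lemma triangle (A B : GradedCat h) :
    S.associator A (one h) B ≫ astHom (rightUnit A) (𝟙 B) = astHom (𝟙 A) (leftUnit B) := by
  refine hom_ext ?_
  rcases A with A | A <;> rcases B with B | B
  · exact SuperVect.triangle A.space B.space
  · exact SuperVect.triangle A.space B
  · exact SuperVect.triangle A B.space
  · change S.alpha₁₀₁ (0 : OddOps h unit) A B ≫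
      tensorHom (𝟙 _) (tensorHom (SuperVect.rightUnit A) (𝟙 B)) =
        tensorHom (𝟙 _) (tensorHom (𝟙 A) (SuperVect.leftUnit B))
    rw [alpha₁₀₁_zero, ← tensorHom_id_comp, SuperVect.triangle]

lemma pentagon (A B C D : GradedCat h) :
    astHom (𝟙 A) (S.associator B C D) ≫ S.associator A (ast B C) D ≫
        astHom (S.associator A B C) (𝟙 D) =
      S.associator A B (ast C D) ≫ S.associator (ast A B) C D := by
  refine hom_ext ?_
  rcases A with A | A <;> rcases B with B | B <;> rcases C with C | C <;> rcases D with D | D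
  · exact assocInv_pentagon A.space B.space C.space D.space
  · exact assocInv_pentagon A.space B.space C.space D
  · exact S.pentagon₀₀₁₀ A.act B.act D.act (C := C)
  · change tensorHom (𝟙 _) (S.assoc₀₁₁ B C D) ≫ S.assoc₀₁₁ A (B.space ⊗ₛ C) D ≫
        tensorHom (𝟙 _) (tensorHom (assocInv A.space B.space C) (𝟙 D)) =
      assocInv A.space B.space (HRep.envSpace h ⊗ₛ (C ⊗ₛ D)) ≫ S.assoc₀₁₁ (A ⊗ᵣ B) C D
    rw [assoc₀₁₁_eq, assoc₀₁₁_eq, assoc₀₁₁_eq]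
    exact S.pentagon₀₀₁₁ A.act B.act
  · exact S.pentagon₀₁₀₀ A.act C.act D.act (B := B)
  · change tensorHom (𝟙 _) (S.alpha₁₀₁ C.act B D) ≫ S.assoc₀₁₁ A (B ⊗ₛ C.space) D ≫
        tensorHom (𝟙 _) (tensorHom (S.alpha₀₁₀ A.act C.act B) (𝟙 D)) =
      S.assoc₀₁₁ A B (C.space ⊗ₛ D) ≫ S.alpha₁₀₁ C.act (A.space ⊗ₛ B) D
    rw [assoc₀₁₁_eq, assoc₀₁₁_eq]
    exact S.pentagon₀₁₀₁ A.act C.act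
  · change tensorHom (𝟙 _) (S.assoc₁₁₀ B C D) ≫
        assocInv A.space (HRep.envSpace h ⊗ₛ (B ⊗ₛ C)) D.space ≫
        tensorHom (S.assoc₀₁₁ A B C) (𝟙 D.space) =
      S.assoc₀₁₁ A B (C ⊗ₛ D.space) ≫ S.assoc₁₁₀ (A.space ⊗ₛ B) C D
    rw [assoc₀₁₁_eq, assoc₀₁₁_eq, assoc₁₁₀_eq, assoc₁₁₀_eq]
    exact S.pentagon₀₁₁₀ A.act D.act
  · change tensorHom (𝟙 _) (S.assoc₁₁₁ B C D) ≫
        assocInv A.space (HRep.envSpace h ⊗ₛ (B ⊗ₛ C)) D ≫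
        tensorHom (S.assoc₀₁₁ A B C) (𝟙 D) =
      S.alpha₀₁₀ A.act (HRep.env h ⊗ᵣ HRep.triv h (C ⊗ₛ D)).act B ≫
        S.assoc₁₁₁ (A.space ⊗ₛ B) C D
    rw [assoc₀₁₁_eq, assoc₁₁₁_eq, assoc₁₁₁_eq, tensor_triv_act_eq]
    exact S.pentagon₀₁₁₁ A.act
  · exact assocInv_pentagon A B.space C.space D.space
  · exact S.pentagon₁₀₀₁ B.act C.act (A := A) (D := D)
  · change tensorHom (𝟙 _) (tensorHom (𝟙 A) (S.alpha₀₁₀ B.act D.act C)) ≫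
        S.assoc₁₁₀ A (B.space ⊗ₛ C) D ≫ tensorHom (S.alpha₁₀₁ B.act A C) (𝟙 D.space) =
      S.alpha₁₀₁ B.act A (C ⊗ₛ D.space) ≫ S.assoc₁₁₀ (A ⊗ₛ B.space) C D
    rw [assoc₁₁₀_eq, assoc₁₁₀_eq]
    exact S.pentagon₁₀₁₀ B.act D.act
  · change tensorHom (𝟙 A) (S.assoc₀₁₁ B C D) ≫ S.assoc₁₁₁ A (B.space ⊗ₛ C) D ≫
        tensorHom (S.alpha₁₀₁ B.act A C) (𝟙 D) =
      assocInv A B.space (HRep.envSpace h ⊗ₛ (C ⊗ₛ D)) ≫ S.assoc₁₁₁ (A ⊗ₛ B.space) C D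
    rw [assoc₀₁₁_eq, assoc₁₁₁_eq, assoc₁₁₁_eq]
    exact S.pentagon₁₀₁₁ B.act
  · change tensorHom (𝟙 _) (tensorHom (𝟙 A) (assocInv B C.space D.space)) ≫
        S.assoc₁₁₀ A (B ⊗ₛ C.space) D ≫ tensorHom (S.assoc₁₁₀ A B C) (𝟙 D.space) =
      S.assoc₁₁₀ A B (C ⊗ᵣ D) ≫ assocInv (HRep.envSpace h ⊗ₛ (A ⊗ₛ B)) C.space D.space
    rw [assoc₁₁₀_eq, assoc₁₁₀_eq, assoc₁₁₀_eq]
    exact S.pentagon₁₁₀₀ C.act D.act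
  · change tensorHom (𝟙 A) (S.alpha₁₀₁ C.act B D) ≫ S.assoc₁₁₁ A (B ⊗ₛ C.space) D ≫
        tensorHom (S.assoc₁₁₀ A B C) (𝟙 D) =
      S.assoc₁₁₁ A B (C.space ⊗ₛ D) ≫ assocInv (HRep.envSpace h ⊗ₛ (A ⊗ₛ B)) C.space D
    rw [assoc₁₁₀_eq, assoc₁₁₁_eq, assoc₁₁₁_eq]
    exact S.pentagon₁₁₀₁ C.act
  · change tensorHom (𝟙 A) (S.assoc₁₁₀ B C D) ≫
        assocInv A (HRep.envSpace h ⊗ₛ (B ⊗ₛ C)) D.space ≫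
        tensorHom (S.assoc₁₁₁ A B C) (𝟙 D.space) =
      S.assoc₁₁₁ A B (C ⊗ₛ D.space) ≫
        S.alpha₀₁₀ (HRep.env h ⊗ᵣ HRep.triv h (A ⊗ₛ B)).act D.act C
    rw [assoc₁₁₀_eq, assoc₁₁₁_eq, assoc₁₁₁_eq, tensor_triv_act_eq]
    exact S.pentagon₁₁₁₀ D.act
  · change tensorHom (𝟙 _) (tensorHom (𝟙 A) (S.assoc₁₁₁ B C D)) ≫
        S.alpha₁₀₁ (HRep.env h ⊗ᵣ HRep.triv h (B ⊗ₛ C)).act A D ≫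
        tensorHom (𝟙 _) (tensorHom (S.assoc₁₁₁ A B C) (𝟙 D)) =
      S.assoc₁₁₀ A B (HRep.env h ⊗ᵣ HRep.triv h (C ⊗ₛ D)) ≫
        S.assoc₀₁₁ (HRep.env h ⊗ᵣ HRep.triv h (A ⊗ₛ B)) C D
    rw [assoc₁₁₀_eq, assoc₀₁₁_eq, assoc₁₁₁_eq, assoc₁₁₁_eq, tensor_triv_act_eq, tensor_triv_act_eq,
      tensor_triv_act_eq]
    exact S.pentagon₁₁₁₁

lemma isMonoidal : S.IsMonoidal where
  ast_id := ast_id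
  ast_comp := ast_comp
  associator_isIso := S.associator_isIso
  associator_natural := S.associator_natural
  leftUnit_isIso := leftUnit_isIso
  leftUnit_natural := leftUnit_natural
  rightUnit_isIso := rightUnit_isIso
  rightUnit_natural := rightUnit_natural
  pentagon := S.pentagon
  triangle := S.triangle

end OddMetric

/-! ### The braiding -/

namespace OddMetric
open OddOps SuperVect GradedCat
variable {h : Type u} [AddCommGroup h] [Module ℂ h] [FiniteDimensional ℂ h] (S : OddMetric h)

lemma braid_isIso (A B : GradedCat h) : IsIso (S.braid A B) := by
  refine isIso_of_space ?_
  rcases A with A | A <;> rcases B with B | B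
  · exact (inferInstance : IsIso (S.beta₀₀ A.act B.act))
  · exact (inferInstance : IsIso (S.beta₀₁ A.act B))
  · exact (inferInstance : IsIso (S.beta₁₀ B.act A))
  · exact (inferInstance : IsIso (S.beta₁₁ A B))

lemma braid_natural {A A' B B' : GradedCat h} (f : A ⟶ A') (g : B ⟶ B') :
    astHom f g ≫ S.braid A' B' = S.braid A B ≫ astHom g f := by
  refine hom_ext ?_
  rcases A with A | A <;> rcases A' with A' | A' <;>
    first
    | exact PEmpty.elim f
    | skip
  all_goals
    rcases B with B | B <;> rcases B' with B' | B' <;>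
      first
      | exact PEmpty.elim g
      | skip
  · exact S.beta₀₀_natural A.act A'.act B.act B'.act f.down.hom g.down.hom
  · exact S.beta₀₁_natural A.act A'.act f.down.hom g.down
  · exact S.beta₁₀_natural B.act B'.act g.down.hom f.down
  · exact S.beta₁₁_natural f.down g.down

lemma hexagon_forward (A B C : GradedCat h) :
    haveI := S.associator_isIso B A C
    S.associator A B C ≫ astHom (S.braid A B) (𝟙 C) ≫ inv (S.associator B A C) ≫
        astHom (𝟙 B) (S.braid A C) ≫ S.associator B C A = S.braid A (ast B C) := by
  have := S.associator_isIso B A C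
  rcases A with A | A <;> rcases B with B | B <;> rcases C with C | C
  · exact comp_inv_comp_eq_of_space (assoc B.space A.space C.space) (assocInv_comp_assoc _ _ _)
      (S.hexagon_forward₀₀₀ A.act B.act C.act)
  · exact comp_inv_comp_eq_of_space (assoc B.space A.space C) (assocInv_comp_assoc _ _ _)
      (S.hexagon_forward₀₀₁ A.act B.act (C := C))
  · exact comp_inv_comp_eq_of_space (assoc B A.space C.space) (assocInv_comp_assoc _ _ _)
      (S.hexagon_forward₀₁₀ A.act C.act (B := B))
  · refine comp_inv_comp_eq_of_space (S.alphaInv₁₀₁ A.act B C)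
      (S.alpha₁₀₁_comp_alphaInv₁₀₁ A.act) ?_
    change S.assoc₀₁₁ A B C ≫ tensorHom (𝟙 _) (tensorHom (S.beta₀₁ A.act B) (𝟙 C)) ≫
      S.alphaInv₁₀₁ A.act B C ≫ tensorHom (𝟙 _) (tensorHom (𝟙 B) (S.beta₀₁ A.act C)) ≫
      S.assoc₁₁₀ B C A = S.beta₀₀ A.act (HRep.env h ⊗ᵣ HRep.triv h (B ⊗ₛ C)).act
    rw [assoc₀₁₁_eq, assoc₁₁₀_eq, tensor_triv_act_eq]
    exact S.hexagon_forward₀₁₁ A.act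
  · exact comp_inv_comp_eq_of_space (S.alphaInv₀₁₀ B.act C.act A)
      (S.alpha₀₁₀_comp_alphaInv₀₁₀ B.act C.act) (S.hexagon_forward₁₀₀ B.act C.act (A := A))
  · refine comp_inv_comp_eq_of_space (S.alphaInv₀₁₁ B.act A C) ?_ ?_
    · change S.assoc₀₁₁ B A C ≫ _ = _
      rw [assoc₀₁₁_eq]
      exact S.alpha₀₁₁_comp_alphaInv₀₁₁ B.act
    · change S.alpha₁₀₁ B.act A C ≫ tensorHom (𝟙 _) (tensorHom (S.beta₁₀ B.act A) (𝟙 C)) ≫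
        S.alphaInv₀₁₁ B.act A C ≫ tensorHom (𝟙 B.space) (S.beta₁₁ A C) ≫ S.assoc₀₁₁ B C A =
          S.beta₁₁ A (B.space ⊗ₛ C)
      rw [assoc₀₁₁_eq]
      exact S.hexagon_forward₁₀₁ B.act
  · refine comp_inv_comp_eq_of_space (S.alphaInv₁₁₀ C.act B A) ?_ ?_
    · change S.assoc₁₁₀ B A C ≫ _ = _
      rw [assoc₁₁₀_eq]
      exact S.alpha₁₁₀_comp_alphaInv₁₁₀ C.act
    · change S.assoc₁₁₀ A B C ≫ tensorHom (S.beta₁₁ A B) (𝟙 C.space) ≫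
        S.alphaInv₁₁₀ C.act B A ≫ tensorHom (𝟙 _) (tensorHom (𝟙 B) (S.beta₁₀ C.act A)) ≫
        S.alpha₁₀₁ C.act B A = S.beta₁₁ A (B ⊗ₛ C.space)
      rw [assoc₁₁₀_eq]
      exact S.hexagon_forward₁₁₀ C.act
  · refine comp_inv_comp_eq_of_space (S.alphaInv₁₁₁ A C B) ?_ ?_
    · change S.assoc₁₁₁ B A C ≫ _ = _
      rw [assoc₁₁₁_eq]
      exact S.alpha₁₁₁_comp_alphaInv₁₁₁
    · change S.assoc₁₁₁ A B C ≫ tensorHom (S.beta₁₁ A B) (𝟙 C) ≫ S.alphaInv₁₁₁ A C B ≫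
        tensorHom (𝟙 B) (S.beta₁₁ A C) ≫ S.assoc₁₁₁ B C A =
          S.beta₁₀ (HRep.env h ⊗ᵣ HRep.triv h (B ⊗ₛ C)).act A
      rw [assoc₁₁₁_eq, assoc₁₁₁_eq, tensor_triv_act_eq]
      exact S.hexagon_forward₁₁₁ A B C

lemma hexagon_reverse (A B C : GradedCat h) :
    S.associator A B C ≫ S.braid (ast A B) C ≫ S.associator C A B =
      astHom (𝟙 A) (S.braid B C) ≫ S.associator A C B ≫ astHom (S.braid A C) (𝟙 B) := by
  refine hom_ext ?_
  rcases A with A | A <;> rcases B with B | B <;> rcases C with C | C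
  · exact S.hexagon_reverse₀₀₀ A.act B.act C.act
  · exact S.hexagon_reverse₀₀₁ A.act B.act (C := C)
  · exact S.hexagon_reverse₀₁₀ A.act C.act (B := B)
  · change S.assoc₀₁₁ A B C ≫ S.beta₁₁ (A.space ⊗ₛ B) C ≫ S.alpha₁₀₁ A.act C B =
      tensorHom (𝟙 A.space) (S.beta₁₁ B C) ≫ S.assoc₀₁₁ A C B ≫
        tensorHom (𝟙 _) (tensorHom (S.beta₀₁ A.act C) (𝟙 B))
    rw [assoc₀₁₁_eq, assoc₀₁₁_eq]
    exact S.hexagon_reverse₀₁₁ A.act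
  · exact S.hexagon_reverse₁₀₀ B.act C.act (A := A)
  · change S.alpha₁₀₁ B.act A C ≫ S.beta₁₁ (A ⊗ₛ B.space) C ≫ S.assoc₁₁₀ C A B =
      tensorHom (𝟙 _) (tensorHom (𝟙 A) (S.beta₀₁ B.act C)) ≫ S.assoc₁₁₀ A C B ≫
        tensorHom (S.beta₁₁ A C) (𝟙 B.space)
    rw [assoc₁₁₀_eq, assoc₁₁₀_eq]
    exact S.hexagon_reverse₁₀₁ B.act
  · change S.assoc₁₁₀ A B C ≫ S.beta₀₀ (HRep.env h ⊗ᵣ HRep.triv h (A ⊗ₛ B)).act C.act ≫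
        S.assoc₀₁₁ C A B =
      tensorHom (𝟙 _) (tensorHom (𝟙 A) (S.beta₁₀ C.act B)) ≫ S.alpha₁₀₁ C.act A B ≫
        tensorHom (𝟙 _) (tensorHom (S.beta₁₀ C.act A) (𝟙 B))
    rw [assoc₁₁₀_eq, assoc₀₁₁_eq, tensor_triv_act_eq]
    exact S.hexagon_reverse₁₁₀ C.act
  · change S.assoc₁₁₁ A B C ≫ S.beta₀₁ (HRep.env h ⊗ᵣ HRep.triv h (A ⊗ₛ B)).act C ≫
        S.assoc₁₁₁ C A B =
      tensorHom (𝟙 A) (S.beta₁₁ B C) ≫ S.assoc₁₁₁ A C B ≫ tensorHom (S.beta₁₁ A C) (𝟙 B)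
    rw [assoc₁₁₁_eq, assoc₁₁₁_eq, assoc₁₁₁_eq, tensor_triv_act_eq]
    exact S.hexagon_reverse₁₁₁ A B C

/-- The braided category `(C, ∗, α, c)`. -/
@[reducible]
def braidedCategory : @BraidedCategory (GradedCat h) _ (S.monoidalCategory S.isMonoidal) :=
  letI := S.monoidalCategory S.isMonoidal
  { braiding := fun A B =>
      haveI := S.braid_isIso A B
      asIso (S.braid A B)
    braiding_naturality_right := fun A _ _ f => S.braid_natural (𝟙 A) f
    braiding_naturality_left := fun f B => S.braid_natural f (𝟙 B)
    hexagon_forward := fun A B C => by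
      have := S.associator_isIso
      change inv (S.associator A B C) ≫ S.braid A (ast B C) ≫ inv (S.associator B C A) =
        astHom (S.braid A B) (𝟙 C) ≫ inv (S.associator B A C) ≫ astHom (𝟙 B) (S.braid A C)
      rw [IsIso.inv_comp_eq, IsIso.comp_inv_eq, ← S.hexagon_forward]
      simp only [Category.assoc]
    hexagon_reverse := fun A B C => S.hexagon_reverse A B C }

end OddMetric

end

end SymplecticFermions

/-- For a finite-dimensional purely odd metric abelian Lie super-algebra `h`, the explicit data
`(C, ∗, α)` form a monoidal category, and the explicit family `c` is a braiding on it: the `c_{A,B}`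
are natural isomorphisms which satisfy both hexagon identities, for all objects of `C`. -/
theorem theorem5p3 {h : Type u} [AddCommGroup h] [Module ℂ h] [FiniteDimensional ℂ h]
    (S : SymplecticFermions.OddMetric h) :
    ∃ H : S.IsMonoidal,
      ∃ Br : @CategoryTheory.BraidedCategory (SymplecticFermions.GradedCat h) _
          (S.monoidalCategory H),
        ∀ A B : SymplecticFermions.GradedCat h, (Br.braiding A B).hom = S.braid A B :=
  ⟨S.isMonoidal, S.braidedCategory, fun _ _ => rfl⟩
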